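/- Let $\mathbb F$ be a field of characteristic zero. A finite root system $R$ in an $\mathbb F$-vector space contains $0$ and may be non-reduced; $R^\times=R\setminus\{0\}$, $R_{sdiv}=(R\setminus\{\alpha\in R\mid 2\alpha\in R\})\cup\{0\}$, and $R_{sh}\subseteq R^\times$ is the set of nonzero roots of minimal length with respect to a Weyl-invariant form that is positive on nonzero roots. A subsystem $S\ni 0$ of $R$ is full if $\operatorname{span}_{\mathbb F}S\cap R=S$. A module $\mathcal M$ over a Lie algebra $\mathcal H$ has a weight space decomposition if $\mathcal M=\bigoplus_{\alpha\in\mathcal H^*}\mathcal M_\alpha$ with $\mathcal M_\alpha=\{x\mid h\cdot x=\alpha(h)x\ \forall h\in\mathcal H\}$; its weights are the $\alpha$ with $\mathcal M_\alpha\ne 0$. Let $\mathcal G_1$ be a finite dimensional split simple Lie algebra over $\mathbb F$ with splitting Cartan subalgebra $\mathcal H_1$, let $R_1\subset\mathcal H_1^*$ be an irreducible finite root system such that the root system of $\mathcal G_1$ with respect to $\mathcal H_1$ is $(R_1)_{sdiv}$, and let $R_2$ be an irreducible full subsystem of $R_1$ of rank greater than $1$. Put $$\mathcal G_2=\sum_{\alpha\in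 (R_2)_{sdiv}^\times}(\mathcal G_1)_\alpha\oplus\sum_{\alpha\in (R_2)_{sdiv}^\times}[(\mathcal G_1)_\alpha,(\mathcal G_1)_{-\alpha}],$$ which is a Lie subalgebra of $\mathcal G_1$, and $\mathcal H_2=\mathcal H_1\cap\mathcal G_2$. Let $\mathcal V_1$ be a $\mathcal G_1$-module and $\mathcal V_2\subseteq\mathcal V_1$ a $\mathcal G_2$-submodule such that, for $i=1,2$, $\mathcal V_i$ has a weight space decomposition with respect to $\mathcal H_i$, with set of weights $\Lambda_i$. Suppose that (i) $R_1$ and $R_2$ are of the same type, which is one of $A$, $B$, $C$, $D$, $BC$; (ii) $\Lambda_1\subseteq R_1$ and $\Lambda_2\subseteq\{\alpha|_{\mathcal H_2}\mid\alpha\in R_2\}$; (iii) $(\mathcal V_2)_{\alpha|_{\mathcal H_2}}\subseteq(\mathcal V_1)_\alpha$ for every nonzero $\alpha\in R_2$ with $\alpha|_{\mathcal H_2}\in\Lambda_2$. Let $\mathcal W$ be a nontrivial finite dimensional irreducible $\mathcal G_2$-submodule of $\mathcal V_2$ and let $\mathcal U$ be the $\mathcal G_1$-submodule of $\mathcal V_1$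 generated by $\mathcal W$. Then $\mathcal U$ is a finite dimensional irreducible $\mathcal G_1$-module that has a weight space decomposition with respect to $\mathcal H_1$. Moreover, the set of nonzero weights of $\mathcal U$ is $(R_1)_{sh}$ (resp. $(R_1)_{sdiv}^\times$, resp. $((R_1)_{sdiv})_{sh}$) if the set of nonzero weights of $\mathcal W$ is the set of restrictions to $\mathcal H_2$ of the elements of $(R_2)_{sh}$ (resp. $(R_2)_{sdiv}^\times$, resp. $((R_2)_{sdiv})_{sh}$). -/

import Mathlib

open Module

namespace RootGraded

/-! ### Weight spaces -/

section Weights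

variable {F K M : Type*} [Field F] [LieRing K] [LieAlgebra F K]
  [AddCommGroup M] [Module F M] [LieRingModule K M] [LieModule F K M]

/-- The space `M_α = {m | h • m = α(h) m for all h ∈ K}` of a `K`-module `M`, for `α ∈ K*`. -/
def weightSpace (K M : Type*) [LieRing K] [LieAlgebra F K] [AddCommGroup M] [Module F M]
    [LieRingModule K M] [LieModule F K M] (α : Dual F K) : Submodule F M where
  carrier := {m | ∀ h : K, ⁅h, m⁆ = α h • m}
  add_mem' := by
    intro a b ha hb h
    rw [lie_add, ha h, hb h, smul_add]
  zero_mem' := by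
    intro h
    simp
  smul_mem' := by
    intro c m hm h
    rw [lie_smul, hm h, smul_comm]

theorem mem_weightSpace {α : Dual F K} {m : M} :
    m ∈ weightSpace K M α ↔ ∀ h : K, ⁅h, m⁆ = α h • m := Iff.rfl

/-- The set of weights of the `K`-module `M`. -/
def weights (F K M : Type*) [Field F] [LieRing K] [LieAlgebra F K] [AddCommGroup M] [Module F M]
    [LieRingModule K M] [LieModule F K M] : Set (Dual F K) :=
  {α | weightSpace K M α ≠ ⊥}

/-- The set of nonzero weights of the `K`-module `M`. -/
def nonzeroWeights (F K M : Type*) [Field F] [LieRing K] [LieAlgebra F K] [AddCommGroup M]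
    [Module F M] [LieRingModule K M] [LieModule F K M] : Set (Dual F K) :=
  weights F K M \ {0}

open Classical in
/-- `M` has a weight space decomposition with respect to `K`: it is the (internal) direct sum of
the spaces `M_α`, `α ∈ K*`. -/
def HasWeightDecomposition (F K M : Type*) [Field F] [LieRing K] [LieAlgebra F K]
    [AddCommGroup M] [Module F M] [LieRingModule K M] [LieModule F K M] : Prop :=
  DirectSum.IsInternal (fun α : Dual F K => weightSpace K M α)

end Weights

/-! ### Splitting Cartan subalgebras and the subalgebra attached to a set of roots -/

section Split

variable {F L : Type*} [Field F] [LieRing L] [LieAlgebra F L]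

/-- `H` is a splitting Cartan subalgebra of `L`: it is nontrivial, `L` has a weight space
decomposition with respect to `H` under the adjoint action, and `L_0 = H`. -/
structure IsSplittingCartan (H : LieSubalgebra F L) : Prop where
  ne_bot : H ≠ ⊥
  decomposition : HasWeightDecomposition F H L
  zero_space : weightSpace H L (0 : Dual F H) = H.toSubmodule

/-- The subspace `[L_α, L_{-α}]`, spanned by all brackets. -/
def bracketSpace (H : LieSubalgebra F L) (α : Dual F H) : Submodule F L :=
  Submodule.span F {z | ∃ x ∈ weightSpace H L α, ∃ y ∈ weightSpace H L (-α), ⁅x, y⁆ = z}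

/-- The subspace `∑_{α ∈ Φ} L_α + ∑_{α ∈ Φ} [L_α, L_{-α}]`. -/
def rootSum (H : LieSubalgebra F L) (Φ : Set (Dual F H)) : Submodule F L :=
  (⨆ α ∈ Φ, weightSpace H L α) ⊔ (⨆ α ∈ Φ, bracketSpace H α)

/-- The Lie subalgebra `∑_{α ∈ Φ} L_α + ∑_{α ∈ Φ} [L_α, L_{-α}]`. It is written as the Lie
subalgebra generated by this subspace, so that it is a Lie subalgebra for every `Φ`; the subspace
is itself a Lie subalgebra whenever `Φ` is closed, see `rootSubalgebra_toSubmodule`. -/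
def rootSubalgebra (H : LieSubalgebra F L) (Φ : Set (Dual F H)) : LieSubalgebra F L :=
  LieSubalgebra.lieSpan F L (rootSum H Φ : Set L)

theorem lie_mem_weightSpace_add {H : LieSubalgebra F L} {α β : Dual F H} {x y : L}
    (hx : x ∈ weightSpace H L α) (hy : y ∈ weightSpace H L β) :
    ⁅x, y⁆ ∈ weightSpace H L (α + β) := by
  intro h
  rw [leibniz_lie, hx h, hy h, smul_lie, lie_smul, LinearMap.add_apply, add_smul]

theorem bracketSpace_le_zero (H : LieSubalgebra F L) (α : Dual F H) :
    bracketSpace H α ≤ weightSpace H L (0 : Dual F H) := by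
  refine Submodule.span_le.2 ?_
  rintro z ⟨x, hx, y, hy, rfl⟩
  have := lie_mem_weightSpace_add hx hy
  rwa [add_neg_cancel] at this

theorem lie_mem_bracketSpace {H : LieSubalgebra F L} {α : Dual F H} {d z : L}
    (hd : d ∈ weightSpace H L (0 : Dual F H)) (hz : z ∈ bracketSpace H α) :
    ⁅d, z⁆ ∈ bracketSpace H α := by
  induction hz using Submodule.span_induction with
  | mem z hz =>
    obtain ⟨x, hx, y, hy, rfl⟩ := hz
    rw [leibniz_lie]
    refine add_mem (Submodule.subset_span ⟨_, ?_, y, hy, rfl⟩)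
      (Submodule.subset_span ⟨x, hx, _, ?_, rfl⟩)
    · simpa using lie_mem_weightSpace_add hd hx
    · simpa using lie_mem_weightSpace_add hd hy
  | zero => simp
  | add a b _ _ ha hb => rw [lie_add]; exact add_mem ha hb
  | smul c a _ ha => rw [lie_smul]; exact Submodule.smul_mem _ c ha

theorem weightSpace_le_rootSum {H : LieSubalgebra F L} {Φ : Set (Dual F H)} {α : Dual F H}
    (hα : α ∈ Φ) : weightSpace H L α ≤ rootSum H Φ :=
  le_trans (le_iSup₂_of_le α hα le_rfl) le_sup_left

theorem bracketSpace_le_rootSum {H : LieSubalgebra F L} {Φ : Set (Dual F H)} {α : Dual F H}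
    (hα : α ∈ Φ) : bracketSpace H α ≤ rootSum H Φ :=
  le_trans (le_iSup₂_of_le α hα le_rfl) le_sup_right

theorem rootSum_le_iff {H : LieSubalgebra F L} {Φ : Set (Dual F H)} {N : Submodule F L} :
    rootSum H Φ ≤ N ↔ ∀ α ∈ Φ, weightSpace H L α ≤ N ∧ bracketSpace H α ≤ N := by
  simp only [rootSum, sup_le_iff, iSup_le_iff]
  exact ⟨fun h α hα => ⟨h.1 α hα, h.2 α hα⟩, fun h => ⟨fun α hα => (h α hα).1, fun α hα => (h α hα).2⟩⟩

/-- If `Φ` is closed, then `rootSubalgebra H Φ` is the subspace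
`∑_{α ∈ Φ} L_α + ∑_{α ∈ Φ} [L_α, L_{-α}]`. -/
theorem rootSubalgebra_toSubmodule (H : LieSubalgebra F L) (Φ : Set (Dual F H))
    (hΦ : ∀ α ∈ Φ, ∀ β ∈ Φ, α + β ≠ 0 → α + β ∈ weights F H L → α + β ∈ Φ) :
    (rootSubalgebra H Φ).toSubmodule = rootSum H Φ := by
  have key : ∀ x ∈ rootSum H Φ, ∀ y ∈ rootSum H Φ, ⁅x, y⁆ ∈ rootSum H Φ := by
    intro x hx y hy
    have h1 : ∀ α ∈ Φ, ∀ β ∈ Φ, ∀ x ∈ weightSpace H L α, ∀ y ∈ weightSpace H L β,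
        ⁅x, y⁆ ∈ rootSum H Φ := by
      intro α hα β hβ x hx y hy
      by_cases h0 : α + β = 0
      · obtain rfl : β = -α := (neg_eq_of_add_eq_zero_right h0).symm
        exact bracketSpace_le_rootSum hα (Submodule.subset_span ⟨x, hx, y, hy, rfl⟩)
      · have hm := lie_mem_weightSpace_add hx hy
        by_cases hw : α + β ∈ weights F H L
        · exact weightSpace_le_rootSum (hΦ α hα β hβ h0 hw) hm
        · have hb : weightSpace H L (α + β) = ⊥ := by simpa [weights] using hw
          rw [hb, Submodule.mem_bot] at hm
          rw [hm]; exact zero_mem _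
    have h2 : ∀ d ∈ weightSpace H L (0 : Dual F H), ∀ y ∈ rootSum H Φ,
        ⁅d, y⁆ ∈ rootSum H Φ := by
      intro d hd y hy
      have : rootSum H Φ ≤ (rootSum H Φ).comap (LieAlgebra.ad F L d : L →ₗ[F] L) := by
        refine rootSum_le_iff.2 fun α hα => ⟨fun y hy => ?_, fun y hy => ?_⟩
        · refine weightSpace_le_rootSum hα ?_
          simpa using lie_mem_weightSpace_add hd hy
        · exact bracketSpace_le_rootSum hα (by simpa using lie_mem_bracketSpace hd hy)
      exact this hy
    have h3 : rootSum H Φ ≤ (rootSum H Φ).comap (LieAlgebra.ad F L y : L →ₗ[F] L) := by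
      refine rootSum_le_iff.2 fun α hα => ⟨fun x hx => ?_, fun x hx => ?_⟩
      · have h4 : rootSum H Φ ≤ (rootSum H Φ).comap (LieAlgebra.ad F L x : L →ₗ[F] L) := by
          refine rootSum_le_iff.2 fun β hβ => ⟨fun z hz => h1 α hα β hβ x hx z hz, fun z hz => ?_⟩
          have := h2 z (bracketSpace_le_zero H β hz) x (weightSpace_le_rootSum hα hx)
          have h5 : ⁅x, z⁆ ∈ rootSum H Φ := by rw [← lie_skew]; exact neg_mem this
          exact h5
        have h5 : ⁅y, x⁆ ∈ rootSum H Φ := by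
          rw [← lie_skew]; exact neg_mem (h4 hy)
        exact h5
      · have h5 : ⁅y, x⁆ ∈ rootSum H Φ := by
          rw [← lie_skew]; exact neg_mem (h2 x (bracketSpace_le_zero H α hx) y hy)
        exact h5
    have h6 : ⁅y, x⁆ ∈ rootSum H Φ := h3 hx
    rw [← lie_skew]; exact neg_mem h6
  exact LieSubalgebra.coe_lieSpan_submodule_eq_iff.2
    ⟨{ rootSum H Φ with lie_mem' := fun {x y} hx hy => key x hx y hy }, rfl⟩

/-- The Lie subalgebra `H ∩ G` of `G`. -/
abbrev cartanIn (H G : LieSubalgebra F L) : LieSubalgebra F G := H.comap G.incl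

/-- Restriction of functionals from `H` to `H ∩ G`. -/
def restrict (H G : LieSubalgebra F L) : Dual F H →ₗ[F] Dual F (cartanIn H G) :=
  Dual.transpose (R := F)
    ({ toFun := fun h => ⟨((h : G) : L), h.2⟩
       map_add' := fun _ _ => rfl
       map_smul' := fun _ _ => rfl } : cartanIn H G →ₗ[F] H)

theorem restrict_apply (H G : LieSubalgebra F L) (α : Dual F H) (h : cartanIn H G) :
    restrict H G α h = α ⟨((h : G) : L), h.2⟩ := rfl

end Split

/-! ### Finite root systems and their subsystems

A finite root system `R` (which contains `0`) in a vector space `U` is given by Mathlib's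
`RootPairing` whose family of roots enumerates `R \ {0}`. A subsystem is given by the set
of the indices of its nonzero elements. -/

section RootSystems

variable {ι F U N : Type*} [Field F] [AddCommGroup U] [Module F U] [AddCommGroup N] [Module F N]
  (P : RootPairing ι F U N)

/-- `S` is stable under its own reflections. -/
def IsSubsystem (S : Set ι) : Prop :=
  ∀ i ∈ S, ∀ j ∈ S, P.reflectionPerm i j ∈ S

/-- Every root in the span of the roots in `S` lies in `S`. -/
def IsFull (S : Set ι) : Prop :=
  ∀ i, P.root i ∈ Submodule.span F (P.root '' S) → i ∈ S

/-- Any two elements of `S` are joined by a chain in `S` whose consecutive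
members are not orthogonal. -/
def IsConnected (S : Set ι) : Prop :=
  ∀ i ∈ S, ∀ j ∈ S, Relation.ReflTransGen (fun a b => a ∈ S ∧ b ∈ S ∧ P.pairing a b ≠ 0) i j

/-- The rank of the subsystem `S`. -/
noncomputable def rootRank (S : Set ι) : ℕ := finrank F (Submodule.span F (P.root '' S))

/-- The nonzero elements of `S_sdiv`: the roots in `S` whose double is not in `S`. -/
def sdiv (S : Set ι) : Set ι :=
  {i ∈ S | ∀ j ∈ S, P.root j ≠ (2 : F) • P.root i}

/-- The squared length of a root with respect to the symmetric bilinear form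
`(x, y) = ∑_{γ ∈ S} γ̌(x) γ̌(y)`, which is invariant under the Weyl group of `S`. For finite
irreducible `S`, this is up to a positive rational factor the only such form that is positive
on the roots. -/
noncomputable def sqLength [P.IsCrystallographic] (S : Set ι) (i : ι) : ℤ :=
  ∑ᶠ k ∈ S, P.pairingIn ℤ i k ^ 2

/-- The short roots of `S`: the nonzero roots of minimal length. -/
def short [P.IsCrystallographic] (S : Set ι) : Set ι :=
  {i ∈ S | ∀ j ∈ S, sqLength P S i ≤ sqLength P S j}

end RootSystems

/-! ### The classical types -/

/-- The types of classical root systems. -/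
inductive ClassicalType
  | A | B | C | D | BC

/-- The standard basis vector `ε_i`. -/
def eps (F : Type*) [Field F] (n : ℕ) (i : Fin n) : Fin n → F := Pi.single i 1

/-- `A = {ε_i - ε_j}`. -/
def rootsA (F : Type*) [Field F] (n : ℕ) : Set (Fin n → F) :=
  {x | ∃ i j, x = eps F n i - eps F n j}

/-- `D = A ∪ {±(ε_i + ε_j) | i ≠ j}`. -/
def rootsD (F : Type*) [Field F] (n : ℕ) : Set (Fin n → F) :=
  rootsA F n ∪
    {x | ∃ i j, i ≠ j ∧ (x = eps F n i + eps F n j ∨ x = -(eps F n i + eps F n j))}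

/-- `B = D ∪ {±ε_i}`. -/
def rootsB (F : Type*) [Field F] (n : ℕ) : Set (Fin n → F) :=
  rootsD F n ∪ {x | ∃ i, x = eps F n i ∨ x = -eps F n i}

/-- `C = D ∪ {±2ε_i}`. -/
def rootsC (F : Type*) [Field F] (n : ℕ) : Set (Fin n → F) :=
  rootsD F n ∪ {x | ∃ i, x = (2 : F) • eps F n i ∨ x = -((2 : F) • eps F n i)}

/-- The standard root system (containing `0`) of the given type in the coordinates
`ε_1, …, ε_n`; for type `A` its rank is `n - 1`, otherwise it is `n` (if it is irreducible). -/
def ClassicalType.roots (F : Type*) [Field F] (n : ℕ) : ClassicalType → Set (Fin n → F)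
  | .A => rootsA F n
  | .B => rootsB F n
  | .C => rootsC F n
  | .D => rootsD F n
  | .BC => rootsB F n ∪ rootsC F n

/-- The subsystem `S` is of type `X`: for some `n`, there is a linear isomorphism
between the spans that maps `S` (with `0`) onto the standard root system of type `X`
in `n` coordinates. -/
def HasType {ι F U N : Type*} [Field F] [AddCommGroup U] [Module F U] [AddCommGroup N]
    [Module F N] (P : RootPairing ι F U N) (S : Set ι) (X : ClassicalType) : Prop :=
  ∃ (n : ℕ) (f : Submodule.span F (P.root '' S) ≃ₗ[F] Submodule.span F (X.roots F n)),
    ∀ x : Submodule.span F (P.root '' S), (x : U) ∈ insert 0 (P.root '' S) ↔ (f x : Fin n → F) ∈ X.roots F n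

/-- In a Lie algebra with root system `R_sdiv`, the sum attached to a full subsystem `S` of `R` is
itself a Lie subalgebra. -/
theorem rootSubalgebra_sdiv {ι F L N : Type*} [Field F] [LieRing L] [LieAlgebra F L]
    [AddCommGroup N] [Module F N] (H : LieSubalgebra F L) (P : RootPairing ι F (Dual F H) N)
    (hR : weights F H L = insert 0 (P.root '' sdiv P Set.univ))
    (S : Set ι) (hS : IsFull P S) :
    (rootSubalgebra H (P.root '' sdiv P S)).toSubmodule = rootSum H (P.root '' sdiv P S) := by
  refine rootSubalgebra_toSubmodule H _ ?_
  rintro _ ⟨i, hi, rfl⟩ _ ⟨j, hj, rfl⟩ h0 hw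
  rw [hR] at hw
  obtain h | ⟨k, hk, hk'⟩ := hw
  · exact absurd h h0
  · refine ⟨k, ⟨hS k ?_, fun m _ => hk.2 m (Set.mem_univ m)⟩, hk'⟩
    rw [hk']
    exact add_mem (Submodule.subset_span ⟨i, hi.1, rfl⟩) (Submodule.subset_span ⟨j, hj.1, rfl⟩)

end RootGraded

/-! The argument is highest weight theory without a choice of simple roots. Let `inn` be the
Weyl-invariant inner product of roots. A vector w of weight α, a root, is called extremal if L_γ w =
0 for every root γ of the Lie algebra with ⟨α, γ⟩ ≥ 0.

Since `W` is nontrivial, some nonzero root is a weight of it. Let w be a weight vector in `W` whose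
weight α has maximal length. It is extremal for `G₂` (`isExtremal_of_max`), because α + γ would be a
longer root of the full subsystem `S`. The decisive step is that w is extremal for all of `L`
(`IsExtremal.univ`). If β lies outside `S`, ⟨α, β⟩ ≥ 0 and α + β is a root, then α and β are
orthogonal of equal length, as with ε₁ and ε₂ in type B. Because both systems have the same
classical type, they have the same root lengths (`exists_length_eq`). This yields a root γ of `S`
orthogonal to α such that δ = β + γ is a root while α + δ is not (`exists_orthogonal`). Then L_β =
[L_{-γ}, L_δ], and both factors kill w.

Since `W` is irreducible, `U` is generated by w. Grading by the pairing with the coroot of α shows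
that `U` is spanned by iterated images of w under root vectors of negative degree. All weights being
roots or zero, at most six of these can be applied, so `U` is finite dimensional, and the α-weight
space is the line through w. For irreducibility, the Casimir operator acts on `U` by a scalar. A
nonzero submodule missing w would contain either only the weight 0 or an extremal vector whose
weight is strictly smaller than α; both give a smaller eigenvalue (`casimirValue_pos`,
`casimirValue_lt`), which is impossible (`IsExtremal.mem_of_ne_bot`).

The weights of `U` that are roots are stable under the Weyl group, no longer than α, and congruent
to α modulo the lattice spanned by the roots of `L` (`IsExtremal.isWeightSet`). Roots of equal
length are conjugate, and half of a root never lies in that lattice (`root_notMem_closure`).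
Together with the equality of lengths in `S` and in the whole system, this determines the three
weight sets (`IsWeightSet.eq_short`, `IsWeightSet.eq_sdiv`, `IsWeightSet.eq_short_sdiv`). -/

set_option linter.unusedSectionVars false

namespace RootGraded

/-! ### Pairing vectors and invariant forms -/

section Forms

variable {ι F M N : Type*} [Fintype ι] [Field F] [CharZero F] [AddCommGroup M] [Module F M]
  [AddCommGroup N] [Module F N] (P : RootPairing ι F M N) [P.IsCrystallographic]

/-- The integer vector of the pairings of a root with all coroots. -/
noncomputable def pairVec (i : ι) : ι → ℤ := fun k => P.pairingIn ℤ i k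

/-- The weighted sum of the products of the entries of two integer vectors. -/
def wform (a : ι → ℚ) (x y : ι → ℤ) : ℚ := ∑ k, a k * x k * y k

omit [Field F] [CharZero F] in
theorem wform_comm (a : ι → ℚ) (x y : ι → ℤ) : wform a x y = wform a y x :=
  Finset.sum_congr rfl fun k _ => by ring

theorem wform_add_left (a : ι → ℚ) (x y z : ι → ℤ) :
    wform a (x + y) z = wform a x z + wform a y z := by
  simp only [wform, ← Finset.sum_add_distrib]
  exact Finset.sum_congr rfl fun k _ => by simp; ring

theorem wform_sub_left (a : ι → ℚ) (x y z : ι → ℤ) :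
    wform a (x - y) z = wform a x z - wform a y z := by
  simp only [wform, ← Finset.sum_sub_distrib]
  exact Finset.sum_congr rfl fun k _ => by simp; ring

theorem wform_zsmul_left (a : ι → ℚ) (n : ℤ) (x y : ι → ℤ) :
    wform a (n • x) y = n * wform a x y := by
  simp only [wform, Finset.mul_sum]
  exact Finset.sum_congr rfl fun k _ => by simp; ring

theorem wform_zsmul_right (a : ι → ℚ) (n : ℤ) (x y : ι → ℤ) :
    wform a x (n • y) = n * wform a x y := by
  rw [wform_comm, wform_zsmul_left, wform_comm]

theorem wform_self_pos {a : ι → ℚ} (ha : ∀ k, 0 ≤ a k) {x : ι → ℤ} {k : ι} (hk : 0 < a k)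
    (hx : x k ≠ 0) : 0 < wform a x x := by
  refine Finset.sum_pos' (fun k _ => ?_) ⟨k, Finset.mem_univ k, ?_⟩
  · rw [mul_assoc]; exact mul_nonneg (ha k) (mul_self_nonneg _)
  · rw [mul_assoc]
    have : (x k : ℚ) ≠ 0 := by exact_mod_cast hx
    exact mul_pos hk (mul_self_pos.2 this)

omit [Fintype ι] in
theorem pairVec_eq_of_root_eq {i j : ι} {m n : ℤ} {k : ι}
    (h : P.root k = m • P.root i + n • P.root j) : pairVec P k = m • pairVec P i + n • pairVec P j := by
  funext l
  have := RootPairing.pairingIn_eq_add_of_root_eq_smul_add_smul (S := ℤ) (j := l) h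
  simpa [pairVec] using this

omit [Fintype ι] in
theorem pairVec_add {i j k : ι} (h : P.root k = P.root i + P.root j) :
    pairVec P k = pairVec P i + pairVec P j := by
  simpa using pairVec_eq_of_root_eq P (m := 1) (n := 1) (by simpa using h)

omit [Fintype ι] in
theorem pairVec_sub {i j k : ι} (h : P.root k = P.root i - P.root j) :
    pairVec P k = pairVec P i - pairVec P j := by
  simpa [sub_eq_add_neg] using
    pairVec_eq_of_root_eq P (m := 1) (n := -1) (by simpa [sub_eq_add_neg] using h)

omit [Fintype ι] [CharZero F] in
theorem root_reflectionPerm_int (i j : ι) :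
    P.root (P.reflectionPerm i j) = P.root j - P.pairingIn ℤ j i • P.root i := by
  rw [P.root_reflectionPerm, P.reflection_apply_root, ← P.algebraMap_pairingIn ℤ]
  simp [Int.cast_smul_eq_zsmul]

omit [Fintype ι] in
theorem pairVec_reflectionPerm (i j : ι) :
    pairVec P (P.reflectionPerm i j) = pairVec P j - P.pairingIn ℤ j i • pairVec P i := by
  have := pairVec_eq_of_root_eq P (k := P.reflectionPerm i j) (i := j) (j := i) (m := 1)
    (n := -P.pairingIn ℤ j i) (by rw [root_reflectionPerm_int]; simp [sub_eq_add_neg])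
  simpa [sub_eq_add_neg] using this

theorem wform_reflectionPerm {a : ι → ℚ} {j : ι} (ha : ∀ k, a (P.reflectionPerm j k) = a k)
    (x y : ι) : wform a (pairVec P (P.reflectionPerm j x)) (pairVec P (P.reflectionPerm j y)) =
      wform a (pairVec P x) (pairVec P y) := by
  simp only [wform, pairVec, ← P.pairingIn_reflectionPerm]
  exact Fintype.sum_equiv (P.reflectionPerm j) _ _ fun k => by rw [ha]

/-- Expand the invariance of the form under the reflection s_j at the pair (x, j), using s_j(j) =
-j. The general weights `a` allow one proof for three forms: the canonical one, the one defining
`sqLength`, and the form induced by the Killing form. -/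
theorem two_mul_wform {a : ι → ℚ} {j : ι} (ha : ∀ k, a (P.reflectionPerm j k) = a k) (x : ι) :
    2 * wform a (pairVec P x) (pairVec P j) =
      P.pairingIn ℤ x j * wform a (pairVec P j) (pairVec P j) := by
  have h := wform_reflectionPerm P ha x j
  have h1 : pairVec P (P.reflectionPerm j j) = (-1 : ℤ) • pairVec P j := by
    rw [pairVec_reflectionPerm, P.pairingIn_same]; module
  rw [h1, pairVec_reflectionPerm, wform_zsmul_right, wform_sub_left, wform_zsmul_left] at h
  push_cast at h
  linarith

/-- A length function on a set of roots: it is positive, invariant under the reflections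
in the set, and compatible with the pairing. -/
structure IsLength (S : Set ι) (f : ι → ℚ) : Prop where
  pos : ∀ i ∈ S, 0 < f i
  refl : ∀ i ∈ S, ∀ j ∈ S, f (P.reflectionPerm i j) = f j
  swap : ∀ i ∈ S, ∀ j ∈ S, P.pairingIn ℤ i j * f j = P.pairingIn ℤ j i * f i

theorem isLength_wform {S : Set ι} {a : ι → ℚ} (ha0 : ∀ k, 0 ≤ a k) (haS : ∀ k ∈ S, 0 < a k)
    (ha : ∀ j ∈ S, ∀ k, a (P.reflectionPerm j k) = a k) :
    IsLength P S (fun i => wform a (pairVec P i) (pairVec P i)) where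
  pos i hi := wform_self_pos ha0 (haS i hi) (by simp [pairVec])
  refl i hi j hj := wform_reflectionPerm P (ha i hi) j j
  swap i hi j hj := by
    rw [← two_mul_wform P (ha j hj), ← two_mul_wform P (ha i hi), wform_comm]

open Classical in
theorem sqLength_eq_wform (S : Set ι) (i : ι) : (sqLength P S i : ℚ) =
    wform (fun k => if k ∈ S then 1 else 0) (pairVec P i) (pairVec P i) := by
  rw [sqLength, finsum_mem_eq_finite_toFinset_sum _ (Set.toFinite S), wform]
  push_cast
  rw [← Finset.sum_filter_add_sum_filter_not Finset.univ (fun k => k ∈ S)]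
  rw [Finset.sum_congr (s₂ := Finset.univ.filter (fun k => k ∈ S)) (by ext; simp) fun _ _ => rfl]
  have h2 : ∑ x ∈ Finset.univ.filter (fun k => ¬ k ∈ S), (if x ∈ S then (1 : ℚ) else 0) *
      (pairVec P i x) * (pairVec P i x) = 0 :=
    Finset.sum_eq_zero fun k hk => by simp_all
  rw [h2, add_zero]
  refine Finset.sum_congr rfl fun k hk => ?_
  rw [if_pos (by simpa using hk), one_mul, pairVec, pow_two]

omit [Fintype ι] [CharZero F] [P.IsCrystallographic] in
theorem IsSubsystem.reflectionPerm_mem_iff {S : Set ι} (hS : IsSubsystem P S) {j : ι} (hj : j ∈ S)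
    (k : ι) : P.reflectionPerm j k ∈ S ↔ k ∈ S :=
  ⟨fun h => by simpa using hS j hj _ h, fun h => hS j hj k h⟩

theorem isLength_sqLength {S : Set ι} (hS : IsSubsystem P S) :
    IsLength P S (fun i => (sqLength P S i : ℚ)) := by
  classical
  simp only [sqLength_eq_wform]
  refine isLength_wform P (fun k => by split_ifs <;> simp) (fun k hk => by simp [hk]) ?_
  intro j hj k
  simp only [hS.reflectionPerm_mem_iff P hj]

omit [Fintype ι] in
theorem pairingIn_pos_comm [Finite ι] {i j : ι} (h : 0 < P.pairingIn ℤ i j) : 0 < P.pairingIn ℤ j i := by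
  have := P.pairingIn_pairingIn_mem_set_of_isCrystallographic i j
  simp only [Set.mem_insert_iff, Set.mem_singleton_iff, Prod.mk.injEq] at this
  omega

omit [Fintype ι] in
theorem pairingIn_neg_comm [Finite ι] {i j : ι} (h : P.pairingIn ℤ i j < 0) : P.pairingIn ℤ j i < 0 := by
  have := P.pairingIn_pairingIn_mem_set_of_isCrystallographic i j
  simp only [Set.mem_insert_iff, Set.mem_singleton_iff, Prod.mk.injEq] at this
  omega

omit [Fintype ι] in
theorem pairingIn_zero_comm [Finite ι] {i j : ι} (h : P.pairingIn ℤ i j = 0) : P.pairingIn ℤ j i = 0 := by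
  have := P.pairingIn_pairingIn_mem_set_of_isCrystallographic i j
  simp only [Set.mem_insert_iff, Set.mem_singleton_iff, Prod.mk.injEq] at this
  omega

omit [Fintype ι] in
/-- In an irreducible system, every orbit of the Weyl group meets the open half space
of every root. -/
theorem exists_mem_pairingIn_pos [Finite ι] {S A : Set ι} (hconn : IsConnected P S) (hAS : A ⊆ S)
    (hne : A.Nonempty) (hA : ∀ k ∈ S, ∀ a ∈ A, P.reflectionPerm k a ∈ A) {i : ι} (hi : i ∈ S) :
    ∃ a ∈ A, 0 < P.pairingIn ℤ i a := by
  suffices h : ∃ a ∈ A, P.pairingIn ℤ i a ≠ 0 by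
    obtain ⟨a, ha, h⟩ := h
    obtain h | h := lt_or_gt_of_ne h
    · exact ⟨P.reflectionPerm a a, hA a (hAS ha) a ha, by simpa using h⟩
    · exact ⟨a, ha, h⟩
  obtain ⟨a₀, ha₀⟩ := hne
  have := hconn a₀ (hAS ha₀) i hi
  induction this with
  | refl => exact ⟨a₀, ha₀, by simp⟩
  | tail _ h ih =>
    rename_i b c _
    obtain ⟨hb, hc, hbc⟩ := h
    obtain ⟨a, ha, hba⟩ := ih hb
    -- If c is orthogonal to a, replace a by s_b(a): then ⟨c, s_b a⟩ = -⟨c, b⟩⟨b, a⟩ is nonzero.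
    by_cases hca : P.pairingIn ℤ c a = 0
    · refine ⟨P.reflectionPerm b a, hA b hb a ha, ?_⟩
      rw [P.pairingIn_reflectionPerm]
      have h1 := congrFun (pairVec_reflectionPerm P b c) a
      simp only [pairVec, Pi.sub_apply, Pi.smul_apply, hca, zero_sub, smul_eq_mul] at h1
      rw [h1]
      have h2 : P.pairingIn ℤ c b ≠ 0 := by
        intro h
        have := pairingIn_zero_comm P h
        apply hbc
        rw [← P.algebraMap_pairingIn ℤ, this, map_zero]
      simp [h2, hba]
    · exact ⟨a, ha, hca⟩

omit [Fintype ι] in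
/-- In an irreducible system, roots of the same length are conjugate. -/
theorem mem_of_length_eq [Finite ι] {S A : Set ι} {f : ι → ℚ} (hf : IsLength P S f)
    (hS : IsSubsystem P S) (hconn : IsConnected P S) (hAS : A ⊆ S)
    (hne : A.Nonempty) (hA : ∀ k ∈ S, ∀ a ∈ A, P.reflectionPerm k a ∈ A) {i : ι} (hi : i ∈ S)
    (hlen : ∀ a ∈ A, f a = f i) : i ∈ A := by
  obtain ⟨a, ha, h⟩ := exists_mem_pairingIn_pos P hconn hAS hne hA hi
  have h1 := hf.swap i hi a (hAS ha)
  rw [hlen a ha] at h1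
  have h2 : P.pairingIn ℤ i a = P.pairingIn ℤ a i := by
    exact_mod_cast mul_right_cancel₀ (hf.pos i hi).ne' h1
  have h3 := P.pairingIn_pairingIn_mem_set_of_isCrystallographic i a
  simp only [Set.mem_insert_iff, Set.mem_singleton_iff, Prod.mk.injEq] at h3
  have h4 : P.pairingIn ℤ i a = 2 ∧ P.pairingIn ℤ a i = 2 ∨
    P.pairingIn ℤ i a = 1 ∧ P.pairingIn ℤ a i = 1 := by omega
  obtain h4 | ⟨h4, h5⟩ := h4
  · rwa [(P.pairingIn_two_two_iff ℤ i a).1 h4]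
  -- Here s_i(a) = a - i, and the reflection in a - i carries a to i.
  · have h6 : P.reflectionPerm (P.reflectionPerm i a) a = i := by
      apply P.root.injective
      have h7 : P.pairingIn ℤ a (P.reflectionPerm i a) = 1 := by
        rw [P.pairingIn_reflectionPerm]
        have h8 := congrFun (pairVec_reflectionPerm P i a) a
        simp only [pairVec, Pi.sub_apply, Pi.smul_apply, h4, h5, smul_eq_mul, P.pairingIn_same] at h8
        rw [h8]; norm_num
      rw [root_reflectionPerm_int, h7, root_reflectionPerm_int, h5]
      simp
    rw [← h6]
    exact hA _ (hS i hi a (hAS ha)) a ha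

end Forms

/-! ### Lengths of roots -/

section Lengths

variable {ι F M N : Type*} [Fintype ι] [Field F] [CharZero F] [AddCommGroup M] [Module F M]
  [AddCommGroup N] [Module F N] (P : RootPairing ι F M N) [P.IsCrystallographic]

/-- The canonical inner product of two roots. -/
noncomputable def inn (i j : ι) : ℚ := wform (fun _ => 1) (pairVec P i) (pairVec P j)

theorem inn_comm (i j : ι) : inn P i j = inn P j i := wform_comm _ _ _

theorem inn_self_pos (i : ι) : 0 < inn P i i :=
  wform_self_pos (k := i) (by simp) one_pos (by simp [pairVec])

theorem two_mul_inn (i j : ι) : 2 * inn P i j = P.pairingIn ℤ i j * inn P j j :=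
  two_mul_wform P (fun _ => rfl) i

theorem two_mul_inn' (i j : ι) : 2 * inn P i j = P.pairingIn ℤ j i * inn P i i := by
  rw [inn_comm, two_mul_inn]

theorem inn_add {i j k : ι} (h : P.root k = P.root i + P.root j) (l : ι) :
    inn P k l = inn P i l + inn P j l := by
  rw [inn, pairVec_add P h, wform_add_left]; rfl

theorem inn_sub {i j k : ι} (h : P.root k = P.root i - P.root j) (l : ι) :
    inn P k l = inn P i l - inn P j l := by
  rw [inn, pairVec_sub P h, wform_sub_left]; rfl

theorem inn_add_self {i j k : ι} (h : P.root k = P.root i + P.root j) :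
    inn P k k = inn P i i + 2 * inn P i j + inn P j j := by
  rw [inn_add P h, inn_comm P i, inn_comm P j, inn_add P h, inn_add P h, inn_comm P j i]; ring

theorem inn_sub_self {i j k : ι} (h : P.root k = P.root i - P.root j) :
    inn P k k = inn P i i - 2 * inn P i j + inn P j j := by
  rw [inn_sub P h, inn_comm P i, inn_comm P j, inn_sub P h, inn_sub P h, inn_comm P j i]; ring

theorem inn_refl (k i j : ι) :
    inn P (P.reflectionPerm k i) (P.reflectionPerm k j) = inn P i j :=
  wform_reflectionPerm P (fun _ => rfl) i j

theorem isLength_inn (S : Set ι) : IsLength P S (fun i => inn P i i) :=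
  isLength_wform P (by simp) (by simp) (by simp)

theorem isSubsystem_univ : IsSubsystem P Set.univ := fun _ _ _ _ => Set.mem_univ _

variable {P} in
theorem prop_of_length_eq {S : Set ι} (hS : IsSubsystem P S) (hconn : IsConnected P S)
    {Q : ι → Prop} (hQ : ∀ k ∈ S, ∀ a ∈ S, Q a → Q (P.reflectionPerm k a)) {i j : ι} (hi : i ∈ S)
    (hj : j ∈ S) (h : inn P i i = inn P j j) (hQi : Q i) : Q j := by
  have := mem_of_length_eq P (A := {a ∈ S | Q a ∧ inn P a a = inn P i i}) (isLength_inn P S) hS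
    hconn (fun a ha => ha.1) ⟨i, hi, hQi, rfl⟩ (fun k hk a ha => ⟨hS k hk a ha.1, hQ k hk a ha.1
      ha.2.1, by rw [inn_refl]; exact ha.2.2⟩) hj (fun a ha => ha.2.2.trans h)
  exact this.2.1

variable {P} in
/-- In an irreducible system, every root has a positive pairing with a conjugate
of any given root. -/
theorem exists_conj_pairing_pos {S : Set ι} (hS : IsSubsystem P S) (hconn : IsConnected P S)
    {Q : ι → Prop} (hQ : ∀ k ∈ S, ∀ a ∈ S, Q a → Q (P.reflectionPerm k a)) {i j : ι} (hi : i ∈ S)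
    (hj : j ∈ S) (hQi : Q i) :
    ∃ a ∈ S, Q a ∧ inn P a a = inn P i i ∧ 0 < P.pairingIn ℤ j a := by
  obtain ⟨a, ha, h⟩ := exists_mem_pairingIn_pos P (A := {a ∈ S | Q a ∧ inn P a a = inn P i i})
    hconn (fun a ha => ha.1) ⟨i, hi, hQi, rfl⟩ (fun k hk a ha => ⟨hS k hk a ha.1, hQ k hk a ha.1
      ha.2.1, by rw [inn_refl]; exact ha.2.2⟩) hj
  exact ⟨a, ha.1, ha.2.1, ha.2.2, h⟩

/-- The table of pairs of Cartan integers of roots at an acute angle, with the pairs (1, 3) and (3,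
1) removed. The lengths follow from ⟨i, j⟩ |j|² = ⟨j, i⟩ |i|². -/
theorem pairing_cases (h3 : ∀ i j, P.pairingIn ℤ i j ≠ 3) {i j : ι} (h : 0 < P.pairingIn ℤ i j) :
    (i = j) ∨ (P.pairingIn ℤ i j = 1 ∧ P.pairingIn ℤ j i = 1 ∧ inn P i i = inn P j j) ∨
    (P.pairingIn ℤ i j = 2 ∧ P.pairingIn ℤ j i = 1 ∧ inn P i i = 2 * inn P j j) ∨
    (P.pairingIn ℤ i j = 1 ∧ P.pairingIn ℤ j i = 2 ∧ inn P j j = 2 * inn P i i) ∨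
    (P.root i = (2 : F) • P.root j ∧ P.pairingIn ℤ i j = 4 ∧ inn P i i = 4 * inn P j j) ∨
    (P.root j = (2 : F) • P.root i ∧ P.pairingIn ℤ j i = 4 ∧ inn P j j = 4 * inn P i i) := by
  have h1 := P.pairingIn_pairingIn_mem_set_of_isCrystallographic i j
  have h2 := h3 i j
  have h4 := h3 j i
  have h5 := two_mul_inn P i j
  rw [two_mul_inn'] at h5
  simp only [Set.mem_insert_iff, Set.mem_singleton_iff, Prod.mk.injEq] at h1
  have h6 : (P.pairingIn ℤ i j = 1 ∧ P.pairingIn ℤ j i = 1) ∨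
    (P.pairingIn ℤ i j = 2 ∧ P.pairingIn ℤ j i = 2) ∨
    (P.pairingIn ℤ i j = 2 ∧ P.pairingIn ℤ j i = 1) ∨
    (P.pairingIn ℤ i j = 1 ∧ P.pairingIn ℤ j i = 2) ∨
    (P.pairingIn ℤ i j = 4 ∧ P.pairingIn ℤ j i = 1) ∨
    (P.pairingIn ℤ i j = 1 ∧ P.pairingIn ℤ j i = 4) := by omega
  have : Module.IsTorsionFree F N := inferInstance
  rcases h6 with h6 | h6 | h6 | h6 | h6 | h6 <;> rw [h6.1, h6.2] at h5 <;> push_cast at h5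
  · exact Or.inr (Or.inl ⟨h6.1, h6.2, by linarith⟩)
  · exact Or.inl ((P.pairingIn_two_two_iff ℤ i j).1 h6)
  · exact Or.inr (Or.inr (Or.inl ⟨h6.1, h6.2, by linarith⟩))
  · exact Or.inr (Or.inr (Or.inr (Or.inl ⟨h6.1, h6.2, by linarith⟩)))
  · exact Or.inr (Or.inr (Or.inr (Or.inr (Or.inl
      ⟨(P.pairingIn_one_four_iff ℤ j i).1 h6.symm, h6.1, by linarith⟩))))
  · exact Or.inr (Or.inr (Or.inr (Or.inr (Or.inr
      ⟨(P.pairingIn_one_four_iff ℤ i j).1 h6, h6.2, by linarith⟩))))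

theorem exists_double_refl (k a : ι) (h : ∃ m, P.root m = (2 : F) • P.root a) :
    ∃ m, P.root m = (2 : F) • P.root (P.reflectionPerm k a) := by
  obtain ⟨m, hm⟩ := h
  exact ⟨P.reflectionPerm k m, by rw [P.root_reflectionPerm, hm, map_smul, P.root_reflectionPerm]⟩

theorem mem_sdiv_univ {i : ι} :
    i ∈ sdiv P Set.univ ↔ ¬ ∃ m, P.root m = (2 : F) • P.root i := by
  simp [sdiv]

theorem refl_mem_sdiv {i : ι} (k : ι) (h : i ∈ sdiv P Set.univ) :
    P.reflectionPerm k i ∈ sdiv P Set.univ := by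
  rw [mem_sdiv_univ] at h ⊢
  intro h'
  apply h
  have := exists_double_refl P k _ h'
  rwa [P.reflectionPerm_self] at this

variable {P} in
theorem mem_sdiv_of_length_eq (hP : IsConnected P Set.univ) {i j : ι}
    (h : inn P i i = inn P j j) (hi : i ∈ sdiv P Set.univ) : j ∈ sdiv P Set.univ :=
  prop_of_length_eq (isSubsystem_univ P) hP (fun k _ _ _ h => refl_mem_sdiv P k h)
    (Set.mem_univ i) (Set.mem_univ j) h hi

variable {P} in
-- Replace i by a conjugate that makes an acute angle with j and read off the table. Ratio 4 occurs
-- only for a root and its double, and having a double is invariant under conjugation.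
theorem length_cases (hP : IsConnected P Set.univ) (h3 : ∀ i j, P.pairingIn ℤ i j ≠ 3) (i j : ι) :
    inn P i i = inn P j j ∨ inn P i i = 2 * inn P j j ∨ inn P j j = 2 * inn P i i ∨
    (inn P i i = 4 * inn P j j ∧ ∃ m, P.root m = (2 : F) • P.root j) ∨
    (inn P j j = 4 * inn P i i ∧ ∃ m, P.root m = (2 : F) • P.root i) := by
  obtain ⟨a, -, -, ha, hpos⟩ := exists_conj_pairing_pos (Q := fun _ => True) (isSubsystem_univ P) hP
    (fun _ _ _ _ _ => trivial) (Set.mem_univ i) (Set.mem_univ j) trivial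
  rw [← ha]
  rcases pairing_cases P h3 hpos with h | h | h | h | h | h
  · rw [h]; simp
  · exact Or.inl h.2.2.symm
  · exact Or.inr (Or.inr (Or.inl h.2.2))
  · exact Or.inr (Or.inl h.2.2)
  · refine Or.inr (Or.inr (Or.inr (Or.inr ⟨h.2.2, ?_⟩)))
    exact prop_of_length_eq (Q := fun i => ∃ m, P.root m = (2 : F) • P.root i)
      (isSubsystem_univ P) hP (fun k _ a _ h => exists_double_refl P k a h)
      (Set.mem_univ a) (Set.mem_univ i) ha ⟨j, h.1⟩
  · exact Or.inr (Or.inr (Or.inr (Or.inl ⟨h.2.2, a, h.1⟩)))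

end Lengths

/-! ### Lengths in the classical types -/

section Types

theorem dot_of_mem_rootsD {F : Type*} [Field F] [CharZero F] {n : ℕ} {v : Fin n → F}
    (hv : v ∈ rootsD F n) (h0 : v ≠ 0) : v ⬝ᵥ v = 2 := by
  rcases hv with ⟨i, j, rfl⟩ | ⟨i, j, hij, rfl | rfl⟩
  · have hij : i ≠ j := by rintro rfl; simp at h0
    simp [eps, hij, hij.symm]; norm_num
  · simp [eps, hij, hij.symm]; norm_num
  · simp [eps, hij, hij.symm]; norm_num

theorem dot_of_mem_rootsB {F : Type*} [Field F] [CharZero F] {n : ℕ} {v : Fin n → F}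
    (hv : v ∈ rootsB F n) (h0 : v ≠ 0) : v ⬝ᵥ v = 1 ∨ v ⬝ᵥ v = 2 := by
  rcases hv with hv | ⟨i, rfl | rfl⟩
  · exact Or.inr (dot_of_mem_rootsD hv h0)
  · simp [eps]
  · simp [eps]

theorem dot_of_mem_rootsC {F : Type*} [Field F] [CharZero F] {n : ℕ} {v : Fin n → F}
    (hv : v ∈ rootsC F n) (h0 : v ≠ 0) : v ⬝ᵥ v = 2 ∨ v ⬝ᵥ v = 4 := by
  rcases hv with hv | ⟨i, rfl | rfl⟩
  · exact Or.inl (dot_of_mem_rootsD hv h0)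
  · right; simp [eps]; norm_num
  · right; simp [eps]; norm_num

theorem dot_of_mem_roots {F : Type*} [Field F] [CharZero F] {n : ℕ} {X : ClassicalType}
    {v : Fin n → F} (hv : v ∈ X.roots F n) (h0 : v ≠ 0) :
    ∃ q : ℤ, v ⬝ᵥ v = q ∧ (q = 1 ∨ q = 2 ∨ q = 4) := by
  have h : v ⬝ᵥ v = 1 ∨ v ⬝ᵥ v = 2 ∨ v ⬝ᵥ v = 4 := by
    cases X with
    | A => exact Or.inr (Or.inl (dot_of_mem_rootsD (Or.inl hv) h0))
    | B => exact (dot_of_mem_rootsB hv h0).imp_right Or.inl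
    | C => exact Or.inr (dot_of_mem_rootsC hv h0)
    | D => exact Or.inr (Or.inl (dot_of_mem_rootsD hv h0))
    | BC =>
      rcases hv with hv | hv
      · exact (dot_of_mem_rootsB hv h0).imp_right Or.inl
      · exact Or.inr (dot_of_mem_rootsC hv h0)
  rcases h with h | h | h
  exacts [⟨1, by simpa using h, by simp⟩, ⟨2, by simpa using h, by simp⟩, ⟨4, by simpa using h, by simp⟩]

variable {ι F M N : Type*} [Fintype ι] [Field F] [CharZero F] [AddCommGroup M] [Module F M]
  [AddCommGroup N] [Module F N] {P : RootPairing ι F M N}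

/-- The isomorphism of spans is extended to the ambient space, so that sums and differences of roots
can be computed in coordinates without subtypes. Injectivity survives only on the span of `S`. -/
theorem HasType.exists_linearMap {S : Set ι} {X : ClassicalType} (h : HasType P S X) :
    ∃ (n : ℕ) (g : M →ₗ[F] (Fin n → F)), rootRank P S ≤ n ∧
      (∀ i ∈ S, g (P.root i) ∈ X.roots F n ∧ g (P.root i) ≠ 0) ∧
      (∀ v ∈ X.roots F n, v ≠ 0 → ∃ i ∈ S, g (P.root i) = v) ∧
      (∀ x ∈ Submodule.span F (P.root '' S), g x = 0 → x = 0) := by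
  obtain ⟨n, f, hf⟩ := h
  obtain ⟨g, hg⟩ := LinearMap.exists_extend ((Submodule.subtype _).comp f.toLinearMap)
  have hg' : ∀ x : Submodule.span F (P.root '' S), g x = f x := fun x =>
    LinearMap.congr_fun hg x
  have hinj : ∀ x ∈ Submodule.span F (P.root '' S), g x = 0 → x = 0 := by
    intro x hx h
    have h1 := (hg' ⟨x, hx⟩).symm.trans h
    have h2 : f ⟨x, hx⟩ = 0 := Subtype.ext h1
    have h3 := (LinearEquiv.map_eq_zero_iff f).1 h2
    simpa using congrArg Subtype.val h3
  refine ⟨n, g, ?_, fun i hi => ?_, fun v hv h0 => ?_, hinj⟩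
  · rw [rootRank, f.finrank_eq]
    exact (Submodule.finrank_le _).trans (by simp)
  · have hi' : P.root i ∈ Submodule.span F (P.root '' S) := Submodule.subset_span ⟨i, hi, rfl⟩
    refine ⟨?_, fun h => P.ne_zero i (hinj _ hi' h)⟩
    have := (hf ⟨P.root i, hi'⟩).1 (Or.inr ⟨i, hi, rfl⟩)
    rwa [← hg'] at this
  · obtain ⟨x, hx⟩ := f.surjective ⟨v, Submodule.subset_span hv⟩
    have h1 := (hf x).2 (by rw [hx]; exact hv)
    have h2 : g x = v := by rw [hg', hx]
    rcases h1 with h1 | ⟨i, hi, h1⟩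
    · rw [h1] at h2; simp at h2; exact absurd h2.symm h0
    · exact ⟨i, hi, by rw [h1, h2]⟩

variable [P.IsCrystallographic]

/-- Cartan integers 3 and 1 would produce the roots x, y, y - x, 2y - x, x - 3y and 2x - 3y of a G₂
system. The dot product of coordinates need not be Weyl invariant, but it is a quadratic form with
values 1, 2 or 4 on all roots. Its values on these six are linear combinations of the first three,
and no choice is consistent. -/
theorem HasType.pairingIn_ne_three {X : ClassicalType} (h : HasType P Set.univ X) (i j : ι) :
    P.pairingIn ℤ i j ≠ 3 := by
  intro hij
  have hji : P.pairingIn ℤ j i = 1 := by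
    have := P.pairingIn_pairingIn_mem_set_of_isCrystallographic i j
    simp only [Set.mem_insert_iff, Set.mem_singleton_iff, Prod.mk.injEq] at this
    omega
  obtain ⟨n, g, -, hg, -⟩ := h.exists_linearMap
  have hq : ∀ k, ∃ q : ℤ, g (P.root k) ⬝ᵥ g (P.root k) = q ∧ (q = 1 ∨ q = 2 ∨ q = 4) :=
    fun k => dot_of_mem_roots (hg k (Set.mem_univ k)).1 (hg k (Set.mem_univ k)).2
  choose q hq hq' using hq
  set x := g (P.root i)
  set y := g (P.root j)
  have e1 : g (P.root (P.reflectionPerm i j)) = y - x := by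
    rw [root_reflectionPerm_int, hji]; simp [x, y]
  have p1 : P.pairingIn ℤ (P.reflectionPerm i j) j = -1 := by
    have := congrFun (pairVec_reflectionPerm P i j) j
    simp only [pairVec, Pi.sub_apply, Pi.smul_apply, hij, hji, smul_eq_mul, P.pairingIn_same] at this
    rw [this]; norm_num
  have e2 : g (P.root (P.reflectionPerm j (P.reflectionPerm i j))) = (2 : F) • y - x := by
    rw [root_reflectionPerm_int, p1, map_sub, e1, map_zsmul]; change _ - (-1 : ℤ) • y = _; module
  have e3 : g (P.root (P.reflectionPerm j i)) = x - (3 : F) • y := by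
    rw [root_reflectionPerm_int, hij, map_sub, map_zsmul]; change x - (3 : ℤ) • y = _; module
  have p2 : P.pairingIn ℤ (P.reflectionPerm j i) i = -1 := by
    have := congrFun (pairVec_reflectionPerm P j i) i
    simp only [pairVec, Pi.sub_apply, Pi.smul_apply, hij, hji, smul_eq_mul, P.pairingIn_same] at this
    rw [this]; norm_num
  have e4 : g (P.root (P.reflectionPerm i (P.reflectionPerm j i))) = (2 : F) • x - (3 : F) • y := by
    rw [root_reflectionPerm_int, p2, map_sub, e3, map_zsmul]; change _ - (-1 : ℤ) • x = _; module
  have q0 := hq i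
  have q0' := hq j
  have q1 := hq (P.reflectionPerm i j)
  have q2 := hq (P.reflectionPerm j (P.reflectionPerm i j))
  have q3 := hq (P.reflectionPerm j i)
  have q4 := hq (P.reflectionPerm i (P.reflectionPerm j i))
  rw [e1] at q1
  rw [e2] at q2
  rw [e3] at q3
  rw [e4] at q4
  change x ⬝ᵥ x = _ at q0
  change y ⬝ᵥ y = _ at q0'
  simp only [dotProduct_sub, sub_dotProduct, smul_dotProduct, dotProduct_smul, smul_eq_mul, q0, q0',
    dotProduct_comm y x] at q1 q2 q3 q4
  have r2 : q (P.reflectionPerm j (P.reflectionPerm i j)) =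
      -q i + 2 * q j + 2 * q (P.reflectionPerm i j) := by
    have : (q (P.reflectionPerm j (P.reflectionPerm i j)) : F) =
      -q i + 2 * q j + 2 * q (P.reflectionPerm i j) := by linear_combination 2 * q1 - q2
    exact_mod_cast this
  have r3 : q (P.reflectionPerm j i) = -2 * q i + 6 * q j + 3 * q (P.reflectionPerm i j) := by
    have : (q (P.reflectionPerm j i) : F) =
      -2 * q i + 6 * q j + 3 * q (P.reflectionPerm i j) := by linear_combination 3 * q1 - q3
    exact_mod_cast this
  have r4 : q (P.reflectionPerm i (P.reflectionPerm j i)) =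
      -2 * q i + 3 * q j + 6 * q (P.reflectionPerm i j) := by
    have : (q (P.reflectionPerm i (P.reflectionPerm j i)) : F) =
      -2 * q i + 3 * q j + 6 * q (P.reflectionPerm i j) := by linear_combination 6 * q1 - q4
    exact_mod_cast this
  have c1 := hq' i
  have c2 := hq' j
  have c3 := hq' (P.reflectionPerm i j)
  have c4 := hq' (P.reflectionPerm j (P.reflectionPerm i j))
  have c5 := hq' (P.reflectionPerm j i)
  have c6 := hq' (P.reflectionPerm i (P.reflectionPerm j i))
  omega

theorem parallelogram {i j k l : ι} (h1 : P.root k = P.root i + P.root j)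
    (h2 : P.root l = P.root i - P.root j) :
    inn P k k + inn P l l = 2 * inn P i i + 2 * inn P j j := by
  rw [inn_add_self P h1, inn_sub_self P h2]; ring

/-- With length ratio 2 there would be roots a, j with ⟨j, a⟩ = 1 and ⟨a, j⟩ = 2. Dot product 2 on j
- a forces a · j = 1, while on a - 2j it forces a · j = 2. -/
theorem length_eq_of_dot_eq_two (hP : IsConnected P Set.univ)
    (h3 : ∀ i j, P.pairingIn ℤ i j ≠ 3) {n : ℕ} (g : M →ₗ[F] (Fin n → F))
    (hg : ∀ i, g (P.root i) ⬝ᵥ g (P.root i) = 2) (i j : ι) : inn P i i = inn P j j := by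
  have hd : ∀ i, ¬ ∃ m, P.root m = (2 : F) • P.root i := by
    rintro i ⟨m, hm⟩
    have := hg m
    rw [hm, map_smul, smul_dotProduct, dotProduct_smul, hg i] at this
    norm_num at this
  have key : ∀ i j, inn P i i ≠ 2 * inn P j j := by
    intro i j h
    obtain ⟨a, -, -, ha, hpos⟩ := exists_conj_pairing_pos (Q := fun _ => True) (isSubsystem_univ P)
      hP (fun _ _ _ _ _ => trivial) (Set.mem_univ i) (Set.mem_univ j) trivial
    have hj := inn_self_pos P j
    rw [← ha] at h
    have h' : P.pairingIn ℤ j a = 1 ∧ P.pairingIn ℤ a j = 2 := by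
      rcases pairing_cases P h3 hpos with h1 | h1 | h1 | h1 | h1 | h1
      · rw [h1] at h hj; linarith
      · linarith [h1.2.2]
      · linarith [h1.2.2]
      · exact ⟨h1.1, h1.2.1⟩
      · linarith [h1.2.2]
      · linarith [h1.2.2]
    have e1 := hg (P.reflectionPerm a j)
    have e2 := hg (P.reflectionPerm j a)
    have e3 := hg a
    have e4 := hg j
    rw [root_reflectionPerm_int, h'.1] at e1
    rw [root_reflectionPerm_int, h'.2] at e2
    simp only [one_smul, two_smul, map_sub, map_add, dotProduct_sub, sub_dotProduct, add_dotProduct,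
      dotProduct_add, e3, e4, dotProduct_comm (g (P.root j)) (g (P.root a))] at e1 e2
    have : (4 : F) = 0 := by linear_combination e2 - 2 * e1
    norm_num at this
  rcases length_cases hP h3 i j with h | h | h | h | h
  · exact h
  · exact absurd h (key i j)
  · exact absurd h (key j i)
  · exact absurd h.2 (hd j)
  · exact absurd h.2 (hd i)

theorem HasType.mem_span {S : Set ι} {i : ι} (hi : i ∈ S) :
    P.root i ∈ Submodule.span F (P.root '' S) := Submodule.subset_span ⟨i, hi, rfl⟩

/-- An irreducible system and a subsystem of rank greater than `1` that have the same classical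
type have the same root lengths. -/
theorem exists_length_eq {S : Set ι} {X : ClassicalType} (hP : IsConnected P Set.univ)
    (hrank : 1 < rootRank P S) (h₁ : HasType P Set.univ X) (h₂ : HasType P S X) (i : ι) :
    ∃ j ∈ S, inn P j j = inn P i i := by
  have h3 := h₁.pairingIn_ne_three
  obtain ⟨n, g, -, hg, -, -⟩ := h₁.exists_linearMap
  obtain ⟨m, f, hm, hf, hf', hinj⟩ := h₂.exists_linearMap
  have hne : ∃ j, j ∈ S := by
    by_contra! h
    have : S = ∅ := Set.eq_empty_of_forall_notMem h
    subst this
    rw [rootRank, Set.image_empty, Submodule.span_empty, finrank_bot] at hrank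
    omega
  -- The rank hypothesis provides two distinct coordinates.
  replace hm := hrank.trans_le hm
  have hadd : ∀ {a b c : ι}, a ∈ S → b ∈ S → c ∈ S →
      f (P.root c) = f (P.root a) + f (P.root b) → P.root c = P.root a + P.root b := by
    intro a b c ha hb hc h
    refine sub_eq_zero.1 (hinj _ ?_ (by rw [map_sub, map_add, h, sub_self]))
    exact sub_mem (HasType.mem_span hc) (add_mem (HasType.mem_span ha) (HasType.mem_span hb))
  have hsub : ∀ {a b c : ι}, a ∈ S → b ∈ S → c ∈ S →
      f (P.root c) = f (P.root a) - f (P.root b) → P.root c = P.root a - P.root b := by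
    intro a b c ha hb hc h
    have := hadd hc hb ha (by rw [h]; simp)
    rw [this]; simp
  let u : Fin m := ⟨0, by omega⟩
  let v : Fin m := ⟨1, hm⟩
  have huv : u ≠ v := by simp [u, v]
  -- a reduced system with two roots whose sum and difference are roots
  have two : (∀ i, ¬ ∃ m, P.root m = (2 : F) • P.root i) → ∀ a ∈ S, ∀ b ∈ S, ∀ c ∈ S, ∀ d ∈ S,
      P.root c = P.root a + P.root b → P.root d = P.root a - P.root b →
      ∃ j ∈ S, inn P j j = inn P i i := by
    intro hd a ha b hb c hc d hd' h1 h2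
    have h := parallelogram h1 h2
    have ratio : ∀ k, inn P i i = inn P k k ∨ inn P i i = 2 * inn P k k ∨
        inn P k k = 2 * inn P i i := by
      intro k
      rcases length_cases hP h3 i k with h | h | h | h | h
      · exact Or.inl h
      · exact Or.inr (Or.inl h)
      · exact Or.inr (Or.inr h)
      · exact absurd h.2 (hd k)
      · exact absurd h.2 (hd i)
    by_contra! hno
    have hi := inn_self_pos P i
    have ra := (ratio a).resolve_left (hno a ha).symm
    have rb := (ratio b).resolve_left (hno b hb).symm
    have rc := (ratio c).resolve_left (hno c hc).symm
    have rd := (ratio d).resolve_left (hno d hd').symm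
    -- With l = |i|², each of the four squared lengths is l/2 or 2l. So |c|² + |d|² is l, 5l/2 or
    -- 4l, while 2|a|² + 2|b|² is 2l, 5l or 8l.
    rcases ra with ra | ra <;> rcases rb with rb | rb <;> rcases rc with rc | rc <;>
      rcases rd with rd | rd <;> linarith
  -- Doubling a root multiplies its dot square by 4, which leaves {1, 2} and {2, 4}.
  have hred : (∀ i, g (P.root i) ⬝ᵥ g (P.root i) = 1 ∨ g (P.root i) ⬝ᵥ g (P.root i) = 2) ∨
      (∀ i, g (P.root i) ⬝ᵥ g (P.root i) = 2 ∨ g (P.root i) ⬝ᵥ g (P.root i) = 4) →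
      ∀ i, ¬ ∃ m, P.root m = (2 : F) • P.root i := by
    rintro h i ⟨k, hk⟩
    have h1 : g (P.root k) ⬝ᵥ g (P.root k) = 4 * g (P.root i) ⬝ᵥ g (P.root i) := by
      rw [hk, map_smul, smul_dotProduct, dotProduct_smul]; simp only [smul_eq_mul]; ring
    rcases h with h | h <;> rcases h i with h2 | h2 <;> rcases h k with h4 | h4 <;>
      rw [h2, h4] at h1 <;> norm_num at h1
  have ne0 : ∀ {w : Fin m → F} (t : Fin m), w t ≠ 0 → w ≠ 0 := by
    rintro w t h rfl; exact h rfl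
  cases X with
  | A =>
    obtain ⟨j, hj⟩ := hne
    exact ⟨j, hj, length_eq_of_dot_eq_two hP h3 g (fun i => dot_of_mem_rootsD
      (Or.inl (hg i (Set.mem_univ i)).1) (hg i (Set.mem_univ i)).2) j i⟩
  | D =>
    obtain ⟨j, hj⟩ := hne
    exact ⟨j, hj, length_eq_of_dot_eq_two hP h3 g (fun i => dot_of_mem_rootsD
      (hg i (Set.mem_univ i)).1 (hg i (Set.mem_univ i)).2) j i⟩
  | B =>
    have hd := hred (Or.inl fun i => dot_of_mem_rootsB
      (hg i (Set.mem_univ i)).1 (hg i (Set.mem_univ i)).2)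
    obtain ⟨a, ha, ea⟩ := hf' (eps F m u) (Or.inr ⟨u, Or.inl rfl⟩) (ne0 u (by simp [eps]))
    obtain ⟨b, hb, eb⟩ := hf' (eps F m v) (Or.inr ⟨v, Or.inl rfl⟩) (ne0 v (by simp [eps]))
    obtain ⟨c, hc, ec⟩ := hf' (eps F m u + eps F m v) (Or.inl (Or.inr ⟨u, v, huv, Or.inl rfl⟩))
      (ne0 u (by simp [eps, huv]))
    obtain ⟨d, hd', ed⟩ := hf' (eps F m u - eps F m v) (Or.inl (Or.inl ⟨u, v, rfl⟩))
      (ne0 u (by simp [eps, huv]))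
    exact two hd a ha b hb c hc d hd' (hadd ha hb hc (by rw [ea, eb, ec]))
      (hsub ha hb hd' (by rw [ea, eb, ed]))
  | C =>
    have hd := hred (Or.inr fun i => dot_of_mem_rootsC
      (hg i (Set.mem_univ i)).1 (hg i (Set.mem_univ i)).2)
    obtain ⟨a, ha, ea⟩ := hf' ((2 : F) • eps F m u) (Or.inr ⟨u, Or.inl rfl⟩)
      (ne0 u (by simp [eps]))
    obtain ⟨b, hb, eb⟩ := hf' ((2 : F) • eps F m v) (Or.inr ⟨v, Or.inl rfl⟩)
      (ne0 v (by simp [eps]))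
    obtain ⟨c, hc, ec⟩ := hf' (eps F m u + eps F m v) (Or.inl (Or.inr ⟨u, v, huv, Or.inl rfl⟩))
      (ne0 u (by simp [eps, huv]))
    obtain ⟨d, hd', ed⟩ := hf' (eps F m u - eps F m v) (Or.inl (Or.inl ⟨u, v, rfl⟩))
      (ne0 u (by simp [eps, huv]))
    exact two hd c hc d hd' a ha b hb (hadd hc hd' ha (by rw [ea, ec, ed]; module))
      (hsub hc hd' hb (by rw [ec, eb, ed]; module))
  | BC =>
    obtain ⟨a, ha, ea⟩ := hf' (eps F m u) (Or.inl (Or.inr ⟨u, Or.inl rfl⟩))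
      (ne0 u (by simp [eps]))
    obtain ⟨b, hb, eb⟩ := hf' (eps F m v) (Or.inl (Or.inr ⟨v, Or.inl rfl⟩))
      (ne0 v (by simp [eps]))
    obtain ⟨a', ha', ea'⟩ := hf' ((2 : F) • eps F m u) (Or.inr (Or.inr ⟨u, Or.inl rfl⟩))
      (ne0 u (by simp [eps]))
    obtain ⟨b', hb', eb'⟩ := hf' ((2 : F) • eps F m v) (Or.inr (Or.inr ⟨v, Or.inl rfl⟩))
      (ne0 v (by simp [eps]))
    obtain ⟨c, hc, ec⟩ := hf' (eps F m u + eps F m v)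
      (Or.inl (Or.inl (Or.inr ⟨u, v, huv, Or.inl rfl⟩))) (ne0 u (by simp [eps, huv]))
    obtain ⟨d, hd', ed⟩ := hf' (eps F m u - eps F m v) (Or.inl (Or.inl (Or.inl ⟨u, v, rfl⟩)))
      (ne0 u (by simp [eps, huv]))
    have h := parallelogram (hadd ha hb hc (by rw [ea, eb, ec])) (hsub ha hb hd' (by rw [ea, eb, ed]))
    have la := inn_add_self P (hadd ha ha ha' (by rw [ea, ea', two_smul]))
    have lb := inn_add_self P (hadd hb hb hb' (by rw [eb, eb', two_smul]))
    have pa := inn_self_pos P a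
    -- A root shorter than a would be related to a' = 2a by a ratio of 8 or 16, so a is short and
    -- every squared length is 1, 2 or 4 times |a|².
    have ratio : ∀ k, inn P k k = inn P a a ∨ inn P k k = 2 * inn P a a ∨
        inn P k k = 4 * inn P a a := by
      intro k
      have pk := inn_self_pos P k
      rcases length_cases hP h3 k a with h | h | h | h | h
      · exact Or.inl h
      · exact Or.inr (Or.inl h)
      · rcases length_cases hP h3 k a' with h' | h' | h' | h' | h' <;> exfalso <;>
          linarith
      · exact Or.inr (Or.inr h.1)
      · rcases length_cases hP h3 k a' with h' | h' | h' | h' | h' <;> exfalso <;>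
          linarith [h.1]
    have hb4 : inn P b b = inn P a a := by
      rcases ratio b with h | h | h
      · exact h
      · rcases ratio b' with h' | h' | h' <;> exfalso <;> linarith
      · rcases ratio b' with h' | h' | h' <;> exfalso <;> linarith
    -- The parallelogram law reads |c|² + |d|² = 4|a|², and both terms are 1, 2 or 4 times |a|².
    have hc2 : inn P c c = 2 * inn P a a := by
      rcases ratio c with h' | h' | h' <;> rcases ratio d with h'' | h'' | h'' <;> linarith
    rcases ratio i with h' | h' | h'
    · exact ⟨a, ha, h'.symm⟩
    · exact ⟨c, hc, by rw [h', hc2]⟩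
    · exact ⟨a', ha', by rw [h', la]; ring⟩

end Types

/-! ### Short roots and the set `sdiv` -/

section Sdiv

variable {ι F M N : Type*} [Fintype ι] [Field F] [CharZero F] [AddCommGroup M] [Module F M]
  [AddCommGroup N] [Module F N] {P : RootPairing ι F M N} [P.IsCrystallographic]

/-- After conjugating j to make an acute angle with i, the comparison of lengths is the comparison
of ⟨i, j⟩ with ⟨j, i⟩, which does not involve the length function. This makes `sqLength`
interchangeable with `inn`. -/
theorem IsLength.le_iff {S : Set ι} {f g : ι → ℚ} (hf : IsLength P S f) (hg : IsLength P S g)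
    (hS : IsSubsystem P S) (hconn : IsConnected P S) {i j : ι} (hi : i ∈ S) (hj : j ∈ S) :
    f i ≤ f j ↔ g i ≤ g j := by
  obtain ⟨a, ⟨ha, hfa, hga⟩, h⟩ := exists_mem_pairingIn_pos P
    (A := {a ∈ S | f a = f j ∧ g a = g j}) hconn (fun a ha => ha.1) ⟨j, hj, rfl, rfl⟩
    (fun k hk a ha => ⟨hS k hk a ha.1, (hf.refl k hk a ha.1).trans ha.2.1,
      (hg.refl k hk a ha.1).trans ha.2.2⟩) hi
  have h' := pairingIn_pos_comm P h
  rw [← hfa, ← hga]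
  have key : ∀ {f : ι → ℚ}, IsLength P S f →
      (f i ≤ f a ↔ P.pairingIn ℤ i a ≤ P.pairingIn ℤ a i) := by
    intro f hf
    have h1 := hf.swap i hi a ha
    have h2 := hf.pos i hi
    have h3 := hf.pos a ha
    have h4 : (0 : ℚ) < P.pairingIn ℤ i a := by exact_mod_cast h
    have h5 : (0 : ℚ) < P.pairingIn ℤ a i := by exact_mod_cast h'
    rw [← @Int.cast_le ℚ]
    constructor
    · intro h6
      by_contra! h7
      nlinarith
    · intro h6
      by_contra! h7
      nlinarith
  rw [key hf, key hg]

theorem mem_short_iff {S : Set ι} (hS : IsSubsystem P S) (hconn : IsConnected P S) {i : ι} :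
    i ∈ short P S ↔ i ∈ S ∧ ∀ j ∈ S, inn P i i ≤ inn P j j := by
  refine and_congr_right fun hi => forall₂_congr fun j hj => ?_
  rw [← (isLength_sqLength P hS).le_iff (isLength_inn P S) hS hconn hi hj]
  exact Int.cast_le.symm

theorem IsSubsystem.sdiv {S : Set ι} (hS : IsSubsystem P S) : IsSubsystem P (sdiv P S) := by
  intro i hi j hj
  refine ⟨hS i hi.1 j hj.1, fun k hk h => ?_⟩
  refine hj.2 (P.reflectionPerm i k) (hS i hi.1 k hk) ?_
  rw [P.root_reflectionPerm, h, map_smul, P.root_reflectionPerm, P.reflection_same]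

/-- A root and its fourfold multiple would have Cartan integer 8. -/
theorem ne_two_smul_of_eq_two_smul {i j k : ι} (h : P.root j = (2 : F) • P.root i) :
    P.root k ≠ (2 : F) • P.root j := by
  intro h'
  have h1 := (P.pairingIn_one_four_iff ℤ i j).2 h
  have h2 : pairVec P k = (2 : ℤ) • pairVec P j + (0 : ℤ) • pairVec P j :=
    pairVec_eq_of_root_eq P (by rw [h']; simp [two_smul])
  have h3 := congrFun h2 i
  simp only [pairVec, Pi.add_apply, Pi.smul_apply, smul_eq_mul, h1.2] at h3
  have := P.pairingIn_pairingIn_mem_set_of_isCrystallographic k i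
  simp only [Set.mem_insert_iff, Set.mem_singleton_iff, Prod.mk.injEq] at this
  omega

theorem exists_mem_sdiv {S : Set ι} {i : ι} (hi : i ∈ S) :
    ∃ j ∈ sdiv P S, j = i ∨ P.root j = (2 : F) • P.root i := by
  by_cases h : i ∈ sdiv P S
  · exact ⟨i, h, Or.inl rfl⟩
  · have : ∃ j ∈ S, P.root j = (2 : F) • P.root i := by
      by_contra! h'
      exact h ⟨hi, h'⟩
    obtain ⟨j, hj, h'⟩ := this
    exact ⟨j, ⟨hj, fun k _ => ne_two_smul_of_eq_two_smul h'⟩, Or.inr h'⟩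

/-- Replace each root of a chain by its double whenever the double lies in `S`; this does not affect
orthogonality. -/
theorem IsConnected.sdiv {S : Set ι} (hS : IsConnected P S) : IsConnected P (sdiv P S) := by
  classical
  let f : ι → ι := fun i => if h : i ∈ S then (exists_mem_sdiv (P := P) h).choose else i
  have hf : ∀ i ∈ S, f i ∈ RootGraded.sdiv P S ∧ (f i = i ∨ P.root (f i) = (2 : F) • P.root i) := by
    intro i hi
    simp only [f, dif_pos hi]
    exact (exists_mem_sdiv (P := P) hi).choose_spec
  have hf' : ∀ i ∈ RootGraded.sdiv P S, f i = i := by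
    intro i hi
    obtain h | h := (hf i hi.1).2
    · exact h
    · exact absurd h (hi.2 _ (hf i hi.1).1.1)
  intro i hi j hj
  rw [← hf' i hi, ← hf' j hj]
  refine Relation.ReflTransGen.lift f ?_ _ _ (hS i hi.1 j hj.1)
  rintro a b ⟨ha, hb, hab⟩
  refine ⟨(hf a ha).1, (hf b hb).1, ?_⟩
  rw [Ne, P.pairing_eq_zero_iff']
  have h1 : P.pairing (f a) b ≠ 0 := by
    obtain h | h := (hf a ha).2
    · rwa [h]
    · rw [← RootPairing.root_coroot_eq_pairing, h, map_smul]
      simpa using hab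
  rw [Ne, P.pairing_eq_zero_iff'] at h1
  obtain h | h := (hf b hb).2
  · rwa [h]
  · rw [← RootPairing.root_coroot_eq_pairing, h, map_smul]
    simpa using h1

theorem mem_sdiv_iff_of_isFull {S : Set ι} (hfull : IsFull P S) {i : ι} (hi : i ∈ S) :
    i ∈ sdiv P S ↔ i ∈ sdiv P Set.univ := by
  refine ⟨fun h => ⟨Set.mem_univ i, fun j _ hj => h.2 j (hfull j ?_) hj⟩,
    fun h => ⟨hi, fun j _ => h.2 j (Set.mem_univ j)⟩⟩
  rw [hj]
  exact Submodule.smul_mem _ _ (Submodule.subset_span ⟨i, hi, rfl⟩)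

theorem rootForm_root_root (i j : ι) : P.RootForm (P.root i) (P.root j) = (inn P i j : F) := by
  rw [RootPairing.rootForm_apply_apply]
  simp only [inn, wform, pairVec]
  push_cast
  refine Finset.sum_congr rfl fun k _ => ?_
  have h : ∀ a, P.coroot' k (P.root a) = (P.pairingIn ℤ a k : F) := by
    intro a
    rw [RootPairing.root_coroot'_eq_pairing, ← P.algebraMap_pairingIn ℤ]; rfl
  rw [h, h, one_mul]

/-- Half of a root of an irreducible root system does not lie in the lattice
spanned by the roots whose double is not a root. -/
theorem root_notMem_closure (hP : IsConnected P Set.univ) (h3 : ∀ i j, P.pairingIn ℤ i j ≠ 3)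
    {i : ι} (hi : i ∉ sdiv P Set.univ) :
    P.root i ∉ AddSubgroup.closure (P.root '' sdiv P Set.univ) := by
  have hi' := hi
  rw [mem_sdiv_univ, not_not] at hi'
  obtain ⟨ν, hν⟩ := hi'
  set l := inn P i i
  have hl : 0 < l := inn_self_pos P i
  have hνl : inn P ν ν = 4 * l := by
    rw [two_smul] at hν
    rw [inn_add_self P hν]; ring
  -- With l the squared length of i, the form will be even relative to l on the lattice: the
  -- generators have squared length 2l or 4l. Length l is excluded since i has a double and its
  -- conjugates do too; length l/2 is excluded by comparison with ν, of squared length 4l.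
  have hlen : ∀ j ∈ sdiv P Set.univ, ∃ n : ℤ, inn P j j = 2 * l * n := by
    intro j hj
    have hlj := inn_self_pos P j
    rcases length_cases hP h3 j i with h | h | h | h | h
    · exact absurd (mem_sdiv_of_length_eq hP h hj) hi
    · exact ⟨1, by rw [h]; simp [l]⟩
    · rcases length_cases hP h3 j ν with h' | h' | h' | h' | h' <;> exfalso <;>
        linarith
    · exact ⟨2, by rw [h.1]; simp only [l]; push_cast; ring⟩
    · exact absurd h.2 ((mem_sdiv_univ P).1 hj)
  have h1 : ∀ x ∈ AddSubgroup.closure (P.root '' sdiv P Set.univ),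
      ∀ y ∈ AddSubgroup.closure (P.root '' sdiv P Set.univ),
        ∃ n : ℤ, P.RootForm x y = l * n := by
    intro x hx y hy
    induction hx, hy using AddSubgroup.closure_induction₂ with
    | mem x y hx hy =>
      obtain ⟨a, ha, rfl⟩ := hx
      obtain ⟨b, hb, rfl⟩ := hy
      obtain ⟨n, hn⟩ := hlen b hb
      refine ⟨P.pairingIn ℤ a b * n, ?_⟩
      rw [rootForm_root_root]
      have : inn P a b = l * (P.pairingIn ℤ a b * n : ℤ) := by
        have := two_mul_inn P a b
        rw [hn] at this
        push_cast
        linarith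
      rw [this]; push_cast; ring
    | zero_left x hx => exact ⟨0, by simp⟩
    | zero_right x hx => exact ⟨0, by simp⟩
    | add_left x y z _ _ _ h1 h2 =>
      obtain ⟨m, hm⟩ := h1
      obtain ⟨n, hn⟩ := h2
      exact ⟨m + n, by rw [map_add, LinearMap.add_apply, hm, hn]; push_cast; ring⟩
    | add_right x y z _ _ _ h1 h2 =>
      obtain ⟨m, hm⟩ := h1
      obtain ⟨n, hn⟩ := h2
      exact ⟨m + n, by rw [map_add, hm, hn]; push_cast; ring⟩
    | neg_left x y _ _ h =>
      obtain ⟨m, hm⟩ := h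
      exact ⟨-m, by rw [map_neg, LinearMap.neg_apply, hm]; push_cast; ring⟩
    | neg_right x y _ _ h =>
      obtain ⟨m, hm⟩ := h
      exact ⟨-m, by rw [map_neg, hm]; push_cast; ring⟩
  -- In |x + y|² = |x|² + 2(x, y) + |y|² the cross term is even because (x, y) is an integral
  -- multiple of l. The root i itself has the odd value l.
  have h2 : ∀ x ∈ AddSubgroup.closure (P.root '' sdiv P Set.univ),
        ∃ n : ℤ, P.RootForm x x = 2 * l * n := by
    intro x hx
    induction hx using AddSubgroup.closure_induction with
    | mem x hx =>
      obtain ⟨a, ha, rfl⟩ := hx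
      obtain ⟨n, hn⟩ := hlen a ha
      exact ⟨n, by rw [rootForm_root_root, hn]; push_cast; ring⟩
    | zero => exact ⟨0, by simp⟩
    | add x y hx hy h1' h2' =>
      obtain ⟨m, hm⟩ := h1'
      obtain ⟨n, hn⟩ := h2'
      obtain ⟨k, hk⟩ := h1 x hx y hy
      refine ⟨m + n + k, ?_⟩
      have hsymm : P.RootForm y x = P.RootForm x y := by
        simp only [RootPairing.rootForm_apply_apply, mul_comm]
      simp only [map_add, LinearMap.add_apply, hm, hn, hsymm, hk]
      push_cast; ring
    | neg x _ h =>
      obtain ⟨m, hm⟩ := h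
      exact ⟨m, by simp [hm]⟩
  intro h
  obtain ⟨n, hn⟩ := h2 _ h
  rw [rootForm_root_root] at hn
  have h4 : inn P i i = 2 * l * n := by exact_mod_cast hn
  have h5 : (1 : ℚ) = 2 * n := mul_left_cancel₀ hl.ne' (by linarith)
  have h6 : (1 : ℤ) = 2 * n := by exact_mod_cast h5
  omega

/-- The properties of the set of nonzero weights of the module generated by an extremal
vector of weight `α`. -/
structure IsWeightSet (P : RootPairing ι F M N) [P.IsCrystallographic] (Ω : Set ι) (α : ι) :
    Prop where
  mem : α ∈ Ω
  refl : ∀ k, ∀ i ∈ Ω, P.reflectionPerm k i ∈ Ω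
  length_le : ∀ i ∈ Ω, inn P i i ≤ inn P α α
  sub_mem : ∀ i ∈ Ω, P.root α - P.root i ∈ AddSubgroup.closure (P.root '' sdiv P Set.univ)
  add_mem : ∀ i ∈ Ω, ∀ j ∈ sdiv P Set.univ, P.pairingIn ℤ i j < 0 →
    ∀ k, P.root k = P.root i + P.root j → k ∈ Ω

namespace IsWeightSet

variable {Ω : Set ι} {α : ι}

theorem mem_of_length_eq (h : IsWeightSet P Ω α) (hP : IsConnected P Set.univ) {i : ι}
    (hi : inn P α α = inn P i i) : i ∈ Ω :=
  prop_of_length_eq (Q := (· ∈ Ω)) (isSubsystem_univ P) hP (fun k _ i _ hi => h.refl k i hi)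
    (Set.mem_univ α) (Set.mem_univ i) hi h.mem

/-- All weights are congruent to α modulo the lattice of `sdiv`, so they lie in this lattice, which
contains no half of a root. -/
theorem subset_sdiv (h : IsWeightSet P Ω α) (hP : IsConnected P Set.univ)
    (h3 : ∀ i j, P.pairingIn ℤ i j ≠ 3) (hα : α ∈ sdiv P Set.univ) : Ω ⊆ sdiv P Set.univ := by
  intro i hi
  by_contra hi'
  refine root_notMem_closure hP h3 hi' ?_
  have := AddSubgroup.sub_mem _ (AddSubgroup.subset_closure (Set.mem_image_of_mem P.root hα))
    (h.sub_mem i hi)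
  simpa using this

/-- Equality of lengths makes α short in the whole system as well. Weights are no longer than α, and
all roots of its length are conjugate to it. -/
theorem eq_short (h : IsWeightSet P Ω α) (hP : IsConnected P Set.univ) {S : Set ι}
    (hS : IsSubsystem P S) (hconn : IsConnected P S)
    (hlen : ∀ i, ∃ j ∈ S, inn P j j = inn P i i) (hα : α ∈ short P S) :
    Ω = short P Set.univ := by
  rw [mem_short_iff hS hconn] at hα
  have hmin : ∀ i, inn P α α ≤ inn P i i := by
    intro i
    obtain ⟨j, hj, hji⟩ := hlen i
    exact hji ▸ hα.2 j hj
  ext i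
  rw [mem_short_iff (isSubsystem_univ P) hP]
  refine ⟨fun hi => ⟨Set.mem_univ i, fun j _ => (h.length_le i hi).trans (hmin j)⟩, fun hi => ?_⟩
  exact h.mem_of_length_eq hP (le_antisymm (hmin i) (hi.2 α (Set.mem_univ α)))

theorem exists_sdiv_length_eq {S : Set ι} (hP : IsConnected P Set.univ) (hfull : IsFull P S)
    (hlen : ∀ i, ∃ j ∈ S, inn P j j = inn P i i) {i : ι} (hi : i ∈ sdiv P Set.univ) :
    ∃ j ∈ sdiv P S, inn P j j = inn P i i := by
  obtain ⟨j, hj, hji⟩ := hlen i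
  exact ⟨j, (mem_sdiv_iff_of_isFull hfull hj).2 (mem_sdiv_of_length_eq hP hji.symm hi), hji⟩

theorem eq_short_sdiv (h : IsWeightSet P Ω α) (hP : IsConnected P Set.univ)
    (h3 : ∀ i j, P.pairingIn ℤ i j ≠ 3) {S : Set ι}
    (hS : IsSubsystem P S) (hconn : IsConnected P S) (hfull : IsFull P S)
    (hlen : ∀ i, ∃ j ∈ S, inn P j j = inn P i i) (hα : α ∈ short P (sdiv P S)) :
    Ω = short P (sdiv P Set.univ) := by
  rw [mem_short_iff hS.sdiv hconn.sdiv] at hα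
  have hα' := (mem_sdiv_iff_of_isFull hfull hα.1.1).1 hα.1
  have hmin : ∀ i ∈ sdiv P Set.univ, inn P α α ≤ inn P i i := by
    intro i hi
    obtain ⟨j, hj, hji⟩ := exists_sdiv_length_eq hP hfull hlen hi
    exact hji ▸ hα.2 j hj
  ext i
  rw [mem_short_iff (isSubsystem_univ P).sdiv hP.sdiv]
  refine ⟨fun hi => ⟨h.subset_sdiv hP h3 hα' hi, fun j hj => (h.length_le i hi).trans (hmin j hj)⟩,
    fun hi => ?_⟩
  exact h.mem_of_length_eq hP (le_antisymm (hmin i hi.1) (hi.2 α hα'))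

theorem eq_sdiv (h : IsWeightSet P Ω α) (hP : IsConnected P Set.univ)
    (h3 : ∀ i j, P.pairingIn ℤ i j ≠ 3) {S : Set ι} (hfull : IsFull P S)
    (hlen : ∀ i, ∃ j ∈ S, inn P j j = inn P i i) (hα : α ∈ sdiv P S)
    (hmax : ∀ i ∈ sdiv P S, inn P i i ≤ inn P α α) :
    Ω = sdiv P Set.univ := by
  have hα' := (mem_sdiv_iff_of_isFull hfull hα.1).1 hα
  refine Set.Subset.antisymm (h.subset_sdiv hP h3 hα') fun i hi => ?_
  have hle : inn P i i ≤ inn P α α := by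
    obtain ⟨j, hj, hji⟩ := exists_sdiv_length_eq hP hfull hlen hi
    exact hji ▸ hmax j hj
  obtain ⟨a, -, ha, hal, hpos⟩ := exists_conj_pairing_pos (Q := (· ∈ Ω)) (isSubsystem_univ P) hP
    (fun k _ i _ hi => h.refl k i hi) (Set.mem_univ α) (Set.mem_univ i) h.mem
  have hi0 := inn_self_pos P i
  rcases pairing_cases P h3 hpos with h1 | h1 | h1 | h1 | h1 | h1
  · rwa [h1]
  · exact h.mem_of_length_eq hP (by linarith [h1.2.2])
  · linarith [h1.2.2]
  -- Here a is conjugate to α and twice as long as i in squared length. The root i - a is conjugate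
  -- to i and pairs negatively with a, so i = a + (i - a) is again a weight. The other ratios
  -- contradict the maximality of α or the absence of 2i.
  · have hr : P.root (P.reflectionPerm a i) = P.root i - P.root a := by
      rw [root_reflectionPerm_int, h1.1, one_smul]
    refine h.add_mem a ha (P.reflectionPerm a i) (refl_mem_sdiv P a hi) ?_ i (by rw [hr]; simp)
    apply pairingIn_neg_comm
    have h5 := congrFun (pairVec_sub P hr) a
    simp only [pairVec, Pi.sub_apply, h1.1, P.pairingIn_same] at h5
    omega
  · linarith [h1.2.2]
  · exact absurd ⟨a, h1.1⟩ ((mem_sdiv_univ P).1 hi)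

end IsWeightSet

end Sdiv

/-! ### Modules with a weight space decomposition -/

section Weights

variable {F K M : Type*} [Field F] [LieRing K] [LieAlgebra F K]
  [AddCommGroup M] [Module F M] [LieRingModule K M] [LieModule F K M]

/-- A submodule contains the weight components of its elements. -/
theorem mem_of_sum_mem {N : Submodule F M} (hN : ∀ (h : K), ∀ m ∈ N, ⁅h, m⁆ ∈ N)
    (s : Finset (Dual F K)) : ∀ v : Dual F K → M, (∀ α ∈ s, v α ∈ weightSpace K M α) →
    ∑ α ∈ s, v α ∈ N → ∀ α ∈ s, v α ∈ N := by
  classical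
  induction s using Finset.induction_on with
  | empty => simp
  | insert β s hβ ih =>
    intro v hv hsum
    have hs : ∀ α ∈ s, v α ∈ N := by
      intro α hα
      have hne : α ≠ β := by rintro rfl; exact hβ hα
      obtain ⟨h, hh⟩ : ∃ h, α h ≠ β h := by
        by_contra! h
        exact hne (LinearMap.ext h)
      have h1 := ih (fun γ => (γ h - β h) • v γ)
        (fun γ hγ => Submodule.smul_mem _ _ (hv γ (Finset.mem_insert_of_mem hγ))) ?_ α hα
      · exact (Submodule.smul_mem_iff N (sub_ne_zero.2 hh)).1 h1
      · have h2 := sub_mem (hN h _ hsum) (N.smul_mem (β h) hsum)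
        convert h2 using 1
        rw [lie_sum, Finset.smul_sum, ← Finset.sum_sub_distrib, Finset.sum_insert hβ,
          hv β (Finset.mem_insert_self β s) h, sub_self, zero_add]
        refine Finset.sum_congr rfl fun γ hγ => ?_
        rw [hv γ (Finset.mem_insert_of_mem hγ) h, sub_smul]
    intro α hα
    rcases Finset.mem_insert.1 hα with rfl | hα
    · rw [Finset.sum_insert hβ] at hsum
      exact (Submodule.add_mem_iff_left N (sum_mem hs)).1 hsum
    · exact hs α hα

theorem eq_zero_of_sum_eq_zero (s : Finset (Dual F K)) (v : Dual F K → M)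
    (hv : ∀ α ∈ s, v α ∈ weightSpace K M α) (h : ∑ α ∈ s, v α = 0) : ∀ α ∈ s, v α = 0 := by
  have := mem_of_sum_mem (N := (⊥ : Submodule F M)) (by simp) s v hv (by simpa using h)
  simpa using this

theorem iSupIndep_weightSpace : iSupIndep (fun α : Dual F K => weightSpace K M α) := by
  classical
  rw [iSupIndep_iff_finsetSum_eq_zero_imp_eq_zero]
  exact fun s v hv h => eq_zero_of_sum_eq_zero s v hv h

theorem hasWeightDecomposition_iff :
    HasWeightDecomposition F K M ↔ ⨆ α : Dual F K, weightSpace K M α = ⊤ := by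
  classical
  rw [HasWeightDecomposition, DirectSum.isInternal_submodule_iff_iSupIndep_and_iSup_eq_top]
  exact and_iff_right iSupIndep_weightSpace

theorem HasWeightDecomposition.exists_sum (h : HasWeightDecomposition F K M) (m : M) :
    ∃ (s : Finset (Dual F K)) (v : Dual F K → M),
      (∀ α, v α ∈ weightSpace K M α) ∧ ∑ α ∈ s, v α = m := by
  have hm : m ∈ ⨆ α : Dual F K, weightSpace K M α := by
    rw [hasWeightDecomposition_iff.1 h]; trivial
  obtain ⟨f, hf, hsum⟩ := (Submodule.mem_iSup_iff_exists_finsupp _ _).1 hm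
  exact ⟨f.support, f, hf, hsum⟩

theorem eq_of_mem_weightSpace {α β : Dual F K} {m : M} (hm : m ≠ 0)
    (hα : m ∈ weightSpace K M α) (hβ : m ∈ weightSpace K M β) : α = β := by
  ext h
  have := (hα h).symm.trans (hβ h)
  exact smul_left_injective F hm this

theorem mem_weights {α : Dual F K} {m : M} (hm : m ≠ 0) (hα : m ∈ weightSpace K M α) :
    α ∈ weights F K M := by
  intro h
  rw [h] at hα
  exact hm (by simpa using hα)

theorem exists_of_mem_weights {α : Dual F K} (hα : α ∈ weights F K M) :
    ∃ m ∈ weightSpace K M α, m ≠ 0 := (Submodule.ne_bot_iff _).1 hα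

end Weights

/-! ### Weight spaces under restriction to submodules -/

section Submodules

variable {F L V : Type*} [Field F] [LieRing L] [LieAlgebra F L] {H : LieSubalgebra F L}
  [AddCommGroup V] [Module F V] [LieRingModule L V] [LieModule F L V]

theorem lie_mem_weightSpace {α β : Dual F H} {x : L} {v : V} (hx : x ∈ weightSpace H L α)
    (hv : v ∈ weightSpace H V β) : ⁅x, v⁆ ∈ weightSpace H V (α + β) := by
  intro h
  have h1 : ⁅(h : L), x⁆ = α h • x := hx h
  have h2 : ⁅(h : L), v⁆ = β h • v := hv h
  change ⁅(h : L), ⁅x, v⁆⁆ = _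
  rw [leibniz_lie, h1, h2, smul_lie, lie_smul, LinearMap.add_apply, add_smul]

theorem mem_weightSpace_submodule (U : LieSubmodule F L V) {α : Dual F H} {u : U} :
    u ∈ weightSpace H U α ↔ (u : V) ∈ weightSpace H V α := by
  simp only [mem_weightSpace]
  exact forall_congr' fun h => Subtype.ext_iff

/-- A submodule of a module with a weight space decomposition has one. -/
theorem HasWeightDecomposition.submodule (hV : HasWeightDecomposition F H V)
    (U : LieSubmodule F L V) : HasWeightDecomposition F H U := by
  rw [hasWeightDecomposition_iff, eq_top_iff]
  rintro ⟨u, hu⟩ -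
  obtain ⟨s, v, hv, rfl⟩ := hV.exists_sum u
  have hvU := mem_of_sum_mem (K := H) (N := U.toSubmodule) (fun h m hm => U.lie_mem hm) s v
    (fun α _ => hv α) hu
  have : (⟨∑ α ∈ s, v α, hu⟩ : U) = ∑ α ∈ s.attach, ⟨v α.1, hvU α.1 α.2⟩ := by
    apply Subtype.ext
    simp [Finset.sum_attach s v]
  rw [this]
  exact sum_mem fun α _ => Submodule.mem_iSup_of_mem α.1
    ((mem_weightSpace_submodule U).2 (hv α.1))

end Submodules

/-! ### The structure of a split simple Lie algebra -/

section Structure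

open LieAlgebra LieAlgebra.IsKilling LieModule

variable {F L : Type*} [Field F] [CharZero F] [LieRing L] [LieAlgebra F L] [FiniteDimensional F L]
  {H : LieSubalgebra F L}

theorem IsSplittingCartan.mem_iff (hH : IsSplittingCartan H) {x : L} :
    x ∈ H ↔ ∀ h ∈ H, ⁅h, x⁆ = 0 := by
  have : x ∈ weightSpace H L (0 : Dual F H) ↔ x ∈ H := by rw [hH.zero_space]; rfl
  rw [← this, mem_weightSpace]
  simp [LieSubalgebra.coe_bracket_of_module]

theorem IsSplittingCartan.isLieAbelian (hH : IsSplittingCartan H) : IsLieAbelian H :=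
  ⟨fun x y => Subtype.ext (hH.mem_iff.1 y.2 x x.2)⟩

/-- If x normalizes the abelian algebra `H`, then [h, [h, x]] = 0, so α(h)² v_α = 0 for each
component. Hence α(h) v_α = 0, and x centralizes `H`, which is its own centralizer. -/
theorem IsSplittingCartan.isCartanSubalgebra (hH : IsSplittingCartan H) :
    H.IsCartanSubalgebra where
  nilpotent := by
    have := hH.isLieAbelian
    infer_instance
  self_normalizing := by
    have := hH.isLieAbelian
    refine le_antisymm (fun x hx => ?_) H.le_normalizer
    rw [LieSubalgebra.mem_normalizer_iff] at hx
    obtain ⟨s, v, hv, rfl⟩ := hH.decomposition.exists_sum x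
    have hmem : ∀ α ∈ s, ∀ h : H, α h • v α = 0 := by
      intro α hα h
      set y := ∑ α ∈ s, v α with hy
      have h1 : ⁅(h : L), ⁅(h : L), y⁆⁆ = 0 := by
        have : ⁅(h : L), y⁆ ∈ H := by
          rw [← lie_skew]
          exact neg_mem (hx h h.2)
        exact hH.mem_iff.1 this h h.2
      have h2 : ∑ α ∈ s, (α h * α h) • v α = 0 := by
        rw [← h1, hy, lie_sum, lie_sum]
        refine Finset.sum_congr rfl fun α _ => ?_
        have : ⁅(h : L), v α⁆ = α h • v α := hv α h
        rw [this, lie_smul, this, smul_smul]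
      have := eq_zero_of_sum_eq_zero (K := H) s (fun α => (α h * α h) • v α)
        (fun α _ => Submodule.smul_mem _ _ (hv α)) h2 α hα
      rcases smul_eq_zero.1 this with h3 | h3
      · rw [mul_self_eq_zero.1 h3, zero_smul]
      · rw [h3, smul_zero]
    rw [hH.mem_iff]
    intro h hh
    rw [lie_sum]
    refine Finset.sum_eq_zero fun α hα => ?_
    exact (hv α ⟨h, hh⟩).trans (hmem α hα ⟨h, hh⟩)

theorem IsSplittingCartan.isTriangularizable (hH : IsSplittingCartan H) :
    IsTriangularizable F H L where
  maxGenEigenspace_eq_top x := by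
    rw [eq_top_iff, ← hasWeightDecomposition_iff.1 hH.decomposition]
    refine iSup_le fun α => le_trans ?_ (le_iSup _ (α x))
    intro v hv
    refine (Module.End.mem_maxGenEigenspace _ _ _).2 ⟨1, ?_⟩
    have : ⁅x, v⁆ = α x • v := hv x
    simp [this]

variable [IsKilling F L]

theorem mem_rootSpace_iff [H.IsCartanSubalgebra] [IsTriangularizable F H L] {α : Dual F H} {x : L} :
    x ∈ rootSpace H α ↔ x ∈ weightSpace H L α := by
  constructor
  · exact fun hx h => lie_eq_smul_of_mem_rootSpace hx h
  · intro hx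
    exact LieModule.weightSpace_le_genWeightSpace L _ ((LieModule.mem_weightSpace _ _).2 hx)

/-- The facts about a root of a split Lie algebra that are used below; `c` is the coroot. -/
structure IsCoroot (H : LieSubalgebra F L) (γ : Dual F H) (c : H) : Prop where
  apply_self : γ c = 2
  finrank_eq_one : finrank F (weightSpace H L γ) = 1
  exists_sl2 : ∃ e ∈ weightSpace H L γ, ∃ f ∈ weightSpace H L (-γ), IsSl2Triple (c : L) e f
  lie_eq : ∀ e ∈ weightSpace H L γ, ∀ f ∈ weightSpace H L (-γ),
    ⁅e, f⁆ = (killingForm F L e f * (2 / killingForm F L c c)) • (c : L)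
  apply_eq : ∀ h : H, γ h = (2 / killingForm F L c c) * killingForm F L c h
  refl_mem : ∀ β ∈ weights F H L, β - β c • γ ∈ weights F H L

theorem exists_isCoroot (hH : IsSplittingCartan H) {γ : Dual F H} (hγ : γ ∈ weights F H L)
    (h0 : γ ≠ 0) : ∃ c : H, IsCoroot H γ c := by
  have := hH.isCartanSubalgebra
  have := hH.isTriangularizable
  have hw : ∀ β ∈ weights F H L, ∃ b : Weight F H L, b.toLinear = β := by
    intro β hβ
    refine ⟨⟨β, ?_⟩, by ext; rfl⟩
    intro h
    obtain ⟨m, hm, hm0⟩ := exists_of_mem_weights hβ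
    have h1 := mem_rootSpace_iff.2 hm
    change m ∈ genWeightSpace L β at h1
    rw [h] at h1
    exact hm0 (by simpa using h1)
  have hw' : ∀ b : Weight F H L, b.toLinear ∈ weights F H L := by
    intro b
    obtain ⟨x, hx, hx0⟩ := b.exists_ne_zero
    exact mem_weights hx0 (mem_rootSpace_iff.1 hx)
  obtain ⟨g, rfl⟩ := hw γ hγ
  have hg : g.IsNonZero := by
    intro h
    exact h0 (Weight.coe_toLinear_eq_zero_iff.2 h)
  have hs : weightSpace H L g.toLinear = (rootSpace H g).toSubmodule := by
    ext x; exact mem_rootSpace_iff.symm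
  set t := (cartanEquivDual H).symm g.toLinear with ht
  have ht' : ∀ h : H, killingForm F L t h = g h := by
    intro h
    have h1 := LinearMap.congr_fun ((cartanEquivDual H).apply_symm_apply g.toLinear) h
    exact h1
  have hgt : g t ≠ 0 := root_apply_cartanEquivDual_symm_ne_zero hg
  have hc : (coroot g : H) = (2 * (g t)⁻¹) • t := by
    rw [coroot, mul_smul]
    simp [two_smul, ht]
  have hcL : ((coroot g : H) : L) = (2 * (g t)⁻¹) • (t : L) := congrArg Subtype.val hc
  have hcc : killingForm F L (coroot g : H) (coroot g : H) = 4 * (g t)⁻¹ := by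
    rw [hcL, map_smul, map_smul, LinearMap.smul_apply, ht' t, smul_eq_mul, smul_eq_mul]
    field_simp
    norm_num
  -- Expressing the Killing dual t of the root through its coroot makes all later formulas depend on
  -- the coroot alone.
  have htc : t = (2 / killingForm F L (coroot g : H) (coroot g : H)) • coroot g := by
    rw [hcc, hc, smul_smul]
    have : 2 / (4 * (g t)⁻¹) * (2 * (g t)⁻¹) = 1 := by
      field_simp
      norm_num
    rw [this, one_smul]
  have htL : (t : L) = (2 / killingForm F L (coroot g : H) (coroot g : H)) •
      ((coroot g : H) : L) := congrArg Subtype.val htc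
  refine ⟨coroot g, root_apply_coroot hg, ?_, ?_, ?_, ?_, ?_⟩
  · rw [hs]
    exact finrank_rootSpace_eq_one g hg
  · obtain ⟨h, e, f, hsl, he, hf⟩ := exists_isSl2Triple_of_weight_isNonZero hg
    have := hsl.h_eq_coroot hg he hf
    subst this
    exact ⟨e, mem_rootSpace_iff.1 he, f, mem_rootSpace_iff.1 hf, hsl⟩
  · intro e he f hf
    have he' : e ∈ rootSpace H g := (mem_rootSpace_iff (α := g.toLinear)).2 he
    have hf' : f ∈ rootSpace H (-g) := (mem_rootSpace_iff (α := -g.toLinear)).2 hf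
    have : ⁅e, f⁆ = killingForm F L e f • (t : L) :=
      lie_eq_killingForm_smul_of_mem_rootSpace_of_mem_rootSpace_neg he' hf'
    rw [this, mul_smul, ← htL]
  · intro h
    rw [Weight.toLinear_apply, ← ht' h, htL, map_smul, LinearMap.smul_apply, smul_eq_mul]
  · intro β hβ
    obtain ⟨b, rfl⟩ := hw β hβ
    have := hw' (reflectRoot g b)
    convert this using 1
    rfl

open Classical in
theorem killingForm_eq_sum (hH : IsSplittingCartan H) (s : Finset (Dual F H))
    (hs : ∀ γ, γ ∈ s ↔ γ ∈ weights F H L ∧ γ ≠ 0) (h h' : H) :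
    killingForm F L h h' = ∑ γ ∈ s, γ h * γ h' := by
  have := hH.isCartanSubalgebra
  have := hH.isTriangularizable
  have h1 := LinearMap.congr_fun (LinearMap.congr_fun (restrict_killingForm_eq_sum (K := F) (L := L)
    (H := H)) h) h'
  have h2 : s = H.root.image (fun b : Weight F H L => b.toLinear) := by
    ext γ
    rw [hs, Finset.mem_image]
    constructor
    · rintro ⟨hγ, h0⟩
      refine ⟨⟨γ, fun h => ?_⟩, ?_, by ext; rfl⟩
      · obtain ⟨m, hm, hm0⟩ := exists_of_mem_weights hγ
        have h1 := mem_rootSpace_iff.2 hm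
        change m ∈ genWeightSpace L γ at h1
        rw [h] at h1
        exact hm0 (by simpa using h1)
      · rw [Finset.mem_filter]
        refine ⟨Finset.mem_univ _, fun h => h0 ?_⟩
        ext x
        exact congrFun h x
    · rintro ⟨b, hb, rfl⟩
      obtain ⟨x, hx, hx0⟩ := b.exists_ne_zero
      refine ⟨mem_weights hx0 ((mem_rootSpace_iff (α := b.toLinear)).1 hx), ?_⟩
      rw [Weight.coe_toLinear_ne_zero_iff]
      exact (Finset.mem_filter.1 hb).2
  rw [h2, Finset.sum_image]
  · refine Eq.trans h1 ?_
    simp only [LinearMap.sum_apply, LinearMap.smulRight_apply, LinearMap.smul_apply, smul_eq_mul]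
  · intro a _ b _ hab
    exact Weight.ext fun x => LinearMap.congr_fun hab x

theorem exists_killingForm_eq (hH : IsSplittingCartan H) (μ : Dual F H) :
    ∃ t : H, ∀ h : H, killingForm F L t h = μ h := by
  have := hH.isCartanSubalgebra
  exact ⟨(cartanEquivDual H).symm μ, fun h =>
    LinearMap.congr_fun ((cartanEquivDual H).apply_symm_apply μ) h⟩

end Structure

/-! ### Comparison with an abstract root system -/

section Comparison

open LieAlgebra

variable {F L ι N : Type*} [Field F] [CharZero F] [LieRing L] [LieAlgebra F L]
  [FiniteDimensional F L] [IsKilling F L] {H : LieSubalgebra F L}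
  [Fintype ι] [AddCommGroup N] [Module F N]
  {P : RootPairing ι F (Dual F H) N} [P.IsRootSystem] [P.IsCrystallographic]

theorem root_mem_weights (hR : weights F H L = insert 0 (P.root '' sdiv P Set.univ)) {i : ι}
    (hi : i ∈ sdiv P Set.univ) : P.root i ∈ weights F H L := by
  rw [hR]; exact Or.inr ⟨i, hi, rfl⟩

theorem span_sdiv_eq_top : Submodule.span F (P.root '' sdiv P Set.univ) = ⊤ := by
  rw [eq_top_iff, ← RootPairing.IsRootSystem.span_root_eq_top (P := P), Submodule.span_le]
  rintro _ ⟨i, rfl⟩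
  obtain ⟨j, hj, rfl | h⟩ := exists_mem_sdiv (P := P) (Set.mem_univ i)
  · exact Submodule.subset_span ⟨j, hj, rfl⟩
  · have : P.root i = (2 : F)⁻¹ • P.root j := by rw [h, smul_smul]; simp
    rw [this]
    exact Submodule.smul_mem _ _ (Submodule.subset_span ⟨j, hj, rfl⟩)

/-- For a root of the Lie algebra, the coroot in the Cartan subalgebra is the abstract one. -/
theorem exists_isCoroot_root (hH : IsSplittingCartan H)
    (hR : weights F H L = insert 0 (P.root '' sdiv P Set.univ)) {i : ι}
    (hi : i ∈ sdiv P Set.univ) :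
    ∃ c : H, IsCoroot H (P.root i) c ∧ ∀ x : Dual F H, x c = P.toLinearMap x (P.coroot i) := by
  obtain ⟨c, hc⟩ := exists_isCoroot hH (root_mem_weights hR hi) (P.ne_zero i)
  refine ⟨c, hc, fun x => ?_⟩
  have hfin : (weights F H L).Finite := by
    rw [hR]; exact ((Set.toFinite _).image _).insert _
  have hspan : Submodule.span F (weights F H L) = ⊤ := by
    rw [eq_top_iff, ← span_sdiv_eq_top (P := P), hR]
    exact Submodule.span_mono (Set.subset_insert _ _)
  -- A functional with value 2 on a vector whose reflection preserves a finite spanning set is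
  -- unique. The set of weights of `L` is preserved by the reflections from both coroots.
  have := Dual.eq_of_preReflection_mapsTo (x := P.root i) hfin hspan (f := Dual.eval F H c)
    (g := P.coroot' i) hc.apply_self ?_ (by simp) ?_
  · exact LinearMap.congr_fun this x
  · intro β hβ
    simpa [preReflection_apply] using hc.refl_mem β hβ
  · intro β hβ
    rw [hR] at hβ ⊢
    obtain rfl | ⟨j, hj, rfl⟩ := hβ
    · left; simp
    · right
      refine ⟨P.reflectionPerm i j, refl_mem_sdiv P i hj, ?_⟩
      rw [P.root_reflectionPerm]
      rfl

open Classical in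
theorem killingForm_eq_sum_root (hH : IsSplittingCartan H)
    (hR : weights F H L = insert 0 (P.root '' sdiv P Set.univ)) (h h' : H) :
    killingForm F L h h' =
      ∑ k, (if k ∈ sdiv P Set.univ then 1 else 0) * (P.root k h * P.root k h') := by
  rw [killingForm_eq_sum hH ((Finset.univ.filter (· ∈ sdiv P Set.univ)).image P.root), Finset.sum_image]
  · simp [Finset.sum_filter]
  · intro a _ b _ hab
    exact P.root.injective hab
  · intro γ
    rw [hR]
    simp only [Finset.mem_image, Finset.mem_filter, Finset.mem_univ, true_and, Set.mem_insert_iff,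
      Set.mem_image]
    constructor
    · rintro ⟨a, ha, rfl⟩
      exact ⟨Or.inr ⟨a, ha, rfl⟩, P.ne_zero a⟩
    · rintro ⟨rfl | h, h0⟩
      · exact absurd rfl h0
      · exact h

/-- `c` gives the coroots of the roots of the Lie algebra `L`, which are the roots `i` of `P` whose
double is not a root. -/
structure IsSplitting (H : LieSubalgebra F L) (P : RootPairing ι F (Dual F H) N)
    [P.IsCrystallographic] (c : ι → H) : Prop where
  isSplittingCartan : IsSplittingCartan H
  weights_eq : weights F H L = insert 0 (P.root '' sdiv P Set.univ)
  isCoroot : ∀ i ∈ sdiv P Set.univ, IsCoroot H (P.root i) (c i)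
  apply_eq : ∀ i ∈ sdiv P Set.univ, ∀ x : Dual F H, x (c i) = P.toLinearMap x (P.coroot i)

theorem exists_isSplitting (hH : IsSplittingCartan H)
    (hR : weights F H L = insert 0 (P.root '' sdiv P Set.univ)) :
    ∃ c : ι → H, IsSplitting H P c := by
  classical
  refine ⟨fun i => if h : i ∈ sdiv P Set.univ then (exists_isCoroot_root hH hR h).choose else 0,
    hH, hR, fun i hi => ?_, fun i hi => ?_⟩
  · simp only [dif_pos hi]
    exact (exists_isCoroot_root hH hR hi).choose_spec.1
  · simp only [dif_pos hi]
    exact (exists_isCoroot_root hH hR hi).choose_spec.2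

end Comparison

/-! ### The Casimir operator -/

section Casimir

open LieAlgebra

variable {F L V σ : Type*} [Field F] [CharZero F] [LieRing L] [LieAlgebra F L]
  [FiniteDimensional F L] [IsKilling F L] [Fintype σ] [DecidableEq σ]
  [AddCommGroup V] [Module F V] [LieRingModule L V] [LieModule F L V] (b : Basis σ F L)

/-- The basis that is dual to `b` with respect to the Killing form. -/
noncomputable def killingDual : Basis σ F L :=
  LinearMap.BilinForm.dualBasis (killingForm F L) (IsKilling.killingForm_nondegenerate F L) b

theorem killingForm_killingDual (s t : σ) :
    killingForm F L (killingDual b s) (b t) = if t = s then 1 else 0 :=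
  LinearMap.BilinForm.apply_dualBasis_left _ b s t

theorem killingForm_symm (x y : L) : killingForm F L x y = killingForm F L y x :=
  LieModule.traceForm_comm F L L x y

theorem killingForm_lie (x y z : L) : killingForm F L ⁅x, y⁆ z = -killingForm F L y ⁅x, z⁆ := by
  rw [← lie_skew, map_neg, LinearMap.neg_apply, LieModule.traceForm_apply_lie_apply]

theorem sum_killingForm_killingDual (x : L) : ∑ s, killingForm F L x (killingDual b s) • b s = x := by
  conv_rhs => rw [← b.sum_repr x]
  refine Finset.sum_congr rfl fun s _ => ?_
  congr 1
  conv_lhs => rw [← b.sum_repr x, killingForm_symm, map_sum]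
  simp [killingForm_killingDual]

theorem sum_killingForm_basis (x : L) : ∑ s, killingForm F L x (b s) • killingDual b s = x := by
  conv_rhs => rw [← (killingDual b).sum_repr x]
  refine Finset.sum_congr rfl fun s _ => ?_
  congr 1
  conv_lhs => rw [← (killingDual b).sum_repr x, map_sum, LinearMap.sum_apply]
  simp [killingForm_killingDual]

/-- The Casimir operator of a module. -/
noncomputable def casimir (v : V) : V := ∑ s, ⁅b s, ⁅killingDual b s, v⁆⁆

/-- By invariance of the Killing form, the matrices of ad x in a basis and in its dual basis are
negative transposes, so the two commutator terms cancel. -/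
theorem lie_casimir (x : L) (v : V) : ⁅x, casimir b v⁆ = casimir b ⁅x, v⁆ := by
  have h1 : ∑ s, ⁅⁅x, b s⁆, ⁅killingDual b s, v⁆⁆ =
      ∑ s, ∑ t, killingForm F L ⁅x, b s⁆ (killingDual b t) • ⁅b t, ⁅killingDual b s, v⁆⁆ := by
    refine Finset.sum_congr rfl fun s _ => ?_
    conv_lhs => rw [← sum_killingForm_killingDual b ⁅x, b s⁆]
    simp [sum_lie, smul_lie]
  have h2 : ∑ s, ⁅b s, ⁅⁅x, killingDual b s⁆, v⁆⁆ =
      ∑ s, ∑ t, killingForm F L ⁅x, killingDual b s⁆ (b t) • ⁅b s, ⁅killingDual b t, v⁆⁆ := by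
    refine Finset.sum_congr rfl fun s _ => ?_
    conv_lhs => rw [← sum_killingForm_basis b ⁅x, killingDual b s⁆]
    simp [sum_lie, smul_lie, lie_sum, lie_smul]
  have h3 : ∑ s, ⁅⁅x, b s⁆, ⁅killingDual b s, v⁆⁆ + ∑ s, ⁅b s, ⁅⁅x, killingDual b s⁆, v⁆⁆ = 0 := by
    rw [h1, h2, Finset.sum_comm, ← Finset.sum_add_distrib]
    refine Finset.sum_eq_zero fun s _ => ?_
    rw [← Finset.sum_add_distrib]
    refine Finset.sum_eq_zero fun t _ => ?_
    rw [killingForm_lie, killingForm_symm (b t), neg_smul, neg_add_cancel]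
  rw [casimir, casimir, lie_sum]
  have h4 : ∀ s, ⁅x, ⁅b s, ⁅killingDual b s, v⁆⁆⁆ = ⁅⁅x, b s⁆, ⁅killingDual b s, v⁆⁆ +
      ⁅b s, ⁅⁅x, killingDual b s⁆, v⁆⁆ + ⁅b s, ⁅killingDual b s, ⁅x, v⁆⁆⁆ := by
    intro s
    rw [leibniz_lie x (b s), leibniz_lie x (killingDual b s), lie_add, add_assoc]
  simp only [h4, Finset.sum_add_distrib]
  rw [h3, zero_add]

theorem casimir_smul (r : F) (v : V) : casimir b (r • v) = r • casimir b v := by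
  simp [casimir, lie_smul, Finset.smul_sum]

theorem casimir_add (v w : V) : casimir b (v + w) = casimir b v + casimir b w := by
  simp [casimir, lie_add, Finset.sum_add_distrib]

theorem casimir_coe (U : LieSubmodule F L V) (u : U) : ((casimir b u : U) : V) = casimir b (u : V) := by
  simp [casimir]

/-- Invariance of the form moves ad h to the original basis with a sign. -/
theorem killingDual_mem_weightSpace {H : LieSubalgebra F L} {γ : σ → Dual F H}
    (hb : ∀ s, b s ∈ weightSpace H L (γ s)) (s : σ) :
    killingDual b s ∈ weightSpace H L (-γ s) := by
  intro h
  change ⁅(h : L), killingDual b s⁆ = _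
  rw [← sum_killingForm_basis b ⁅(h : L), killingDual b s⁆]
  have : ∀ t, killingForm F L ⁅(h : L), killingDual b s⁆ (b t) =
      if t = s then - γ s h else 0 := by
    intro t
    have h1 : ⁅(h : L), b t⁆ = γ t h • b t := hb t h
    rw [killingForm_lie, h1, map_smul, killingForm_killingDual]
    split_ifs with h
    · simp [h]
    · simp
  simp [this]

theorem killingForm_eq_zero_of_weight {H : LieSubalgebra F L} {α β : Dual F H} {x y : L}
    (hx : x ∈ weightSpace H L α) (hy : y ∈ weightSpace H L β) (h : α + β ≠ 0) :
    killingForm F L x y = 0 := by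
  obtain ⟨k, hk⟩ : ∃ k, (α + β) k ≠ 0 := by
    by_contra! h'
    exact h (LinearMap.ext h')
  have h1 : ⁅(k : L), x⁆ = α k • x := hx k
  have h2 : ⁅(k : L), y⁆ = β k • y := hy k
  have h3 := killingForm_lie (F := F) (k : L) x y
  rw [h1, h2, map_smul, map_smul, LinearMap.smul_apply] at h3
  have h4 : (α + β) k * killingForm F L x y = 0 := by
    rw [LinearMap.add_apply, add_mul]
    simp only [smul_eq_mul] at h3
    rw [h3]; ring
  exact (mul_eq_zero.1 h4).resolve_left hk

end Casimir

/-! ### The eigenvalue of the Casimir operator on extremal vectors -/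

section Coefficients

variable {ι F M N : Type*} [Fintype ι] [Field F] [CharZero F] [AddCommGroup M] [Module F M]
  [AddCommGroup N] [Module F N] {P : RootPairing ι F M N} [P.IsCrystallographic]

variable (P) in
open Classical in
/-- The coefficients in the expression of the Killing form by pairings with coroots. -/
noncomputable def killingCoeff (k : ι) : ℚ :=
  if k ∈ sdiv P Set.univ then
    2 / ∑ j, (if j ∈ sdiv P Set.univ then 1 else 0) * (P.pairingIn ℤ j k : ℚ) ^ 2 else 0

theorem killingCoeff_nonneg (k : ι) : 0 ≤ killingCoeff P k := by
  rw [killingCoeff]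
  split_ifs
  · refine div_nonneg zero_le_two (Finset.sum_nonneg fun j _ => mul_nonneg ?_ (sq_nonneg _))
    split_ifs <;> simp
  · exact le_rfl

theorem killingCoeff_pos {k : ι} (hk : k ∈ sdiv P Set.univ) : 0 < killingCoeff P k := by
  rw [killingCoeff, if_pos hk]
  refine div_pos zero_lt_two (Finset.sum_pos' (fun j _ => mul_nonneg ?_ (sq_nonneg _))
    ⟨k, Finset.mem_univ k, ?_⟩)
  · split_ifs <;> simp
  · simp [hk]

theorem refl_mem_sdiv_iff (j k : ι) :
    P.reflectionPerm j k ∈ sdiv P Set.univ ↔ k ∈ sdiv P Set.univ :=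
  ⟨fun h => by simpa using refl_mem_sdiv P j h, refl_mem_sdiv P j⟩

theorem killingCoeff_refl (j k : ι) : killingCoeff P (P.reflectionPerm j k) = killingCoeff P k := by
  classical
  have h : ∑ i, (if i ∈ sdiv P Set.univ then 1 else 0) *
        (P.pairingIn ℤ (P.reflectionPerm j i) k : ℚ) ^ 2 =
      ∑ i, (if i ∈ sdiv P Set.univ then 1 else 0) * (P.pairingIn ℤ i k : ℚ) ^ 2 :=
    Fintype.sum_equiv (P.reflectionPerm j) _ _ fun i => by simp only [refl_mem_sdiv_iff]
  simp only [killingCoeff, refl_mem_sdiv_iff, P.pairingIn_reflectionPerm]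
  rw [h]

variable (P) in
/-- The eigenvalue of the Casimir operator on an extremal vector whose weight has the given
values on the coroots. -/
noncomputable def casimirValue (m : ι → ℤ) : ℚ :=
  ∑ k, (killingCoeff P k * m k) ^ 2 + ∑ k, killingCoeff P k * max (m k) 0

end Coefficients

/-! ### The Casimir operator in a basis of weight vectors -/

section Eigenvalue

open LieAlgebra

variable {F L ι N : Type*} [Field F] [CharZero F] [LieRing L] [LieAlgebra F L]
  [FiniteDimensional F L] [IsKilling F L] {H : LieSubalgebra F L}
  [Fintype ι] [AddCommGroup N] [Module F N]
  {P : RootPairing ι F (Dual F H) N} [P.IsRootSystem] [P.IsCrystallographic] {c : ι → H}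

theorem IsSplitting.root_apply (hc : IsSplitting H P c) {k : ι} (hk : k ∈ sdiv P Set.univ) (i : ι) :
    P.root i (c k) = (P.pairingIn ℤ i k : F) := by
  rw [hc.apply_eq k hk, RootPairing.root_coroot_eq_pairing, ← P.algebraMap_pairingIn ℤ]
  rfl

theorem IsSplitting.killingCoeff_eq (hc : IsSplitting H P c) {k : ι}
    (hk : k ∈ sdiv P Set.univ) : (killingCoeff P k : F) = 2 / killingForm F L (c k) (c k) := by
  rw [killingForm_eq_sum_root hc.isSplittingCartan hc.weights_eq, killingCoeff, if_pos hk]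
  push_cast
  congr 1
  refine Finset.sum_congr rfl fun j _ => ?_
  rw [hc.root_apply hk]
  split_ifs <;> push_cast <;> ring

variable (P) in
/-- The weights of a split Lie algebra. -/
noncomputable def rootOrZero : Option {k // k ∈ sdiv P Set.univ} → Dual F H :=
  fun o => o.elim 0 (fun k => P.root k)

open Classical in
theorem IsSplitting.isInternal (hc : IsSplitting H P c) :
    DirectSum.IsInternal (fun o => weightSpace H L (rootOrZero P o)) := by
  have hinj : Function.Injective (rootOrZero P) := by
    rintro (_ | a) (_ | b) h
    · rfl
    · exact absurd h.symm (P.ne_zero _)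
    · exact absurd h (P.ne_zero _)
    · exact congrArg some (Subtype.ext (P.root.injective h))
  rw [DirectSum.isInternal_submodule_iff_iSupIndep_and_iSup_eq_top]
  refine ⟨(iSupIndep_weightSpace (F := F) (K := H) (M := L)).comp hinj, ?_⟩
  rw [eq_top_iff, ← hasWeightDecomposition_iff.1 hc.isSplittingCartan.decomposition]
  refine iSup_le fun γ => ?_
  by_cases hγ : γ ∈ weights F H L
  · rw [hc.weights_eq] at hγ
    rcases hγ with rfl | ⟨i, hi, rfl⟩
    · exact le_iSup (fun o => weightSpace H L (rootOrZero P o)) none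
    · exact le_iSup (fun o => weightSpace H L (rootOrZero P o)) (some ⟨i, hi⟩)
  · have : weightSpace H L γ = ⊥ := by simpa [weights] using hγ
    rw [this]; exact bot_le

open Classical in
/-- A basis of the Lie algebra that consists of weight vectors. -/
noncomputable def IsSplitting.basis (hc : IsSplitting H P c) :
    Basis (Σ o, Fin (finrank F (weightSpace H L (rootOrZero P o)))) F L :=
  hc.isInternal.collectedBasis fun o => finBasis F (weightSpace H L (rootOrZero P o))

theorem IsSplitting.basis_mem (hc : IsSplitting H P c)
    (s : Σ o, Fin (finrank F (weightSpace H L (rootOrZero P o)))) :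
    hc.basis s ∈ weightSpace H L (rootOrZero P s.1) := by
  classical
  exact hc.isInternal.collectedBasis_mem _ s

variable {V : Type*} [AddCommGroup V] [Module F V] [LieRingModule L V] [LieModule F L V]

open Classical in
-- This is the formula (μ, μ + 2ρ) without a choice of positive roots: the Cartan part gives the
-- Killing norm of μ, and the roots pairing positively with μ play the role of the positive ones.
theorem IsSplitting.casimir_eq (hc : IsSplitting H P c) {μ : Dual F H} {w : V}
    (hw : w ∈ weightSpace H V μ) {m : ι → ℤ} (hm : ∀ k ∈ sdiv P Set.univ, μ (c k) = m k)
    (hext : ∀ k ∈ sdiv P Set.univ, 0 ≤ m k → ∀ e ∈ weightSpace H L (P.root k), ⁅e, w⁆ = 0) :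
    casimir hc.basis w = (casimirValue P m : F) • w := by
  set b := hc.basis
  have hb := hc.basis_mem
  have hb' := killingDual_mem_weightSpace b hb
  have hH := hc.isSplittingCartan
  -- the contribution of the roots
  have hroot : ∀ (k : {k // k ∈ sdiv P Set.univ}) j, ⁅b ⟨some k, j⟩, ⁅killingDual b ⟨some k, j⟩, w⁆⁆ =
      ((killingCoeff P k * max (m k) 0 : ℚ) : F) • w := by
    rintro ⟨k, hk⟩ j
    have h1 : b ⟨some ⟨k, hk⟩, j⟩ ∈ weightSpace H L (P.root k) := hb _
    have h2 : killingDual b ⟨some ⟨k, hk⟩, j⟩ ∈ weightSpace H L (-P.root k) := hb' _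
    rcases le_or_gt (m k) 0 with h | h
    -- The dual basis vector has weight -k, which pairs nonnegatively with μ, so it already kills w.
    · have h3 : m (P.reflectionPerm k k) = - m k := by
        have h4 := hm _ (refl_mem_sdiv P k hk)
        rw [hc.apply_eq _ (refl_mem_sdiv P k hk), P.coroot_reflectionPerm,
          P.coreflection_apply_self, map_neg, ← hc.apply_eq k hk, hm k hk] at h4
        exact_mod_cast h4.symm
      rw [hext _ (refl_mem_sdiv P k hk) (by omega) _
        (by rwa [P.root_reflectionPerm, P.reflection_apply_self]), lie_zero]
      have h0 : max (m k) 0 = 0 := max_eq_right h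
      simp only
      rw [h0]; simp
    · have h3 := (hc.isCoroot k hk).lie_eq _ h1 _ h2
      rw [killingForm_symm, killingForm_killingDual, if_pos rfl, one_mul,
        ← hc.killingCoeff_eq hk] at h3
      have h5 : ⁅(c k : L), w⁆ = (m k : F) • w := by rw [← hm k hk]; exact hw (c k)
      rw [leibniz_lie, h3, hext k hk h.le _ h1, lie_zero, add_zero, smul_lie, h5, smul_smul]
      have h0 : max (m k) 0 = m k := max_eq_left h.le
      simp only
      rw [h0]; push_cast; rfl
  -- the contribution of the Cartan subalgebra
  obtain ⟨t, ht⟩ := exists_killingForm_eq hH μ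
  have hmemH : ∀ x ∈ weightSpace H L (0 : Dual F H), x ∈ H := by
    intro x hx
    rw [hH.zero_space] at hx
    exact hx
  have htw : (t : L) ∈ weightSpace H L (0 : Dual F H) := by
    rw [hH.zero_space]; exact t.2
  have hcartan : ∀ j, ⁅b ⟨none, j⟩, ⁅killingDual b ⟨none, j⟩, w⁆⁆ =
      (killingForm F L t (killingDual b ⟨none, j⟩) * killingForm F L t (b ⟨none, j⟩)) • w := by
    intro j
    have h1 := hmemH _ (hb ⟨none, j⟩)
    have h2 := hmemH (killingDual b ⟨none, j⟩) (by
      have := hb' ⟨none, j⟩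
      rwa [show -rootOrZero P none = (0 : Dual F H) from neg_zero] at this)
    have h3 : ⁅b ⟨none, j⟩, w⁆ = μ ⟨_, h1⟩ • w := hw ⟨_, h1⟩
    have h4 : ⁅killingDual b ⟨none, j⟩, w⁆ = μ ⟨_, h2⟩ • w := hw ⟨_, h2⟩
    rw [h4, lie_smul, h3, smul_smul, ← ht, ← ht]
  have htt : ∑ j, killingForm F L t (killingDual b ⟨none, j⟩) * killingForm F L t (b ⟨none, j⟩) =
      killingForm F L t t := by
    have h0 := congrArg (fun x => killingForm F L x t) (sum_killingForm_killingDual b (t : L))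
    simp only [map_sum, LinearMap.sum_apply, map_smul, LinearMap.smul_apply, smul_eq_mul] at h0
    rw [← h0, Fintype.sum_sigma, Fintype.sum_option, Finset.sum_eq_zero (s := Finset.univ (α := {k // _})),
      add_zero]
    · refine Finset.sum_congr rfl fun j _ => ?_
      rw [killingForm_symm (b _)]
    · rintro k -
      refine Finset.sum_eq_zero fun j _ => ?_
      rw [killingForm_eq_zero_of_weight (hb ⟨some k, j⟩) htw, mul_zero]
      rw [add_zero]
      exact P.ne_zero k
  have htt' : killingForm F L t t = ((∑ k, (killingCoeff P k * m k) ^ 2 : ℚ) : F) := by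
    rw [killingForm_eq_sum_root hH hc.weights_eq]
    push_cast
    refine Finset.sum_congr rfl fun k _ => ?_
    by_cases hk : k ∈ sdiv P Set.univ
    · rw [if_pos hk, (hc.isCoroot k hk).apply_eq t, ← hc.killingCoeff_eq hk, killingForm_symm, ht,
        hm k hk]
      ring
    · simp [hk, killingCoeff]
  rw [casimir, Fintype.sum_sigma, Fintype.sum_option]
  simp only [hroot, hcartan, ← Finset.sum_smul, htt, htt']
  -- Each root space contributes one basis vector, hence one copy of its term.
  have hone : ∀ k : {k // k ∈ sdiv P Set.univ},
      finrank F (weightSpace H L (rootOrZero P (some k))) = 1 :=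
    fun k => (hc.isCoroot k k.2).finrank_eq_one
  simp only [Finset.sum_const, Finset.card_univ, Fintype.card_fin, hone, one_smul]
  have hsum : ∑ k : {k // k ∈ sdiv P Set.univ}, killingCoeff P k * ((max (m k) 0 : ℤ) : ℚ) =
      ∑ k, killingCoeff P k * ((max (m k) 0 : ℤ) : ℚ) := by
    rw [← Finset.sum_subtype (Finset.univ.filter fun k => k ∈ sdiv P Set.univ) (by simp)
      (fun k => killingCoeff P k * ((max (m k) 0 : ℤ) : ℚ)), Finset.sum_filter]
    refine Finset.sum_congr rfl fun k _ => ?_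
    split_ifs with hk
    · rfl
    · rw [killingCoeff, if_neg hk, zero_mul]
  rw [← add_smul, casimirValue, ← Rat.cast_sum, hsum, ← Rat.cast_add]

end Eigenvalue

/-! ### Modules with finitely many weights -/

section FiniteWeights

open LieModule

variable {F L V : Type*} [Field F] [CharZero F] [LieRing L] [LieAlgebra F L]
  [FiniteDimensional F L] {H : LieSubalgebra F L}
  [AddCommGroup V] [Module F V] [LieRingModule L V] [LieModule F L V]
  {γ μ : Dual F H} {c : H} {v : V}

theorem pow_toEnd_mem_weightSpace {x : L} (hx : x ∈ weightSpace H L γ) (hv : v ∈ weightSpace H V μ)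
    (n : ℕ) : (toEnd F L V x ^ n) v ∈ weightSpace H V (μ + n • γ) := by
  induction n with
  | zero => simpa using hv
  | succ n ih =>
    rw [pow_succ', Module.End.mul_apply, toEnd_apply_apply]
    have := lie_mem_weightSpace hx ih
    rwa [show γ + (μ + n • γ) = μ + (n + 1) • γ by rw [succ_nsmul]; abel] at this

theorem exists_pow_toEnd_eq_zero (hV : (weights F H V).Finite) (hγ : γ ≠ 0) {x : L}
    (hx : x ∈ weightSpace H L γ) (hv : v ∈ weightSpace H V μ) :
    ∃ n : ℕ, (toEnd F L V x ^ n) v = 0 := by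
  by_contra! h
  refine Set.infinite_of_injective_forall_mem (f := fun n : ℕ => μ + n • γ) (fun m n hmn => ?_)
    (fun n => mem_weights (h n) (pow_toEnd_mem_weightSpace hx hv n)) hV
  obtain ⟨h, hh⟩ : ∃ h, γ h ≠ 0 := by
    by_contra! h'
    exact hγ (LinearMap.ext h')
  have h1 := LinearMap.congr_fun (add_left_cancel hmn) h
  simp only [LinearMap.smul_apply, nsmul_eq_mul] at h1
  exact_mod_cast mul_right_cancel₀ hh h1

theorem IsCoroot.ne_zero (hγ : IsCoroot H γ c) : γ ≠ 0 := by
  rintro rfl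
  simpa using hγ.apply_self

/-- A nonzero weight vector that is killed by `L_γ` has a nonnegative integral weight on the
coroot of `γ`, and the corresponding string of weights below it. -/
theorem IsCoroot.exists_nat (hγ : IsCoroot H γ c) (hV : (weights F H V).Finite)
    (hv : v ∈ weightSpace H V μ) (hv0 : v ≠ 0) (he : ∀ e ∈ weightSpace H L γ, ⁅e, v⁆ = 0) :
    ∃ n : ℕ, μ c = n ∧ ∀ i ≤ n, μ - i • γ ∈ weights F H V := by
  obtain ⟨e, hee, f, hf, t⟩ := hγ.exists_sl2
  have hp : t.HasPrimitiveVectorWith v (μ c) := ⟨hv0, hv c, he e hee⟩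
  obtain ⟨n, hn, hn'⟩ : ∃ n : ℕ, (toEnd F L V f ^ n) v ≠ 0 ∧ (toEnd F L V f ^ (n + 1)) v = 0 :=
    Nat.exists_not_and_succ_of_not_zero_of_exists (p := fun n => (toEnd F L V f ^ n) v = 0) hv0
      (exists_pow_toEnd_eq_zero hV (neg_ne_zero.2 hγ.ne_zero) hf hv)
  have hμ : μ c = n := by
    have := hp.lie_e_pow_succ_toEnd_f n
    rw [hn', lie_zero, eq_comm, smul_eq_zero, mul_eq_zero, sub_eq_zero] at this
    exact (this.resolve_right hn).resolve_left (Nat.cast_add_one_ne_zero n)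
  refine ⟨n, hμ, fun i hi => ?_⟩
  have h1 := pow_toEnd_mem_weightSpace hf hv i
  rw [smul_neg, ← sub_eq_add_neg] at h1
  exact mem_weights (hp.pow_toEnd_f_ne_zero_of_eq_nat hμ hi) h1

/-- Raise a weight vector as far as possible by e, say r times. The result is primitive of weight n
= μ(c) + 2r on the coroot, and the string below it contains the reflection of μ. -/
theorem IsCoroot.exists_int (hγ : IsCoroot H γ c) (hV : (weights F H V).Finite)
    (hμ : μ ∈ weights F H V) :
    ∃ m : ℤ, μ c = m ∧ (0 ≤ m → μ - m • γ ∈ weights F H V) := by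
  obtain ⟨e, hee, f, hf, t⟩ := hγ.exists_sl2
  obtain ⟨v, hv, hv0⟩ := exists_of_mem_weights hμ
  obtain ⟨r, hr, hr'⟩ : ∃ n : ℕ, (toEnd F L V e ^ n) v ≠ 0 ∧ (toEnd F L V e ^ (n + 1)) v = 0 :=
    Nat.exists_not_and_succ_of_not_zero_of_exists (p := fun n => (toEnd F L V e ^ n) v = 0) hv0
      (exists_pow_toEnd_eq_zero hV hγ.ne_zero hee hv)
  obtain ⟨n, hn, h⟩ := hγ.exists_nat hV (pow_toEnd_mem_weightSpace hee hv r) hr (by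
    intro x hx
    obtain ⟨a, rfl⟩ := (finrank_eq_one_iff_of_nonzero' (⟨e, hee⟩ : weightSpace H L γ)
      (by simpa using t.e_ne_zero)).1 hγ.finrank_eq_one ⟨x, hx⟩ |>.imp fun a ha =>
        (congrArg Subtype.val ha : a • e = x)
    rw [smul_lie, ← toEnd_apply_apply F, ← Module.End.mul_apply, ← pow_succ', hr', smul_zero])
  refine ⟨n - 2 * r, ?_, fun h0 => ?_⟩
  · rw [LinearMap.add_apply, LinearMap.smul_apply, hγ.apply_self] at hn
    push_cast
    rw [← hn]
    simp only [nsmul_eq_mul]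
    ring
  -- The reflected weight lies n - r steps below μ + rγ; this is a natural number because μ(c) = n -
  -- 2r ≥ 0.
  · obtain ⟨j, hj⟩ : ∃ j : ℕ, (j : ℤ) = n - r := ⟨n - r, by omega⟩
    have := h j (by omega)
    rwa [show μ + r • γ - j • γ = μ - (n - 2 * r : ℤ) • γ by
      rw [← natCast_zsmul γ r, ← natCast_zsmul γ j, add_sub_assoc, ← sub_smul, sub_eq_add_neg μ,
        ← neg_smul]
      congr 2; omega] at this

end FiniteWeights

/-! ### Weyl invariance of the weights that are roots -/

section Splitting

open LieAlgebra

variable {F L ι N V : Type*} [Field F] [CharZero F] [LieRing L] [LieAlgebra F L]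
  [FiniteDimensional F L] [IsKilling F L] {H : LieSubalgebra F L}
  [Fintype ι] [AddCommGroup N] [Module F N]
  {P : RootPairing ι F (Dual F H) N} [P.IsRootSystem] [P.IsCrystallographic] {c : ι → H}
  [AddCommGroup V] [Module F V] [LieRingModule L V] [LieModule F L V]

theorem finite_weights (hV : weights F H V ⊆ insert 0 (Set.range P.root)) :
    (weights F H V).Finite :=
  (Set.Finite.insert _ (Set.finite_range _)).subset hV

variable (P) in
/-- The indices of the weights of a module that are roots. -/
def weightIndices (V : Type*) [AddCommGroup V] [Module F V] [LieRingModule L V] [LieModule F L V] :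
    Set ι := {i | P.root i ∈ weights F H V}

theorem neg_root (k : ι) : P.root (P.reflectionPerm k k) = -P.root k := by
  rw [P.root_reflectionPerm, P.reflection_apply_self]

theorem IsSplitting.refl_mem_of_mem_sdiv (hc : IsSplitting H P c) (hV : (weights F H V).Finite)
    {k : ι} (hk : k ∈ sdiv P Set.univ) {i : ι} (hi : i ∈ weightIndices P V) :
    P.reflectionPerm k i ∈ weightIndices P V := by
  have key : ∀ k ∈ sdiv P Set.univ, 0 ≤ P.pairingIn ℤ i k →
      P.reflectionPerm k i ∈ weightIndices P V := by
    intro k hk h0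
    obtain ⟨m, hm, h⟩ := (hc.isCoroot k hk).exists_int hV hi
    rw [hc.root_apply hk, Int.cast_inj] at hm
    subst hm
    rw [weightIndices, Set.mem_ofPred_eq, root_reflectionPerm_int]
    exact h h0
  rcases le_or_gt 0 (P.pairingIn ℤ i k) with h | h
  · exact key k hk h
  -- The reflections in k and -k agree, and one of the two pairings is nonnegative.
  · have h1 := key _ (refl_mem_sdiv P k hk) (by
      rw [P.pairingIn_reflectionPerm_self_right]
      omega)
    rw [weightIndices, Set.mem_ofPred_eq, root_reflectionPerm_int,
      P.pairingIn_reflectionPerm_self_right, neg_root, smul_neg, neg_smul, neg_neg] at h1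
    rwa [weightIndices, Set.mem_ofPred_eq, root_reflectionPerm_int]

/-- A root k with a double is not a root of `L`, but the reflections in k and 2k coincide. -/
theorem IsSplitting.refl_mem (hc : IsSplitting H P c) (hV : (weights F H V).Finite)
    (k : ι) {i : ι} (hi : i ∈ weightIndices P V) : P.reflectionPerm k i ∈ weightIndices P V := by
  obtain ⟨j, hj, rfl | h⟩ := exists_mem_sdiv (P := P) (Set.mem_univ k)
  · exact hc.refl_mem_of_mem_sdiv hV hj hi
  · have h1 := hc.refl_mem_of_mem_sdiv hV hj hi
    have h2 : P.reflectionPerm j i = P.reflectionPerm k i := by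
      have h2 : P.root j = P.root k + P.root k := by rw [h, two_smul]
      have h3 := inn_add P h2
      have h4 : P.pairingIn ℤ i k = 2 * P.pairingIn ℤ i j := by
        have h5 := two_mul_inn P i j
        have h6 := two_mul_inn P i k
        rw [inn_comm P i j, h3 i, h3 j, inn_comm P k j, h3 k, inn_comm P k i] at h5
        have h7 := inn_self_pos P k
        have : (P.pairingIn ℤ i k : ℚ) * inn P k k = (2 * P.pairingIn ℤ i j) * inn P k k := by
          linarith
        exact_mod_cast mul_right_cancel₀ h7.ne' this
      apply P.root.injective
      rw [root_reflectionPerm_int, root_reflectionPerm_int, h4, h2]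
      module
    rwa [← h2]

/-- Weights that pair negatively with a root are not extremal. -/
theorem IsSplitting.add_mem_weights (hc : IsSplitting H P c) (hV : (weights F H V).Finite)
    {i j k : ι} (hi : i ∈ weightIndices P V) (hj : j ∈ sdiv P Set.univ)
    (h : P.pairingIn ℤ i j < 0) (hk : P.root k = P.root i + P.root j) : k ∈ weightIndices P V := by
  obtain ⟨v, hv, hv0⟩ := exists_of_mem_weights hi
  by_contra hne
  obtain ⟨n, hn, -⟩ := (hc.isCoroot j hj).exists_nat hV hv hv0 (by
    intro e he
    by_contra hne'
    have h1 := mem_weights hne' (lie_mem_weightSpace he hv)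
    rw [add_comm, ← hk] at h1
    exact hne h1)
  rw [hc.root_apply hj] at hn
  have : P.pairingIn ℤ i j = n := by exact_mod_cast hn
  omega

end Splitting

/-! ### Extremal vectors of the subalgebra are extremal -/

section Combinatorics

variable {ι F M N : Type*} [Fintype ι] [Field F] [CharZero F] [AddCommGroup M] [Module F M]
  [AddCommGroup N] [Module F N] {P : RootPairing ι F M N} [P.IsCrystallographic]

/-- A sum of roots `α + β` with `⟨α, β⟩ ≥ 0` is only a root if `α` and `β` are orthogonal of the
same length. -/
theorem orthogonal_of_add (h3 : ∀ i j, P.pairingIn ℤ i j ≠ 3) {α β k : ι}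
    (hβ : β ∈ sdiv P Set.univ) (hk : P.root k = P.root α + P.root β)
    (h0 : 0 ≤ P.pairingIn ℤ α β) :
    inn P α β = 0 ∧ inn P α α = inn P β β ∧ inn P k k = 2 * inn P β β := by
  have h1 := two_mul_inn P α β
  have h2 := two_mul_inn P k β
  have h4 := inn_add P hk β
  have h5 := inn_add_self P hk
  have hb := inn_self_pos P β
  have ha := inn_self_pos P α
  have hkβ : P.pairingIn ℤ k β = P.pairingIn ℤ α β + 2 := by
    rw [h4, mul_add, h1] at h2
    have : (P.pairingIn ℤ k β : ℚ) * inn P β β = (P.pairingIn ℤ α β + 2) * inn P β β := by linarith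
    exact_mod_cast mul_right_cancel₀ hb.ne' this
  have hne : ¬ P.root k = (2 : F) • P.root β := hβ.2 k (Set.mem_univ k)
  rcases pairing_cases P h3 (i := k) (j := β) (by omega) with
    rfl | ⟨h, -⟩ | ⟨h, -, hl⟩ | ⟨h, -⟩ | ⟨h, -⟩ | ⟨h, h', hl⟩
  · rw [right_eq_add] at hk
    exact absurd hk (P.ne_zero α)
  · omega
  · have : P.pairingIn ℤ α β = 0 := by omega
    rw [this, Int.cast_zero, zero_mul] at h1
    refine ⟨by linarith, by linarith, hl⟩
  · omega
  · exact absurd h hne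
  · have : (0 : ℚ) ≤ P.pairingIn ℤ α β := by exact_mod_cast h0
    nlinarith

/-- The model is type B with α = ε₁, β = ε₂, k = ε₁ + ε₂. Equality of lengths gives a root j = ε₁ -
ε₃ of `S` that is as long as k; then γ = α - j = ε₃ and δ is the reflection of k in j, that is ε₂ +
ε₃. The output is what is needed to write L_β as [L_{-γ}, L_δ] with both factors killing a vector of
weight α. -/
theorem exists_orthogonal (hP : IsConnected P Set.univ) (h3 : ∀ i j, P.pairingIn ℤ i j ≠ 3)
    {S : Set ι} (hS : IsSubsystem P S) (hconn : IsConnected P S)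
    (hlen : ∀ i, ∃ j ∈ S, inn P j j = inn P i i) {α β k : ι} (hα : α ∈ S)
    (hβ : β ∈ sdiv P Set.univ) (hβS : β ∉ S) (hk : P.root k = P.root α + P.root β)
    (h0 : 0 ≤ P.pairingIn ℤ α β) :
    ∃ γ ∈ S, ∃ δ ∈ sdiv P Set.univ, γ ∈ sdiv P Set.univ ∧ P.root δ = P.root β + P.root γ ∧
      P.pairingIn ℤ α γ = 0 ∧ P.pairingIn ℤ δ γ = 2 ∧
      P.root α + P.root δ ∉ insert 0 (Set.range P.root) ∧
      P.root γ + P.root δ ∉ insert 0 (Set.range P.root) := by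
  obtain ⟨hαβ, hll, hkk⟩ := orthogonal_of_add h3 hβ hk h0
  have hℓ := inn_self_pos P β
  obtain ⟨j₀, hj₀, hjk⟩ := hlen k
  obtain ⟨j, hj, -, hjj, hpos⟩ := exists_conj_pairing_pos (Q := fun _ => True) hS hconn
    (fun _ _ _ _ _ => trivial) hj₀ hα trivial
  have hjj' : inn P j j = 2 * inn P β β := by rw [hjj, hjk, hkk]
  have hp : P.pairingIn ℤ α j = 1 ∧ P.pairingIn ℤ j α = 2 := by
    rcases pairing_cases P h3 hpos with rfl | ⟨-, -, h⟩ | ⟨-, -, h⟩ | h | ⟨-, -, h⟩ | ⟨-, -, h⟩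
    · linarith
    · linarith
    · linarith
    · exact ⟨h.1, h.2.1⟩
    · linarith
    · linarith
  have hγroot : P.root (P.reflectionPerm j α) = P.root α - P.root j := by
    rw [root_reflectionPerm_int, hp.1, one_smul]
  have hγS := hS j hj α hα
  have hγγ : inn P (P.reflectionPerm j α) (P.reflectionPerm j α) = inn P β β := by
    rw [inn_refl, hll]
  have hγ := mem_sdiv_of_length_eq hP hγγ.symm hβ
  generalize P.reflectionPerm j α = γ at hγroot hγS hγγ hγ
  have hαγ : inn P α γ = 0 := by
    have h1 := two_mul_inn P α j
    rw [hp.1, hjj', Int.cast_one] at h1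
    rw [inn_comm, inn_sub P hγroot, inn_comm P j]
    linarith
  -- `β` and `γ` are orthogonal
  have hkj := two_mul_inn P k j
  rw [inn_add P hk] at hkj
  have hβγ' := two_mul_inn P β γ
  have hβj : inn P β j = - inn P β γ := by
    have := inn_sub P hγroot β
    rw [inn_comm P γ, inn_comm P j] at this
    linarith
  have hαj : inn P α j = inn P β β := by
    have h1 := two_mul_inn P α j
    rw [hp.1, hjj', Int.cast_one] at h1
    linarith
  -- This parity forces orthogonality: β has the same length as γ and -γ but differs from both,
  -- being outside `S`, so |⟨β, γ⟩| ≤ 1.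
  have hpar : P.pairingIn ℤ β γ = 2 - 2 * P.pairingIn ℤ k j := by
    rw [hαj, hβj, hjj'] at hkj
    rw [hγγ] at hβγ'
    have : (P.pairingIn ℤ β γ : ℚ) * inn P β β = (2 - 2 * P.pairingIn ℤ k j) * inn P β β := by
      linarith
    exact_mod_cast mul_right_cancel₀ hℓ.ne' this
  have hsmall : ∀ γ' ∈ S, inn P γ' γ' = inn P β β → P.pairingIn ℤ β γ' ≤ 1 := by
    intro γ' hγ' hl
    by_contra! h
    rcases pairing_cases P h3 (i := β) (j := γ') (by omega) with
      rfl | h | ⟨-, -, h⟩ | h | ⟨-, -, h⟩ | ⟨-, -, h⟩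
    · exact hβS hγ'
    · omega
    · linarith
    · omega
    · linarith
    · linarith
  have hle := hsmall γ hγS hγγ
  have hle' := hsmall _ (hS γ hγS γ hγS) (by rw [inn_refl, hγγ])
  rw [P.pairingIn_reflectionPerm_self_right] at hle'
  have hpk : P.pairingIn ℤ k j = 1 := by omega
  have hβγ : inn P β γ = 0 := by
    rw [hpar, hpk] at hβγ'
    norm_num at hβγ'
    exact hβγ'
  have hδroot : P.root (P.reflectionPerm j k) = P.root β + P.root γ := by
    rw [root_reflectionPerm_int, hpk, one_smul, hk, hγroot]
    abel
  generalize P.reflectionPerm j k = δ at hδroot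
  have hδβ : inn P δ β = inn P β β := by
    rw [inn_add P hδroot, inn_comm P γ, hβγ, add_zero]
  have hδγ : inn P δ γ = inn P β β := by
    rw [inn_add P hδroot, hβγ, zero_add, hγγ]
  have hδα : inn P δ α = 0 := by
    rw [inn_add P hδroot, inn_comm P γ, hαγ, inn_comm P β, hαβ, add_zero]
  have hδδ : inn P δ δ = 2 * inn P β β := by
    rw [inn_add P hδroot, inn_comm P β, inn_comm P γ, hδβ, hδγ]; ring
  refine ⟨γ, hγS, δ, ?_, hγ, hδroot, ?_, ?_, ?_, ?_⟩
  · rw [mem_sdiv_univ]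
    rintro ⟨m, hm⟩
    rw [two_smul] at hm
    have h1 := two_mul_inn P β m
    rw [inn_comm, inn_add P hm, inn_add_self P hm, hδβ, hδδ] at h1
    have h2 : (1 : ℚ) = 2 * P.pairingIn ℤ β m :=
      mul_right_cancel₀ hℓ.ne' (by linarith)
    have h4 : (1 : ℤ) = 2 * P.pairingIn ℤ β m := by exact_mod_cast h2
    omega
  · have h1 := two_mul_inn P α γ
    rw [hαγ, mul_zero, eq_comm, mul_eq_zero, hγγ] at h1
    exact_mod_cast h1.resolve_right hℓ.ne'
  · have h1 := two_mul_inn P δ γ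
    rw [hδγ, hγγ] at h1
    exact_mod_cast (mul_right_cancel₀ hℓ.ne' h1).symm
  -- A root m = α + δ would have squared length 3 in units of |β|², and ⟨α, m⟩ = 2/3.
  · rintro (h | ⟨m, hm⟩)
    · have h1 : P.root α = P.root (P.reflectionPerm δ δ) := by
        rw [P.root_reflectionPerm, P.reflection_apply_self]
        exact eq_neg_of_add_eq_zero_left h
      have h2 := inn_refl P δ δ δ
      rw [← P.root.injective h1, hδδ, hll] at h2
      linarith
    · have h1 := two_mul_inn P α m
      rw [inn_comm, inn_add P hm, inn_add_self P hm, inn_comm P α δ, hδα, hll, hδδ] at h1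
      have h2 : (2 : ℚ) = 3 * P.pairingIn ℤ α m :=
        mul_right_cancel₀ hℓ.ne' (by linarith)
      have h4 : (2 : ℤ) = 3 * P.pairingIn ℤ α m := by exact_mod_cast h2
      omega
  -- A root m = β + 2γ would have squared length 5 in the same units, and ⟨β, m⟩ = 2/5.
  · rintro (h | ⟨m, hm⟩)
    · have h1 : P.root γ = P.root (P.reflectionPerm δ δ) := by
        rw [P.root_reflectionPerm, P.reflection_apply_self]
        exact eq_neg_of_add_eq_zero_left h
      have h2 := inn_refl P δ δ δ
      rw [← P.root.injective h1, hδδ, hγγ] at h2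
      linarith
    · have h1 := two_mul_inn P β m
      rw [inn_comm, inn_add P hm, inn_add_self P hm, inn_comm P γ β, inn_comm P γ δ, hβγ, hδβ, hδγ,
        hγγ, hδδ] at h1
      have h2 : (2 : ℚ) = 5 * P.pairingIn ℤ β m :=
        mul_right_cancel₀ hℓ.ne' (by linarith)
      have h4 : (2 : ℤ) = 5 * P.pairingIn ℤ β m := by exact_mod_cast h2
      omega

end Combinatorics

/-! ### Passing extremality from the subsystem to the whole system -/

section Extremal

open LieAlgebra

variable {F L ι N V : Type*} [Field F] [CharZero F] [LieRing L] [LieAlgebra F L]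
  [FiniteDimensional F L] [IsKilling F L] {H : LieSubalgebra F L}
  [Fintype ι] [AddCommGroup N] [Module F N]
  {P : RootPairing ι F (Dual F H) N} [P.IsRootSystem] [P.IsCrystallographic] {c : ι → H}
  [AddCommGroup V] [Module F V] [LieRingModule L V] [LieModule F L V]

/-- A weight vector of weight `α` is extremal with respect to the roots in `T`: it is killed by all
root spaces of roots of `T` that pair nonnegatively with `α`. -/
def IsExtremal (P : RootPairing ι F (Dual F H) N) [P.IsCrystallographic] (T : Set ι) (α : ι)
    (w : V) : Prop :=
  w ∈ weightSpace H V (P.root α) ∧ ∀ γ ∈ T, 0 ≤ P.pairingIn ℤ α γ →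
    ∀ e ∈ weightSpace H L (P.root γ), ⁅e, w⁆ = 0

theorem lie_eq_zero_of_add_notMem (hV : weights F H V ⊆ insert 0 (Set.range P.root))
    {γ μ : Dual F H} (h : γ + μ ∉ insert 0 (Set.range P.root)) {e : L} {v : V}
    (he : e ∈ weightSpace H L γ) (hv : v ∈ weightSpace H V μ) : ⁅e, v⁆ = 0 := by
  by_contra hne
  exact h (hV (mem_weights hne (lie_mem_weightSpace he hv)))

/-- Only a root β outside `S` with α + β a root could fail to kill w. For it, `exists_orthogonal`
gives L_β = [L_{-γ}, L_δ]: here L_{-γ} kills w by extremality within `S`, since γ is orthogonal to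
α, and L_δ kills w because α + δ is not a weight. -/
theorem IsExtremal.univ (hc : IsSplitting H P c)
    (hV : weights F H V ⊆ insert 0 (Set.range P.root))
    (hP : IsConnected P Set.univ) (h3 : ∀ i j, P.pairingIn ℤ i j ≠ 3)
    {S : Set ι} (hS : IsSubsystem P S) (hconn : IsConnected P S) (hfull : IsFull P S)
    (hlen : ∀ i, ∃ j ∈ S, inn P j j = inn P i i) {α : ι} (hα : α ∈ S) {w : V}
    (hw : IsExtremal P (sdiv P S) α w) : IsExtremal P (sdiv P Set.univ) α w := by
  refine ⟨hw.1, fun β hβ h0 x hx => ?_⟩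
  by_cases hβS : β ∈ S
  · exact hw.2 β ((mem_sdiv_iff_of_isFull hfull hβS).2 hβ) h0 x hx
  by_contra hne
  have hmem := hV (mem_weights hne (lie_mem_weightSpace hx hw.1))
  rw [add_comm] at hmem
  obtain hz | ⟨k, hk⟩ := hmem
  · have h1 : P.root α = P.root (P.reflectionPerm β β) := by
      rw [neg_root]; exact eq_neg_of_add_eq_zero_left hz
    rw [P.root.injective h1, P.pairingIn_reflectionPerm_self_left] at h0
    simp at h0
  obtain ⟨γ, hγS, δ, hδ, hγ, hδroot, hαγ, hδγ, hαδ, hγδ⟩ :=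
    exists_orthogonal hP h3 hS hconn hlen hα hβ hβS hk h0
  have hγ' := (mem_sdiv_iff_of_isFull hfull hγS).2 hγ
  have hL : weights F H L ⊆ insert 0 (Set.range P.root) := by
    rw [hc.weights_eq]
    exact Set.insert_subset_insert (Set.image_subset_range _ _)
  obtain ⟨e, he, f, hf, t⟩ := (hc.isCoroot γ hγ).exists_sl2
  obtain ⟨d, hd, hd0⟩ := exists_of_mem_weights (root_mem_weights hc.weights_eq hδ)
  have hfw : ⁅f, w⁆ = 0 := by
    refine hw.2 (P.reflectionPerm γ γ) (hS.sdiv γ hγ' γ hγ') ?_ f (by rwa [neg_root])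
    rw [P.pairingIn_reflectionPerm_self_right, hαγ, neg_zero]
  have hdw : ⁅d, w⁆ = 0 := lie_eq_zero_of_add_notMem hV (by rwa [add_comm]) hd hw.1
  have hed : ⁅e, d⁆ = 0 := lie_eq_zero_of_add_notMem hL hγδ he hd
  have hcd : ⁅(c γ : L), d⁆ = (2 : F) • d := by
    have : ⁅(c γ : L), d⁆ = P.root δ (c γ) • d := hd (c γ)
    rw [this, hc.root_apply hγ, hδγ]
    norm_num
  -- Since γ + δ is not a root, e kills d, so [e, [f, d]] = [c_γ, d] = 2d. Hence [f, d] spans the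
  -- line L_β.
  have hfd : ⁅f, d⁆ ≠ 0 := by
    intro h
    have h1 := leibniz_lie e f d
    rw [h, hed, lie_zero, lie_zero, add_zero, t.lie_e_f, hcd] at h1
    exact hd0 ((smul_eq_zero.1 h1.symm).resolve_left two_ne_zero)
  have hmem : ⁅f, d⁆ ∈ weightSpace H L (P.root β) := by
    have := lie_mem_weightSpace_add hf hd
    rwa [hδroot, neg_add_eq_sub, add_sub_cancel_right] at this
  obtain ⟨a, ha⟩ := (finrank_eq_one_iff_of_nonzero' (⟨_, hmem⟩ : weightSpace H L (P.root β))
    (by simpa using hfd)).1 (hc.isCoroot β hβ).finrank_eq_one ⟨x, hx⟩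
  have hxa : a • ⁅f, d⁆ = x := congrArg Subtype.val ha
  apply hne
  rw [← hxa, smul_lie, lie_lie, hfw, hdw, lie_zero, lie_zero, sub_zero, smul_zero]

end Extremal

/-! ### The module generated by an extremal vector -/

section Independence

variable {F K M : Type*} [Field F] [LieRing K] [LieAlgebra F K]
  [AddCommGroup M] [Module F M] [LieRingModule K M] [LieModule F K M]

theorem mem_of_le_iSup {Q : Dual F K → Prop} {μ : Dual F K} {u : M}
    (hu : u ∈ ⨆ (ν) (_ : Q ν), weightSpace K M ν) (hμ : u ∈ weightSpace K M μ) (h0 : u ≠ 0) :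
    Q μ := by
  by_contra hQ
  have h1 : u ∈ ⨆ (ν) (_ : ν ≠ μ), weightSpace K M ν := by
    refine (iSup₂_le fun ν hν => ?_ : (⨆ (ν) (_ : Q ν), weightSpace K M ν) ≤ _) hu
    exact le_iSup₂_of_le ν (by rintro rfl; exact hQ hν) le_rfl
  exact h0 (Submodule.disjoint_def.1 (iSupIndep_weightSpace μ) u hμ h1)

end Independence

section Generated

open LieAlgebra

variable {F L ι N V : Type*} [Field F] [CharZero F] [LieRing L] [LieAlgebra F L]
  [FiniteDimensional F L] [IsKilling F L] {H : LieSubalgebra F L}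
  [Fintype ι] [AddCommGroup N] [Module F N]
  {P : RootPairing ι F (Dual F H) N} [P.IsRootSystem] [P.IsCrystallographic] {c : ι → H}
  [AddCommGroup V] [Module F V] [LieRingModule L V] [LieModule F L V]

/-- The iterated images of `w` under root vectors that lower the pairing with `α`, together with
their number and weight. -/
inductive Lowered (P : RootPairing ι F (Dual F H) N) [P.IsCrystallographic] (α : ι) (w : V) :
    ℕ → Dual F H → V → Prop
  | base : Lowered P α w 0 (P.root α) w
  | step {n : ℕ} {μ : Dual F H} {v : V} {γ : ι} {e : L} (hv : Lowered P α w n μ v)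
      (hγ : γ ∈ sdiv P Set.univ) (h : P.pairingIn ℤ γ α < 0) (he : e ∈ weightSpace H L (P.root γ)) :
      Lowered P α w (n + 1) (P.root γ + μ) ⁅e, v⁆

variable {α : ι} {w : V}

theorem Lowered.mem_weightSpace (hw : w ∈ weightSpace H V (P.root α)) {n : ℕ} {μ : Dual F H} {v : V}
    (h : Lowered P α w n μ v) : v ∈ weightSpace H V μ := by
  induction h with
  | base => exact hw
  | step _ _ _ he ih => exact lie_mem_weightSpace he ih

theorem Lowered.mem_lieSpan {n : ℕ} {μ : Dual F H} {v : V} (h : Lowered P α w n μ v) :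
    v ∈ LieSubmodule.lieSpan F L {w} := by
  induction h with
  | base => exact LieSubmodule.subset_lieSpan rfl
  | step _ _ _ _ ih => exact LieSubmodule.lie_mem _ ih

theorem Lowered.sub_mem {n : ℕ} {μ : Dual F H} {v : V} (h : Lowered P α w n μ v) :
    P.root α - μ ∈
      AddSubmonoid.closure (P.root '' {γ ∈ sdiv P Set.univ | 0 < P.pairingIn ℤ γ α}) := by
  induction h with
  | base => rw [sub_self]; exact zero_mem _
  | @step n μ v γ e _ hγ hlt _ ih =>
    rw [show P.root α - (P.root γ + μ) = P.root α - μ + P.root (P.reflectionPerm γ γ) by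
      rw [neg_root]; abel]
    refine add_mem ih (AddSubmonoid.subset_closure ⟨_, ⟨refl_mem_sdiv P γ hγ, ?_⟩, rfl⟩)
    rw [P.pairingIn_reflectionPerm_self_left]
    omega

/-- Each lowering decreases the value on the coroot of α by at least 1 from its initial value 2.
This bounds the number of lowerings and separates α from all other weights reached. -/
theorem Lowered.exists_level {n : ℕ} {μ : Dual F H} {v : V} (h : Lowered P α w n μ v) :
    ∃ m : ℤ, n ≤ m ∧ P.toLinearMap μ (P.coroot α) = ((2 - m : ℤ) : F) := by
  induction h with
  | base => exact ⟨0, le_rfl, by simp⟩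
  | @step n μ v γ e _ _ hlt _ ih =>
    obtain ⟨m, hm, h⟩ := ih
    refine ⟨m - P.pairingIn ℤ γ α, by push_cast; omega, ?_⟩
    rw [map_add, LinearMap.add_apply, h, RootPairing.root_coroot_eq_pairing,
      ← P.algebraMap_pairingIn ℤ]
    push_cast
    rw [eq_intCast]
    ring

variable (P) in
/-- The span of the vectors obtained by `n` lowerings. -/
def loweredSpan (α : ι) (w : V) (n : ℕ) : Submodule F V :=
  Submodule.span F {v | ∃ μ, Lowered P α w n μ v}

theorem finiteDimensional_loweredSpan (n : ℕ) : FiniteDimensional F (loweredSpan P α w n) := by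
  induction n with
  | zero =>
    refine Submodule.finiteDimensional_of_le (S₂ := Submodule.span F {w}) (Submodule.span_mono ?_)
    rintro v ⟨μ, h⟩
    cases h
    rfl
  | succ n ih =>
    have hfg : (Submodule.map₂ (LieModule.toEnd F L V : L →ₗ[F] End F V) ⊤
        (loweredSpan P α w n)).FG :=
      Submodule.FG.map₂ _ Module.Finite.fg_top ((Submodule.fg_iff_finiteDimensional _).2 ih)
    have := (Submodule.fg_iff_finiteDimensional _).1 hfg
    refine Submodule.finiteDimensional_of_le (Submodule.span_le.2 ?_) (S₂ := Submodule.map₂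
      (LieModule.toEnd F L V : L →ₗ[F] End F V) ⊤ (loweredSpan P α w n))
    rintro v ⟨μ, h⟩
    cases h with
    | step hv _ _ _ =>
      exact Submodule.apply_mem_map₂ _ Submodule.mem_top (Submodule.subset_span ⟨_, hv⟩)

theorem pairingIn_nonneg_comm (i j : ι) : 0 ≤ P.pairingIn ℤ i j ↔ 0 ≤ P.pairingIn ℤ j i := by
  rw [← not_lt, ← not_lt]
  exact not_congr ⟨pairingIn_neg_comm P, pairingIn_neg_comm P⟩

/-- The module generated by an extremal vector is spanned by lowered vectors. -/
theorem IsExtremal.lieSpan_eq (hc : IsSplitting H P c) (hw : IsExtremal P (sdiv P Set.univ) α w) :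
    (LieSubmodule.lieSpan F L {w}).toSubmodule =
      Submodule.span F {v | ∃ n μ, Lowered P α w n μ v} := by
  set T := Submodule.span F {v | ∃ n μ, Lowered P α w n μ v}
  have hgen : ∀ {n μ v}, Lowered P α w n μ v → v ∈ T :=
    fun h => Submodule.subset_span ⟨_, _, h⟩
  have hlow : ∀ γ ∈ sdiv P Set.univ, P.pairingIn ℤ γ α < 0 → ∀ e ∈ weightSpace H L (P.root γ),
      ∀ t ∈ T, ⁅e, t⁆ ∈ T := by
    intro γ hγ h e he t ht
    have : T ≤ T.comap (LieModule.toEnd F L V e : V →ₗ[F] V) :=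
      Submodule.span_le.2 fun v ⟨n, μ, hv⟩ => hgen (hv.step hγ h he)
    exact this ht
  have hbase : ∀ x : L, ⁅x, w⁆ ∈ T := by
    intro x
    obtain ⟨s, v, hv, rfl⟩ := hc.isSplittingCartan.decomposition.exists_sum x
    rw [sum_lie]
    refine sum_mem fun γ _ => ?_
    by_cases h0 : v γ = 0
    · rw [h0, zero_lie]; exact zero_mem _
    have hγ := mem_weights h0 (hv γ)
    rw [hc.weights_eq] at hγ
    obtain rfl | ⟨k, hk, rfl⟩ := hγ
    · have h1 := hv 0
      rw [hc.isSplittingCartan.zero_space] at h1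
      have h2 : ⁅v 0, w⁆ = P.root α ⟨v 0, h1⟩ • w := hw.1 ⟨v 0, h1⟩
      rw [h2]
      exact T.smul_mem _ (hgen .base)
    · by_cases hk0 : 0 ≤ P.pairingIn ℤ α k
      · rw [hw.2 k hk hk0 _ (hv _)]; exact zero_mem _
      · exact hlow k hk (by rwa [pairingIn_nonneg_comm, not_le] at hk0) _ (hv _) _ (hgen .base)
  have hstable : ∀ {n μ v}, Lowered P α w n μ v → ∀ x : L, ⁅x, v⁆ ∈ T := by
    intro n μ v h
    induction h with
    | base => exact hbase
    -- The induction hypothesis covers all x at once, so it also applies to [x, e] in [x, [e, v]] =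
    -- [[x, e], v] + [e, [x, v]].
    | step _ hγ hlt he ih =>
      intro x
      rw [leibniz_lie]
      exact add_mem (ih _) (hlow _ hγ hlt _ he _ (ih x))
  refine le_antisymm ?_ (Submodule.span_le.2 fun v ⟨n, μ, h⟩ => h.mem_lieSpan)
  have h1 : LieSubmodule.lieSpan F L {w} ≤
      ({ T with
        lie_mem := fun {x m} hm => by
          have : T ≤ T.comap (LieModule.toEnd F L V x : V →ₗ[F] V) :=
            Submodule.span_le.2 fun v ⟨n, μ, hv⟩ => hstable hv x
          exact this hm } : LieSubmodule F L V) := by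
    rw [LieSubmodule.lieSpan_le]
    rintro _ rfl
    exact hgen .base
  exact h1

theorem pairingIn_neg_le (i j : ι) : -4 ≤ P.pairingIn ℤ i j := by
  have := P.pairingIn_pairingIn_mem_set_of_isCrystallographic i j
  simp only [Set.mem_insert_iff, Set.mem_singleton_iff, Prod.mk.injEq] at this
  omega

theorem IsExtremal.finiteDimensional (hc : IsSplitting H P c)
    (hV : weights F H V ⊆ insert 0 (Set.range P.root))
    (hw : IsExtremal P (sdiv P Set.univ) α w) :
    FiniteDimensional F (LieSubmodule.lieSpan F L {w}) := by
  have := finiteDimensional_loweredSpan (P := P) (α := α) (w := w)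
  have h1 : (LieSubmodule.lieSpan F L {w}).toSubmodule ≤
      ⨆ n : Fin 7, loweredSpan P α w n := by
    rw [hw.lieSpan_eq hc, Submodule.span_le]
    rintro v ⟨n, μ, h⟩
    by_cases h0 : v = 0
    · rw [h0]; exact zero_mem _
    obtain ⟨m, hm, hlevel⟩ := h.exists_level
    -- The level 2 - m of a nonzero vector is a Cartan integer, at least -4, or 0 for the zero
    -- weight. So n ≤ m ≤ 6.
    have hn : n < 7 := by
      obtain rfl | ⟨i, rfl⟩ := hV (mem_weights h0 (h.mem_weightSpace hw.1))
      · rw [map_zero, LinearMap.zero_apply, eq_comm, Int.cast_eq_zero] at hlevel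
        omega
      · rw [RootPairing.root_coroot_eq_pairing, ← P.algebraMap_pairingIn ℤ, eq_intCast,
          Int.cast_inj] at hlevel
        have := pairingIn_neg_le (P := P) i α
        omega
    exact Submodule.mem_iSup_of_mem (⟨n, hn⟩ : Fin 7) (Submodule.subset_span ⟨μ, h⟩)
  exact Submodule.finiteDimensional_of_le h1

theorem IsExtremal.sub_mem (hc : IsSplitting H P c) (hw : IsExtremal P (sdiv P Set.univ) α w)
    {μ : Dual F H} {u : V} (hu : u ∈ LieSubmodule.lieSpan F L {w}) (hμ : u ∈ weightSpace H V μ)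
    (h0 : u ≠ 0) : P.root α - μ ∈
      AddSubmonoid.closure (P.root '' {γ ∈ sdiv P Set.univ | 0 < P.pairingIn ℤ γ α}) := by
  refine mem_of_le_iSup (Q := fun μ => P.root α - μ ∈ AddSubmonoid.closure
    (P.root '' {γ ∈ sdiv P Set.univ | 0 < P.pairingIn ℤ γ α})) ?_ hμ h0
  have h1 : (LieSubmodule.lieSpan F L {w}).toSubmodule ≤ _ := (hw.lieSpan_eq hc).le
  refine (h1.trans (Submodule.span_le.2 ?_)) hu
  rintro v ⟨n, ν, h⟩
  exact (le_iSup₂_of_le ν h.sub_mem le_rfl :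
    weightSpace H V ν ≤ _) (h.mem_weightSpace hw.1)

/-- The weight space of the extremal weight is one-dimensional. -/
theorem IsExtremal.mem_span (hc : IsSplitting H P c) (hw : IsExtremal P (sdiv P Set.univ) α w)
    {u : V} (hu : u ∈ LieSubmodule.lieSpan F L {w}) (hμ : u ∈ weightSpace H V (P.root α)) :
    u ∈ Submodule.span F {w} := by
  have h1 : (LieSubmodule.lieSpan F L {w}).toSubmodule ≤
      Submodule.span F {w} ⊔ ⨆ (ν) (_ : ν ≠ P.root α), weightSpace H V ν := by
    rw [hw.lieSpan_eq hc, Submodule.span_le]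
    rintro v ⟨n, ν, h⟩
    have hv := h.mem_weightSpace hw.1
    obtain ⟨m, hm, hlevel⟩ := h.exists_level
    cases h with
    | base => exact Submodule.mem_sup_left (Submodule.mem_span_singleton_self w)
    | step h' hγ hlt he =>
      refine Submodule.mem_sup_right ((le_iSup₂_of_le _ ?_ le_rfl : weightSpace H V _ ≤ _) hv)
      intro h
      rw [h, RootPairing.root_coroot_eq_pairing, P.pairing_same] at hlevel
      have : (2 : ℤ) = 2 - m := by exact_mod_cast hlevel
      push_cast at hm
      omega
  obtain ⟨y, hy, z, hz, rfl⟩ := Submodule.mem_sup.1 (h1 hu)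
  have hyα : y ∈ weightSpace H V (P.root α) := by
    obtain ⟨a, rfl⟩ := Submodule.mem_span_singleton.1 hy
    exact Submodule.smul_mem _ a hw.1
  have hzα : z ∈ weightSpace H V (P.root α) := (Submodule.add_mem_iff_right _ hyα).1 hμ
  have : z = 0 := Submodule.disjoint_def.1 (iSupIndep_weightSpace (P.root α)) z hzα hz
  rwa [this, add_zero]

end Generated

/-! ### Comparison of weights -/

section Compare

variable {ι F M N : Type*} [Fintype ι] [Field F] [CharZero F] [AddCommGroup M] [Module F M]
  [AddCommGroup N] [Module F N] {P : RootPairing ι F M N} [P.IsCrystallographic]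

/-- The field carries no order, so positivity is recorded by a rational number mapping to the value
of the form. -/
theorem exists_rootForm_of_mem_closure {T : Set ι} {j : ι}
    (hT : ∀ γ ∈ T, 0 < inn P γ j) {x : M} (hx : x ∈ AddSubmonoid.closure (P.root '' T)) :
    ∃ q : ℚ, 0 ≤ q ∧ P.RootForm x (P.root j) = (q : F) ∧ (x ≠ 0 → 0 < q) := by
  induction hx using AddSubmonoid.closure_induction with
  | mem x hx =>
    obtain ⟨γ, hγ, rfl⟩ := hx
    exact ⟨_, (hT γ hγ).le, rootForm_root_root γ j, fun _ => hT γ hγ⟩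
  | zero => exact ⟨0, le_rfl, by simp, fun h => absurd rfl h⟩
  | add x y _ _ hx hy =>
    obtain ⟨p, hp, hp', hp0⟩ := hx
    obtain ⟨q, hq, hq', hq0⟩ := hy
    refine ⟨p + q, add_nonneg hp hq, by simp [hp', hq'], fun h => ?_⟩
    by_cases hx0 : x = 0
    · have := hq0 (by rintro rfl; exact h (by simp [hx0]))
      linarith
    · have := hp0 hx0
      linarith

theorem exists_rootForm_nonneg_of_mem_closure {T : Set ι} {j : ι}
    (hT : ∀ γ ∈ T, 0 ≤ inn P γ j) {x : M} (hx : x ∈ AddSubmonoid.closure (P.root '' T)) :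
    ∃ q : ℚ, 0 ≤ q ∧ P.RootForm x (P.root j) = (q : F) := by
  induction hx using AddSubmonoid.closure_induction with
  | mem x hx =>
    obtain ⟨γ, hγ, rfl⟩ := hx
    exact ⟨_, hT γ hγ, rootForm_root_root γ j⟩
  | zero => exact ⟨0, le_rfl, by simp⟩
  | add x y _ _ hx hy =>
    obtain ⟨p, hp, hp'⟩ := hx
    obtain ⟨q, hq, hq'⟩ := hy
    exact ⟨p + q, add_nonneg hp hq, by simp [hp', hq']⟩

theorem inn_pos_iff (i j : ι) : 0 < inn P i j ↔ 0 < P.pairingIn ℤ i j := by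
  have h1 := two_mul_inn P i j
  have h2 := inn_self_pos P j
  rw [← Int.cast_pos (R := ℚ)]
  constructor
  · intro h
    exact pos_of_mul_pos_left (by linarith) h2.le
  · intro h
    have := mul_pos h h2
    linarith

theorem inn_nonneg_iff (i j : ι) : 0 ≤ inn P i j ↔ 0 ≤ P.pairingIn ℤ i j := by
  have h1 := two_mul_inn P i j
  have h2 := inn_self_pos P j
  rw [← Int.cast_nonneg_iff (R := ℚ)]
  constructor
  · intro h
    exact nonneg_of_mul_nonneg_left (by linarith) h2
  · intro h
    have := mul_nonneg h h2.le
    linarith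

/-- If `α - i` is a sum of roots that have positive pairings with `α` and nonnegative pairings with
`i`, then the length of `i` is at most that of `α`. -/
theorem inn_le_of_sub_mem_closure {T : Set ι} {α i : ι} (hT : ∀ γ ∈ T, 0 < P.pairingIn ℤ γ α)
    (hT' : ∀ γ ∈ T, 0 ≤ P.pairingIn ℤ i γ)
    (h : P.root α - P.root i ∈ AddSubmonoid.closure (P.root '' T)) :
    inn P i i ≤ inn P α i ∧ inn P α i ≤ inn P α α ∧ (i ≠ α → inn P α i < inn P α α) := by
  obtain ⟨p, hp, hp', hp0⟩ := exists_rootForm_of_mem_closure (j := α)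
    (fun γ hγ => (inn_pos_iff γ α).2 (hT γ hγ)) h
  obtain ⟨q, hq, hq'⟩ := exists_rootForm_nonneg_of_mem_closure (j := i)
    (fun γ hγ => by rw [inn_comm]; exact (inn_nonneg_iff i γ).2 (hT' γ hγ)) h
  rw [map_sub, LinearMap.sub_apply, rootForm_root_root, rootForm_root_root] at hp' hq'
  have h1 : inn P α α - inn P i α = p := by exact_mod_cast hp'
  have h2 : inn P α i - inn P i i = q := by exact_mod_cast hq'
  rw [inn_comm P i α] at h1
  refine ⟨by linarith, by linarith, fun hne => ?_⟩
  have := hp0 (sub_ne_zero.2 fun h => hne (P.root.injective h).symm)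
  linarith

/-- Among the roots of a reflection-stable set that have the length of a given one, there is one
with the largest inner product with `α`. -/
theorem exists_max {A : Set ι} {i : ι} (hi : i ∈ A) {R : Set ι}
    (hA : ∀ k ∈ R, ∀ i ∈ A, P.reflectionPerm k i ∈ A) (α : ι) :
    ∃ i' ∈ A, inn P i' i' = inn P i i ∧
      ∀ γ ∈ R, 0 < P.pairingIn ℤ γ α → 0 ≤ P.pairingIn ℤ i' γ := by
  obtain ⟨i', ⟨h1, h2⟩, hmax⟩ := Set.exists_max_image {j ∈ A | inn P j j = inn P i i}
    (fun j => inn P j α) (Set.toFinite _) ⟨i, hi, rfl⟩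
  refine ⟨i', h1, h2, fun γ hγ hpos => ?_⟩
  by_contra! hneg
  -- If ⟨i', γ⟩ < 0 and γ has positive inner product with α, reflecting i' in γ increases its inner
  -- product with α.
  have h3 := hmax (P.reflectionPerm γ i') ⟨hA γ hγ i' h1, by rw [inn_refl, h2]⟩
  have h4 : inn P (P.reflectionPerm γ i') α =
      inn P i' α - P.pairingIn ℤ i' γ * inn P γ α := by
    rw [inn, pairVec_reflectionPerm, wform_sub_left, wform_zsmul_left]; rfl
  have h5 := (inn_pos_iff γ α).2 hpos
  have h6 : (P.pairingIn ℤ i' γ : ℚ) < 0 := by exact_mod_cast hneg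
  have := mul_pos_of_neg_of_neg h6 (neg_lt_zero.2 h5)
  linarith

end Compare

/-! ### Monotonicity of the Casimir eigenvalue -/

section CasimirValue

variable {ι F M N : Type*} [Fintype ι] [Field F] [CharZero F] [AddCommGroup M] [Module F M]
  [AddCommGroup N] [Module F N] {P : RootPairing ι F M N} [P.IsCrystallographic]

theorem exists_sdiv_pairing_ne_zero (i : ι) : ∃ k ∈ sdiv P Set.univ, P.pairingIn ℤ i k ≠ 0 := by
  obtain ⟨k, hk, rfl | h⟩ := exists_mem_sdiv (P := P) (Set.mem_univ i)
  · exact ⟨k, hk, by simp⟩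
  · refine ⟨k, hk, fun h0 => ?_⟩
    rw [two_smul] at h
    have h1 := two_mul_inn P i k
    rw [h0, inn_comm, inn_add P h] at h1
    have := inn_self_pos P i
    simp at h1
    linarith

variable (P) in
theorem casimirValue_eq (i : ι) : casimirValue P (pairVec P i) =
    wform (fun k => killingCoeff P k ^ 2) (pairVec P i) (pairVec P i) +
      ∑ k, killingCoeff P k * ((max (P.pairingIn ℤ i k) 0 : ℤ) : ℚ) := by
  rw [casimirValue, wform]
  congr 1
  exact Finset.sum_congr rfl fun k _ => by ring

theorem wform_killingCoeff_pos (i : ι) :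
    0 < wform (fun k => killingCoeff P k ^ 2) (pairVec P i) (pairVec P i) := by
  obtain ⟨k, hk, h⟩ := exists_sdiv_pairing_ne_zero (P := P) i
  exact wform_self_pos (fun k => sq_nonneg _) (pow_pos (killingCoeff_pos hk) 2) h

theorem casimirValue_pos (i : ι) : 0 < casimirValue P (pairVec P i) := by
  rw [casimirValue_eq]
  refine add_pos_of_pos_of_nonneg (wform_killingCoeff_pos i) (Finset.sum_nonneg fun k _ =>
    mul_nonneg (killingCoeff_nonneg k) (by exact_mod_cast le_max_right _ _))

theorem sum_max_refl (j i : ι) :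
    ∑ k, killingCoeff P k * ((max (P.pairingIn ℤ (P.reflectionPerm j i) k) 0 : ℤ) : ℚ) =
      ∑ k, killingCoeff P k * ((max (P.pairingIn ℤ i k) 0 : ℤ) : ℚ) :=
  Fintype.sum_equiv (P.reflectionPerm j) _ _ fun k => by
    rw [killingCoeff_refl, P.pairingIn_reflectionPerm]

/-- Put s = ⟨α, i⟩ ≥ 2. The quadratic parts satisfy Q(α) = s Q(i), since ⟨i, α⟩ = 1. For the linear
part X, write s i = α + (-s_i α): X is subadditive and Weyl invariant, so s X(i) ≤ 2 X(α). -/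
theorem casimirValue_lt {α i : ι} (h2 : 2 ≤ P.pairingIn ℤ α i) (h1 : P.pairingIn ℤ i α = 1) :
    casimirValue P (pairVec P i) < casimirValue P (pairVec P α) := by
  rw [casimirValue_eq, casimirValue_eq]
  have hs : (2 : ℚ) ≤ P.pairingIn ℤ α i := by exact_mod_cast h2
  refine add_lt_add_of_lt_of_le ?_ ?_
  · have e1 := two_mul_wform P (a := fun k => killingCoeff P k ^ 2) (j := i)
      (fun k => by rw [killingCoeff_refl]) α
    have e2 := two_mul_wform P (a := fun k => killingCoeff P k ^ 2) (j := α)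
      (fun k => by rw [killingCoeff_refl]) i
    rw [wform_comm, e1, h1] at e2
    have := wform_killingCoeff_pos (P := P) i
    push_cast at e2
    nlinarith
  · set X : ι → ℚ := fun i => ∑ k, killingCoeff P k * ((max (P.pairingIn ℤ i k) 0 : ℤ) : ℚ) with hX
    have hX0 : 0 ≤ X i := Finset.sum_nonneg fun k _ =>
      mul_nonneg (killingCoeff_nonneg k) (by exact_mod_cast le_max_right _ _)
    set β := P.reflectionPerm i α
    -- Termwise this is max(a + b, 0) ≤ max(a, 0) + max(b, 0); the root -β is the reflection of β in
    -- itself.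
    have hle : P.pairingIn ℤ α i * X i ≤ X α + X (P.reflectionPerm β β) := by
      simp only [hX]
      rw [Finset.mul_sum, ← Finset.sum_add_distrib]
      refine Finset.sum_le_sum fun k _ => ?_
      have hβ : P.pairingIn ℤ β k = P.pairingIn ℤ α k - P.pairingIn ℤ α i * P.pairingIn ℤ i k := by
        have := congrFun (pairVec_reflectionPerm P i α) k
        simpa [pairVec] using this
      rw [← mul_add, mul_left_comm]
      refine mul_le_mul_of_nonneg_left ?_ (killingCoeff_nonneg k)
      rw [P.pairingIn_reflectionPerm_self_left, hβ]
      norm_cast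
      rcases le_total (P.pairingIn ℤ i k) 0 with h | h
      · rw [max_eq_right h, mul_zero]
        exact add_nonneg (le_max_right _ _) (le_max_right _ _)
      · rw [max_eq_left h]
        have a1 := le_max_left (P.pairingIn ℤ α k) 0
        have a2 := le_max_left
          (-(P.pairingIn ℤ α k - P.pairingIn ℤ α i * P.pairingIn ℤ i k)) 0
        linarith
    have e1 : X (P.reflectionPerm β β) = X α := (sum_max_refl β β).trans (sum_max_refl i α)
    rw [e1] at hle
    change X i ≤ X α
    nlinarith

end CasimirValue

/-! ### Irreducibility of the module generated by an extremal vector -/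

section Irreducible

open LieAlgebra

variable {F L ι N V : Type*} [Field F] [CharZero F] [LieRing L] [LieAlgebra F L]
  [FiniteDimensional F L] [IsKilling F L] {H : LieSubalgebra F L}
  [Fintype ι] [AddCommGroup N] [Module F N]
  {P : RootPairing ι F (Dual F H) N} [P.IsRootSystem] [P.IsCrystallographic] {c : ι → H}
  [AddCommGroup V] [Module F V] [LieRingModule L V] [LieModule F L V] {α : ι} {w : V}

theorem weights_submodule_subset (U : LieSubmodule F L V) : weights F H U ⊆ weights F H V := by
  intro μ hμ
  obtain ⟨u, hu, h0⟩ := exists_of_mem_weights hμ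
  exact mem_weights (by simpa using h0) ((mem_weightSpace_submodule U).1 hu)

theorem HasWeightDecomposition.exists_mem_weights {K M : Type*} [LieRing K] [LieAlgebra F K]
    [AddCommGroup M] [Module F M] [LieRingModule K M] [LieModule F K M] [Nontrivial M]
    (h : HasWeightDecomposition F K M) : (weights F K M).Nonempty := by
  obtain ⟨m, hm⟩ := exists_ne (0 : M)
  obtain ⟨s, v, hv, rfl⟩ := h.exists_sum m
  obtain ⟨μ, -, hμ⟩ := Finset.exists_ne_zero_of_sum_ne_zero hm
  exact ⟨μ, mem_weights hμ (hv μ)⟩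

open Classical in
theorem IsExtremal.casimir_eq (hc : IsSplitting H P c) (hw : IsExtremal P (sdiv P Set.univ) α w)
    {u : V} (hu : u ∈ LieSubmodule.lieSpan F L {w}) :
    casimir hc.basis u = (casimirValue P (pairVec P α) : F) • u := by
  let E : LieSubmodule F L V :=
    { carrier := {u | casimir hc.basis u = (casimirValue P (pairVec P α) : F) • u}
      add_mem' := fun {x y} hx hy => by
        rw [Set.mem_ofPred_eq] at *
        rw [casimir_add, hx, hy, smul_add]
      zero_mem' := by simp [casimir]
      smul_mem' := fun r x hx => by
        rw [Set.mem_ofPred_eq] at *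
        rw [casimir_smul, hx, smul_comm]
      lie_mem := fun {x u} hu => by
        change casimir hc.basis ⁅x, u⁆ = _
        change casimir hc.basis u = _ at hu
        rw [← lie_casimir, hu, lie_smul] }
  have hE : LieSubmodule.lieSpan F L {w} ≤ E := by
    rw [LieSubmodule.lieSpan_le]
    rintro _ rfl
    exact hc.casimir_eq hw.1 (fun k hk => hc.root_apply hk α) hw.2
  exact hE hu

open Classical in
-- The Casimir operator is the scalar of α on the whole generated module. If w is not in `E`, then α
-- is not a weight of `E`, and a suitable weight vector of `E` has a smaller eigenvalue.
theorem IsExtremal.mem_of_ne_bot (hc : IsSplitting H P c) (hV : HasWeightDecomposition F H V)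
    (hΛ : weights F H V ⊆ insert 0 (Set.range P.root)) (h3 : ∀ i j, P.pairingIn ℤ i j ≠ 3)
    (hw : IsExtremal P (sdiv P Set.univ) α w) {E : LieSubmodule F L V}
    (hE : E ≤ LieSubmodule.lieSpan F L {w}) (hE0 : E ≠ ⊥) : w ∈ E := by
  by_contra hwE
  have hEΛ : weights F H E ⊆ insert 0 (Set.range P.root) := (weights_submodule_subset E).trans hΛ
  have hfin := finite_weights hEΛ
  -- an extremal vector in `E` has the same Casimir eigenvalue as `w`
  have hcas : ∀ {μ : Dual F H} {m : ι → ℤ} {u : E}, u ≠ 0 → u ∈ weightSpace H E μ →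
      (∀ k ∈ sdiv P Set.univ, μ (c k) = m k) →
      (∀ k ∈ sdiv P Set.univ, 0 ≤ m k → P.root k + μ ∉ weights F H E) →
      casimirValue P m = casimirValue P (pairVec P α) := by
    intro μ m u hu0 hu hm hext
    have h1 := hc.casimir_eq hu hm fun k hk h0 e he => by
      by_contra hne
      exact hext k hk h0 (mem_weights hne (lie_mem_weightSpace he hu))
    have h2 := hw.casimir_eq hc (hE u.2)
    rw [← casimir_coe, h1, LieSubmodule.coe_smul] at h2
    exact_mod_cast smul_left_injective F (by simpa using hu0 : (u : V) ≠ 0) h2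
  have hα : α ∉ weightIndices P E := by
    intro h
    obtain ⟨u, hu, hu0⟩ := exists_of_mem_weights h
    obtain ⟨a, ha⟩ := Submodule.mem_span_singleton.1
      (hw.mem_span hc (hE u.2) ((mem_weightSpace_submodule E).1 hu))
    have ha0 : a ≠ 0 := by
      rintro rfl
      rw [zero_smul] at ha
      exact hu0 (Subtype.ext ha.symm)
    refine hwE ((Submodule.smul_mem_iff E.toSubmodule ha0).1 ?_)
    rw [ha]; exact u.2
  -- If 0 is the only weight of `E`, root vectors annihilate `E` and the Casimir operator is zero,
  -- whereas its value for α is positive.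
  rcases (weightIndices P E).eq_empty_or_nonempty with hA | hA
  · have : Nontrivial E := (LieSubmodule.nontrivial_iff_ne_bot F L V).2 hE0
    obtain ⟨μ, hμ⟩ := (hV.submodule E).exists_mem_weights
    obtain rfl : μ = 0 := by
      obtain h | ⟨i, rfl⟩ := hEΛ hμ
      · exact h
      · exact absurd (show i ∈ weightIndices P E from hμ) (by rw [hA]; exact Set.notMem_empty i)
    obtain ⟨u, hu, hu0⟩ := exists_of_mem_weights hμ
    have h1 := hcas (m := 0) hu0 hu (by simp) (fun k _ _ h => by
      rw [add_zero] at h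
      exact absurd (show k ∈ weightIndices P E from h) (by rw [hA]; exact Set.notMem_empty k))
    have h2 : casimirValue P 0 = 0 := by simp [casimirValue]
    have := casimirValue_pos (P := P) α
    linarith
  · obtain ⟨i₀, hi₀, hmax⟩ := Set.exists_max_image (weightIndices P E) (fun i => inn P i i)
      (Set.toFinite _) hA
    -- Maximal length makes i extremal in `E`. Choosing among the weights of that length one closest
    -- to α allows a comparison of inner products with α.
    obtain ⟨i, hi, hlen, hpos⟩ := exists_max hi₀ (R := Set.univ)
      (fun k _ i hi => hc.refl_mem hfin k hi) α
    obtain ⟨u, hu, hu0⟩ := exists_of_mem_weights hi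
    have h1 := hcas (m := pairVec P i) hu0 hu (fun k hk => hc.root_apply hk i) (fun k hk h0 h => by
      have hpk : 0 ≤ P.pairingIn ℤ i k := h0
      obtain hz | ⟨j, hj⟩ := hEΛ h
      · have h1 : P.root i = P.root (P.reflectionPerm k k) := by
          rw [neg_root]; exact eq_neg_of_add_eq_zero_right hz
        rw [P.root.injective h1, P.pairingIn_reflectionPerm_self_left] at hpk
        simp at hpk
      · rw [← hj] at h
        have h2 := hmax j h
        have h4 := inn_add_self P hj
        have h5 := (inn_nonneg_iff i k).2 hpk
        have h6 := inn_self_pos P k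
        rw [inn_comm] at h5
        linarith)
    have hne : i ≠ α := by rintro rfl; exact hα hi
    obtain ⟨h4, -, h5⟩ := inn_le_of_sub_mem_closure (P := P)
      (T := {γ ∈ sdiv P Set.univ | 0 < P.pairingIn ℤ γ α}) (fun γ hγ => hγ.2)
      (fun γ hγ => hpos γ (Set.mem_univ γ) hγ.2)
      (hw.sub_mem hc (hE u.2) ((mem_weightSpace_submodule E).1 hu) (by simpa using hu0))
    have h6 := h5 hne
    have h7 := inn_self_pos P i
    have h8 := two_mul_inn' P α i
    -- From |i|² ≤ (α, i) < |α|² the angle is acute and i is strictly shorter, leaving ⟨α, i⟩ equal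
    -- to 2 or 4 with ⟨i, α⟩ = 1.
    have hlt : casimirValue P (pairVec P i) < casimirValue P (pairVec P α) := by
      rcases pairing_cases P h3 ((inn_pos_iff α i).1 (by linarith)) with
        h | ⟨-, -, h⟩ | ⟨h, h', -⟩ | ⟨-, -, h⟩ | ⟨-, h, h'⟩ | ⟨-, -, h⟩
      · exact absurd h.symm hne
      · linarith
      · exact casimirValue_lt h.ge h'
      · linarith
      · refine casimirValue_lt (by omega) ?_
        have h9 := two_mul_inn P α i
        rw [h8, h'] at h9
        have : (P.pairingIn ℤ i α : ℚ) = 1 := by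
          refine mul_right_cancel₀ (b := 4 * inn P i i) (by positivity) ?_
          rw [h9, h]; push_cast; ring
        exact_mod_cast this
      · linarith
    exact hlt.ne h1

theorem IsExtremal.isIrreducible (hc : IsSplitting H P c) (hV : HasWeightDecomposition F H V)
    (hΛ : weights F H V ⊆ insert 0 (Set.range P.root)) (h3 : ∀ i j, P.pairingIn ℤ i j ≠ 3)
    (hw : IsExtremal P (sdiv P Set.univ) α w) (hw0 : w ≠ 0) :
    LieModule.IsIrreducible F L (LieSubmodule.lieSpan F L {w}) := by
  have hwU : w ∈ LieSubmodule.lieSpan F L {w} := LieSubmodule.subset_lieSpan rfl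
  have : Nontrivial (LieSubmodule.lieSpan F L {w}) :=
    ⟨⟨w, hwU⟩, 0, fun h => hw0 (congrArg Subtype.val h)⟩
  refine LieModule.IsIrreducible.mk fun E hE => ?_
  have h1 : w ∈ E.map (LieSubmodule.lieSpan F L {w}).incl := by
    refine hw.mem_of_ne_bot hc hV hΛ h3 ?_ ?_
    · rintro _ ⟨x, -, rfl⟩
      exact x.2
    · intro h
      apply hE
      rw [LieSubmodule.eq_bot_iff] at h ⊢
      intro x hx
      exact Subtype.ext (h x ⟨x, hx, rfl⟩)
  obtain ⟨x, hx, hxw⟩ := h1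
  rw [eq_top_iff]
  have h2 : LieSubmodule.lieSpan F L {w} ≤ E.map (LieSubmodule.lieSpan F L {w}).incl := by
    rw [LieSubmodule.lieSpan_le]
    rintro _ rfl
    exact ⟨x, hx, hxw⟩
  rintro y -
  obtain ⟨z, hz, hzy⟩ := h2 y.2
  obtain rfl : z = y := Subtype.ext hzy
  exact hz

theorem IsExtremal.isWeightSet (hc : IsSplitting H P c)
    (hΛ : weights F H V ⊆ insert 0 (Set.range P.root))
    (hw : IsExtremal P (sdiv P Set.univ) α w) (hw0 : w ≠ 0) :
    IsWeightSet P (weightIndices P (LieSubmodule.lieSpan F L {w})) α := by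
  have hUΛ := (weights_submodule_subset (H := H) (LieSubmodule.lieSpan F L {w})).trans hΛ
  have hfin := finite_weights hUΛ
  have hsub : ∀ i ∈ weightIndices P (LieSubmodule.lieSpan F L {w}), P.root α - P.root i ∈
      AddSubmonoid.closure (P.root '' {γ ∈ sdiv P Set.univ | 0 < P.pairingIn ℤ γ α}) := by
    intro i hi
    obtain ⟨u, hu, hu0⟩ := exists_of_mem_weights hi
    exact hw.sub_mem hc u.2 ((mem_weightSpace_submodule _).1 hu) (by simpa using hu0)
  refine ⟨?_, fun k i hi => hc.refl_mem hfin k hi, fun i hi => ?_, fun i hi => ?_,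
    fun i hi j hj h k hk => hc.add_mem_weights hfin hi hj h hk⟩
  · refine mem_weights (m := ⟨w, LieSubmodule.subset_lieSpan rfl⟩)
      (fun h => hw0 (congrArg Subtype.val h)) ((mem_weightSpace_submodule _).2 hw.1)
  -- The length bound holds for a conjugate closest to α, which has the same length as i.
  · obtain ⟨i', hi', hlen, hpos⟩ := exists_max hi (R := Set.univ)
      (fun k _ i hi => hc.refl_mem hfin k hi) α
    obtain ⟨h1, h2, -⟩ := inn_le_of_sub_mem_closure (P := P)
      (T := {γ ∈ sdiv P Set.univ | 0 < P.pairingIn ℤ γ α}) (fun γ hγ => hγ.2)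
      (fun γ hγ => hpos γ (Set.mem_univ γ) hγ.2) (hsub i' hi')
    linarith
  · refine (AddSubmonoid.closure_le (S := (AddSubgroup.closure
      (P.root '' sdiv P Set.univ)).toAddSubmonoid)).2 ?_ (hsub i hi)
    rintro _ ⟨γ, hγ, rfl⟩
    exact AddSubgroup.subset_closure ⟨γ, hγ.1, rfl⟩

end Irreducible

/-! ### The subalgebra attached to a subsystem -/

section Subalgebra

open LieAlgebra

variable {F L ι N V : Type*} [Field F] [CharZero F] [LieRing L] [LieAlgebra F L]
  [FiniteDimensional F L] [IsKilling F L] {H : LieSubalgebra F L}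
  [Fintype ι] [AddCommGroup N] [Module F N]
  {P : RootPairing ι F (Dual F H) N} [P.IsRootSystem] [P.IsCrystallographic] {c : ι → H}
  [AddCommGroup V] [Module F V] [LieRingModule L V] [LieModule F L V] {S : Set ι}

theorem mem_rootSubalgebra {i : ι} (hi : i ∈ sdiv P S) {x : L}
    (hx : x ∈ weightSpace H L (P.root i)) : x ∈ rootSubalgebra H (P.root '' sdiv P S) :=
  LieSubalgebra.subset_lieSpan (weightSpace_le_rootSum (Set.mem_image_of_mem P.root hi) hx)

theorem IsSplitting.coroot_mem (hc : IsSplitting H P c) (hS : IsSubsystem P S)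
    (hfull : IsFull P S) {i : ι} (hi : i ∈ sdiv P S) :
    (c i : L) ∈ rootSubalgebra H (P.root '' sdiv P S) := by
  obtain ⟨e, he, f, hf, t⟩ :=
    (hc.isCoroot i ((mem_sdiv_iff_of_isFull hfull hi.1).1 hi)).exists_sl2
  rw [← t.lie_e_f]
  exact LieSubalgebra.lie_mem _ (mem_rootSubalgebra hi he)
    (mem_rootSubalgebra (hS.sdiv i hi i hi) (by rwa [neg_root]))

/-- The elements annihilating the subspace form a Lie subalgebra, so it suffices to test the
generating root spaces; the opposite roots are needed for the spaces [L_γ, L_{-γ}]. -/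
theorem lie_eq_zero_of_mem_rootSubalgebra {W : Submodule F V} {Φ : Set (Dual F H)}
    (hΦ : ∀ γ ∈ Φ, -γ ∈ Φ) (h : ∀ γ ∈ Φ, ∀ e ∈ weightSpace H L γ, ∀ w ∈ W, ⁅e, w⁆ = 0)
    {x : L} (hx : x ∈ rootSubalgebra H Φ) {w : V} (hw : w ∈ W) : ⁅x, w⁆ = 0 := by
  let A : LieSubalgebra F L :=
    { carrier := {x | ∀ w ∈ W, ⁅x, w⁆ = 0}
      add_mem' := fun hx hy w hw => by rw [add_lie, hx w hw, hy w hw, add_zero]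
      zero_mem' := fun w _ => zero_lie w
      smul_mem' := fun r x hx w hw => by rw [smul_lie, hx w hw, smul_zero]
      lie_mem' := fun hx hy w hw => by rw [lie_lie, hx w hw, hy w hw, lie_zero, lie_zero, sub_zero] }
  have hA : rootSum H Φ ≤ A.toSubmodule := by
    refine rootSum_le_iff.2 fun γ hγ => ⟨h γ hγ, Submodule.span_le.2 ?_⟩
    rintro _ ⟨x, hx, y, hy, rfl⟩
    exact A.lie_mem (h γ hγ x hx) (h _ (hΦ γ hγ) y hy)
  exact (LieSubalgebra.lieSpan_le.2 hA : rootSubalgebra H Φ ≤ A) hx w hw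

theorem IsSplitting.restrict_apply_coroot (hc : IsSplitting H P c) (hS : IsSubsystem P S)
    (hfull : IsFull P S) {k : ι} (hk : k ∈ sdiv P S) (i : ι) :
    restrict H (rootSubalgebra H (P.root '' sdiv P S)) (P.root i)
      ⟨⟨c k, hc.coroot_mem hS hfull hk⟩, (c k).2⟩ = (P.pairingIn ℤ i k : F) := by
  rw [restrict_apply]
  exact hc.root_apply ((mem_sdiv_iff_of_isFull hfull hk.1).1 hk) i

/-- The coroot of i, or of 2i when the latter is in `S`, lies in the smaller Cartan subalgebra and
pairs with i to 2 or 1. -/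
theorem IsSplitting.restrict_ne_zero (hc : IsSplitting H P c) (hS : IsSubsystem P S)
    (hfull : IsFull P S) {i : ι} (hi : i ∈ S) :
    restrict H (rootSubalgebra H (P.root '' sdiv P S)) (P.root i) ≠ 0 := by
  obtain ⟨k, hk, hp⟩ : ∃ k ∈ sdiv P S, P.pairingIn ℤ i k ≠ 0 := by
    obtain ⟨k, hk, rfl | h⟩ := exists_mem_sdiv (P := P) hi
    · exact ⟨k, hk, by simp⟩
    · exact ⟨k, hk, by rw [((P.pairingIn_one_four_iff ℤ i k).2 h).1]; exact one_ne_zero⟩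
  intro h0
  have := hc.restrict_apply_coroot hS hfull hk i
  rw [h0, LinearMap.zero_apply, eq_comm, Int.cast_eq_zero] at this
  exact hp this

theorem mem_weightSpace_restrict {G : LieSubalgebra F L} {μ : Dual F H} {v : V}
    (hv : v ∈ weightSpace H V μ) : v ∈ weightSpace (cartanIn H G) V (restrict H G μ) :=
  fun h => hv ⟨((h : G) : L), h.2⟩

theorem nonzeroWeights_submodule (hΛ : weights F H V ⊆ insert 0 (Set.range P.root))
    (U : LieSubmodule F L V) : nonzeroWeights F H U = P.root '' weightIndices P U := by
  ext μ
  constructor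
  · rintro ⟨hμ, h0⟩
    obtain h | ⟨i, rfl⟩ := hΛ (weights_submodule_subset U hμ)
    · exact absurd h h0
    · exact ⟨i, hμ, rfl⟩
  · rintro ⟨i, hi, rfl⟩
    exact ⟨hi, P.ne_zero i⟩

/-- The roots in `S` that are weights of a submodule of the subalgebra attached to `S`. -/
def subIndices (P : RootPairing ι F (Dual F H) N) (S : Set ι) (W : Set V) : Set ι :=
  {i ∈ S | ∃ w ∈ W, w ≠ 0 ∧ w ∈ weightSpace H V (P.root i)}

/-- A weight vector of maximal length in a submodule is extremal. -/
theorem isExtremal_of_max (hΛ : weights F H V ⊆ insert 0 (Set.range P.root))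
    (hfull : IsFull P S) {W : LieSubmodule F (rootSubalgebra H (P.root '' sdiv P S)) V} {i : ι}
    (hi : i ∈ S) (hmax : ∀ j ∈ subIndices P S (W : Set V), inn P j j ≤ inn P i i)
    {w : V} (hwW : w ∈ W) (hw : w ∈ weightSpace H V (P.root i)) :
    IsExtremal P (sdiv P S) i w := by
  refine ⟨hw, fun γ hγ h0 e he => ?_⟩
  by_contra hne
  have hW : ⁅e, w⁆ ∈ W := W.lie_mem (x := ⟨e, mem_rootSubalgebra hγ he⟩) hwW
  have hwt := lie_mem_weightSpace he hw
  obtain hz | ⟨k, hk⟩ := hΛ (mem_weights hne hwt)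
  · have h1 : P.root i = P.root (P.reflectionPerm γ γ) := by
      rw [neg_root]; exact eq_neg_of_add_eq_zero_right hz
    rw [P.root.injective h1, P.pairingIn_reflectionPerm_self_left] at h0
    simp at h0
  · rw [← hk] at hwt
    -- Fullness keeps i + γ inside `S`, where the maximality of i applies.
    have hkS : k ∈ S := hfull k (by
      rw [hk]; exact add_mem (HasType.mem_span hγ.1) (HasType.mem_span hi))
    have h1 := hmax k ⟨hkS, _, hW, hne, hwt⟩
    have h2 := inn_add_self P hk
    have h3 := (inn_nonneg_iff i γ).2 h0
    rw [inn_comm] at h3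
    have h4 := inn_self_pos P γ
    linarith

end Subalgebra

end RootGraded

/-! ### The main theorem -/

open RootGraded in
theorem proposition2p26
    {F L ι N V₁ : Type*} [Field F] [CharZero F]
    -- the Lie algebra `𝒢₁ = L` and its splitting Cartan subalgebra `ℋ₁ = H`
    [LieRing L] [LieAlgebra F L] [FiniteDimensional F L] [LieAlgebra.IsSimple F L]
    (H : LieSubalgebra F L) (hH : IsSplittingCartan H)
    -- the finite irreducible root system `R₁` in the dual of `H`; `(R₁)_sdiv` is that of `L`
    [Finite ι] [AddCommGroup N] [Module F N]
    (P : RootPairing ι F (Module.Dual F H) N) [P.IsRootSystem] [P.IsCrystallographic]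
    (hP : IsConnected P Set.univ)
    (hR : weights F H L = insert 0 (P.root '' sdiv P Set.univ))
    -- the irreducible full subsystem `R₂` of rank greater than `1`
    (S : Set ι) (hS : IsSubsystem P S) (hSfull : IsFull P S) (hSconn : IsConnected P S)
    (hSrank : 1 < rootRank P S)
    -- the common classical type
    (X : ClassicalType) (hX₁ : HasType P Set.univ X) (hX₂ : HasType P S X)
    -- the Lie algebra `𝒢₂`; its subalgebra `ℋ₂` is `cartanIn H G₂`
    (G₂ : LieSubalgebra F L) (hG₂ : G₂ = rootSubalgebra H (P.root '' sdiv P S))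
    -- the modules `𝒱₁` and `𝒱₂ ⊆ 𝒱₁`
    [AddCommGroup V₁] [Module F V₁] [LieRingModule L V₁] [LieModule F L V₁]
    (hV₁ : HasWeightDecomposition F H V₁)
    (V₂ : LieSubmodule F G₂ V₁)
    (hV₂ : HasWeightDecomposition F (cartanIn H G₂) V₂)
    (hΛ₁ : weights F H V₁ ⊆ insert 0 (Set.range P.root))
    (hΛ₂ : weights F (cartanIn H G₂) V₂ ⊆ restrict H G₂ '' insert 0 (P.root '' S))
    (hV₂V₁ : ∀ i ∈ S, restrict H G₂ (P.root i) ∈ weights F (cartanIn H G₂) V₂ →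
      ∀ v ∈ weightSpace (cartanIn H G₂) V₂ (restrict H G₂ (P.root i)),
        (v : V₁) ∈ weightSpace H V₁ (P.root i))
    -- the nontrivial finite dimensional irreducible submodule `𝒲` of `𝒱₂`
    (W : LieSubmodule F G₂ V₁) (hWV₂ : W ≤ V₂) [FiniteDimensional F W]
    (hWirr : LieModule.IsIrreducible F G₂ W) (hWnontriv : ¬ LieModule.IsTrivial G₂ W)
    -- the submodule `𝒰` generated by `𝒲`
    (U : LieSubmodule F L V₁) (hU : U = LieSubmodule.lieSpan F L (W : Set V₁)) :
    FiniteDimensional F U ∧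
    LieModule.IsIrreducible F L U ∧
    HasWeightDecomposition F H U ∧
    (nonzeroWeights F (cartanIn H G₂) W = restrict H G₂ '' (P.root '' short P S) →
      nonzeroWeights F H U = P.root '' short P Set.univ) ∧
    (nonzeroWeights F (cartanIn H G₂) W = restrict H G₂ '' (P.root '' sdiv P S) →
      nonzeroWeights F H U = P.root '' sdiv P Set.univ) ∧
    (nonzeroWeights F (cartanIn H G₂) W = restrict H G₂ '' (P.root '' short P (sdiv P S)) →
      nonzeroWeights F H U = P.root '' short P (sdiv P Set.univ)) := by
  have := Fintype.ofFinite ι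
  have h3 := hX₁.pairingIn_ne_three
  have hlen := exists_length_eq hP hSrank hX₁ hX₂
  obtain ⟨c, hc⟩ := exists_isSplitting hH hR
  subst hG₂
  -- the nonzero weights of `W` come from roots in `S`
  have hroot : ∀ w ∈ W, w ≠ 0 → ∀ j ∈ S,
      (∀ h : cartanIn H (rootSubalgebra H (P.root '' sdiv P S)), ⁅(h : rootSubalgebra H (P.root '' sdiv P S)), w⁆ = restrict H (rootSubalgebra H (P.root '' sdiv P S)) (P.root j) h • w) →
      w ∈ weightSpace H V₁ (P.root j) := by
    intro w hw hw0 j hj hwt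
    have h1 : (⟨w, hWV₂ hw⟩ : V₂) ∈ weightSpace (cartanIn H (rootSubalgebra H (P.root '' sdiv P S))) V₂ (restrict H (rootSubalgebra H (P.root '' sdiv P S)) (P.root j)) :=
      fun h => Subtype.ext (hwt h)
    exact hV₂V₁ j hj (mem_weights (fun h => hw0 (congrArg Subtype.val h)) h1) _ h1
  -- If no nonzero root occurred, the Cartan subalgebra of `G₂` would kill `W`. Then c_k kills both
  -- w and e w for e in L_k, so 2 e w = [c_k, e] w = 0, and `W` would be trivial.
  have hnonempty : (subIndices P S (W : Set V₁)).Nonempty := by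
    by_contra hempty
    rw [Set.not_nonempty_iff_eq_empty] at hempty
    have hzero : ∀ w ∈ W, ∀ h : cartanIn H (rootSubalgebra H (P.root '' sdiv P S)), ⁅(h : rootSubalgebra H (P.root '' sdiv P S)), w⁆ = 0 := by
      intro w hw h
      obtain ⟨s, v, hv, hsum⟩ := hV₂.exists_sum ⟨w, hWV₂ hw⟩
      have hvW := mem_of_sum_mem (N := (W.comap V₂.incl).toSubmodule)
        (fun (h : cartanIn H (rootSubalgebra H (P.root '' sdiv P S))) m hm => (W.comap V₂.incl).lie_mem (x := (h : rootSubalgebra H (P.root '' sdiv P S))) hm) s v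
        (fun α _ => hv α) (by rw [hsum]; exact hw)
      have hv0 : ∀ α ∈ s, ⁅h, v α⁆ = 0 := by
        intro α hα
        by_cases h0 : v α = 0
        · rw [h0, lie_zero]
        obtain ⟨β, rfl | ⟨j, hj, rfl⟩, rfl⟩ := hΛ₂ (mem_weights h0 (hv α))
        · rw [hv _ h, map_zero, LinearMap.zero_apply, zero_smul]
        · have hmem : j ∈ subIndices P S (W : Set V₁) :=
            ⟨hj, _, hvW _ hα, fun h => h0 (Subtype.ext h),
              hV₂V₁ j hj (mem_weights h0 (hv _)) _ (hv _)⟩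
          rw [hempty] at hmem
          exact absurd hmem (Set.notMem_empty j)
      have h1 : ⁅h, (⟨w, hWV₂ hw⟩ : V₂)⁆ = 0 := by
        rw [← hsum, lie_sum]
        exact Finset.sum_eq_zero hv0
      exact congrArg Subtype.val h1
    have hkill : ∀ k ∈ sdiv P S, ∀ e ∈ weightSpace H L (P.root k), ∀ w ∈ W, ⁅e, w⁆ = 0 := by
      intro k hk e he w hw
      have hck := hc.coroot_mem hS hSfull hk
      have h1 : ⁅(c k : L), w⁆ = 0 := hzero w hw ⟨⟨c k, hck⟩, (c k).2⟩
      have h2 : ⁅(c k : L), ⁅e, w⁆⁆ = 0 :=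
        hzero _ (W.lie_mem (x := ⟨e, mem_rootSubalgebra hk he⟩) hw) ⟨⟨c k, hck⟩, (c k).2⟩
      have h3 : ⁅(c k : L), e⁆ = P.root k (c k) • e := he (c k)
      rw [leibniz_lie, h1, lie_zero, add_zero, h3, smul_lie,
        hc.root_apply ((mem_sdiv_iff_of_isFull hSfull hk.1).1 hk), P.pairingIn_same] at h2
      exact (smul_eq_zero.1 h2).resolve_left (by norm_num)
    refine hWnontriv ⟨fun x w => Subtype.ext ?_⟩
    refine lie_eq_zero_of_mem_rootSubalgebra (W := W.toSubmodule)
      (Φ := P.root '' sdiv P S) ?_ ?_ x.2 w.2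
    · rintro _ ⟨k, hk, rfl⟩
      exact ⟨_, hS.sdiv k hk k hk, neg_root k⟩
    · rintro _ ⟨k, hk, rfl⟩
      exact hkill k hk
  obtain ⟨i, ⟨hi, w, hwW, hw0, hwt⟩, hmax⟩ := Set.exists_max_image _ (fun i => inn P i i)
    (Set.toFinite _) hnonempty
  have hw := (isExtremal_of_max hΛ₁ hSfull hi hmax hwW hwt).univ hc hΛ₁ hP h3 hS hSconn hSfull
    hlen hi
  obtain rfl : U = LieSubmodule.lieSpan F L {w} := by
    rw [hU]
    refine le_antisymm (LieSubmodule.lieSpan_le.2 ?_)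
      (LieSubmodule.lieSpan_mono (Set.singleton_subset_iff.2 hwW))
    -- By irreducibility the part of `W` inside the `L`-module generated by w is all of `W`, so w
    -- generates the same module as `W`.
    let E : LieSubmodule F (rootSubalgebra H (P.root '' sdiv P S)) W :=
      { carrier := {x | (x : V₁) ∈ LieSubmodule.lieSpan F L {w}}
        add_mem' := fun hx hy => (LieSubmodule.lieSpan F L {w}).add_mem hx hy
        zero_mem' := (LieSubmodule.lieSpan F L {w}).zero_mem
        smul_mem' := fun r x hx => (LieSubmodule.lieSpan F L {w}).smul_mem r hx
        lie_mem := fun {x m} hm =>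
          (LieSubmodule.lieSpan F L {w}).lie_mem (x := (x : L)) (m := (m : V₁)) hm }
    have hwE : (⟨w, hwW⟩ : W) ∈ E := LieSubmodule.subset_lieSpan rfl
    have : Nontrivial E := ⟨⟨⟨w, hwW⟩, hwE⟩, 0, fun h =>
      hw0 (congrArg (fun x : E => ((x : W) : V₁)) h)⟩
    have hE : E = ⊤ := LieSubmodule.eq_top_of_isIrreducible F _ W E
    intro x hx
    have : (⟨x, hx⟩ : W) ∈ E := by rw [hE]; trivial
    exact this
  have hset := hw.isWeightSet hc hΛ₁ hw0
  -- Two roots of `S` with the same restriction need not be equal a priori. But if t in T restricts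
  -- to the weight of w, then hypothesis (iii) gives w the full weight t, whence t = i.
  have hrestr : ∀ {T : Set ι}, T ⊆ S →
      nonzeroWeights F (cartanIn H (rootSubalgebra H (P.root '' sdiv P S))) W = restrict H (rootSubalgebra H (P.root '' sdiv P S)) '' (P.root '' T) → i ∈ T := by
    intro T hT hW
    have h1 : restrict H (rootSubalgebra H (P.root '' sdiv P S)) (P.root i) ∈ nonzeroWeights F (cartanIn H (rootSubalgebra H (P.root '' sdiv P S))) W :=
      ⟨mem_weights (m := (⟨w, hwW⟩ : W)) (fun h => hw0 (congrArg Subtype.val h))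
        fun h => Subtype.ext (mem_weightSpace_restrict hwt h), hc.restrict_ne_zero hS hSfull hi⟩
    rw [hW] at h1
    obtain ⟨_, ⟨t, ht, rfl⟩, hti⟩ := h1
    have h2 := hroot w hwW hw0 t (hT ht) fun h => by
      rw [hti]; exact mem_weightSpace_restrict hwt h
    rw [P.root.injective (eq_of_mem_weightSpace hw0 hwt h2)]
    exact ht
  rw [nonzeroWeights_submodule hΛ₁]
  refine ⟨hw.finiteDimensional hc hΛ₁, hw.isIrreducible hc hV₁ hΛ₁ h3 hw0, hV₁.submodule _,
    fun h => ?_, fun h => ?_, fun h => ?_⟩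
  · rw [hset.eq_short hP hS hSconn hlen (hrestr (fun _ h => h.1) h)]
  · rw [hset.eq_sdiv hP h3 hSfull hlen (hrestr (fun _ h => h.1) h)]
    -- Every root of `sdiv P S` occurs in `W` with its full weight, so the chosen i is longest among
    -- them.
    intro j hj
    have h1 : restrict H (rootSubalgebra H (P.root '' sdiv P S)) (P.root j) ∈ nonzeroWeights F (cartanIn H (rootSubalgebra H (P.root '' sdiv P S))) W := by
      rw [h]; exact ⟨_, ⟨j, hj, rfl⟩, rfl⟩
    obtain ⟨u, hu, hu0⟩ := exists_of_mem_weights h1.1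
    have hu0' : (u : V₁) ≠ 0 := fun h => hu0 (Subtype.ext h)
    exact hmax j ⟨hj.1, u, u.2, hu0', hroot u u.2 hu0' j hj.1 fun h =>
      congrArg Subtype.val (hu h)⟩
  · rw [hset.eq_short_sdiv hP h3 hS hSconn hSfull hlen (hrestr (fun _ h => h.1.1) h)]
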